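/- Let $(Q,\mathfrak m,\mathsf k)$ be a commutative Noetherian local ring with $\operatorname{char}\mathsf k=0$, and let $(f,g)$ be an exact pair of zero divisors in $Q$: $f,g\neq 0$, $\operatorname{ann}_Q(f)=(g)$ and $\operatorname{ann}_Q(g)=(f)$. Put $R=Q/(f)$ and $S=Q/(f,g)$. Let $M,N$ be finitely generated $R$-modules with $gN=0$ and $\ell(M\otimes_Q N)<\infty$. Then all the lengths $\ell(\operatorname{Tor}^Q_i(M,N))$ and $\ell(\operatorname{Tor}^R_i(M,N))$ are finite, and the power series $$P^Q_{M,N}(t)=\sum_{i\ge 0}\ell(\operatorname{Tor}^Q_i(M,N))\,t^i,\qquad P^R_{M,N}(t)=\sum_{i\ge 0}\ell(\operatorname{Tor}^R_i(M,N))\,t^i$$ satisfy the coefficientwise inequalities $$P^R_{M,N}(t)\preccurlyeq\frac{(1-t+t^2)\,P^Q_{M,N}(t)}{1-t},\qquad P^Q_{M,N}(t)\preccurlyeq\frac{P^R_{M,N}(t)}{1-t}.$$ Furthermore, equality holds in the second inequality if and only if the maps $\mu^N$ and $\delta^N$ are both zero (in all degrees). These maps are defined as follows. Let $A=Q\langle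 y,t\mid\partial y=f,\ \partial t=gy\rangle$ be the Tate resolution of $R$ over $Q$ ($y$ an exterior variable of degree $1$, $t$ a divided powers variable of degree $2$), with $Q$-basis $y_{2i}=t^{(i)}$, $y_{2i+1}=t^{(i)}y$. There exists a free resolution $U$ of $M$ over $Q$ that has a structure of semi-free dg module over $A$; choose any such $U$ and any homogeneous basis of it over $A$, let $V_n$ be the free $Q$-module spanned by the basis elements of degree $n$, so that $U_n=\bigoplus_{i=0}^{n}y_iV_{n-i}$, and let $\partial^V_n\colon V_n\to V_{n-1}$ be the restriction of the differential of $U$ to $V_n$ followed by the projection $U_{n-1}\to V_{n-1}$. Then $(V\otimes_QR,\partial^V\otimes_Q R)$ is a free resolution of $M$ over $R$, and $\partial^V\partial^V=f\widetilde\tau$ for some maps $\widetilde\tau\colon V_{n+2}\to V_n$. The Eisenbud operator $\tau=\widetilde\tau\otimes_QS$ is a chain map of degree $-2$ on $V\otimes_QS$. Let $W$ be its mapping cone: $W_n=(V_{n-1}\oplus V_n)\otimes_QS$ with differential induced by $(a,b)\mapsto(-\partial^V a-\widetilde\tau b,\ \partial^V b)$. With $\operatorname{Tor}^R_n(M,N)=H_n((V\otimes_QS)\otimes_SN)$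 and $\operatorname{Tor}^Q_n(M,N)=H_n((U\otimes_QS)\otimes_SN)$: * $\delta^N_n\colon\operatorname{Tor}^R_n(M,N)\to\operatorname{Tor}^R_{n-2}(M,N)$ is the map induced by $\tau$; * $\mu^N_{n+1}\colon H_{n+1}(W\otimes_SN)\to\operatorname{Tor}^Q_{n-2}(M,N)$ is the connecting homomorphism of the short exact sequence of complexes $0\to\Sigma^2U\otimes_QS\to U\otimes_QS\to W\to 0$ tensored over $S$ with $N$, where the first map is multiplication by $y_2=t$ and the second sends $b+ya+l$, with $b\in V_n$, $a\in V_{n-1}$, $l\in\bigoplus_{i\ge2}y_iV_{n-i}$, to $(a,b)$. The equivalence holds for every choice of $U$, of its $A$-structure and of its basis. -/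

import Mathlib

open CategoryTheory MonoidalCategory TensorProduct

universe u

noncomputable section

/-! ### Exact pairs of zero divisors, generalized Poincaré series -/

/-- `(f, g)` is an exact pair of zero divisors of `Q`: both are nonzero, `ann (f) = (g)` and
`ann (g) = (f)`. -/
structure IsExactPair {Q : Type u} [CommRing Q] (f g : Q) : Prop where
  left_ne_zero : f ≠ 0
  right_ne_zero : g ≠ 0
  ann_left : Ideal.torsionOf Q Q f = Ideal.span {g}
  ann_right : Ideal.torsionOf Q Q g = Ideal.span {f}

/-- The `A`-module `Tor_n^A(M, N)`, computed by resolving the first argument. -/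
abbrev torModule (A : Type u) [CommRing A] (M N : Type u) [AddCommGroup M] [Module A M]
    [AddCommGroup N] [Module A N] (n : ℕ) : ModuleCat.{u} A :=
  ((Tor' (ModuleCat.{u} A) n).obj (ModuleCat.of A M)).obj (ModuleCat.of A N)

/-- The generalized Poincaré series `∑ ℓ(Tor_n^A(M, N)) tⁿ`, meaningful when all these
lengths are finite. -/
def poincareSeries (A : Type u) [CommRing A] (M N : Type u) [AddCommGroup M] [Module A M]
    [AddCommGroup N] [Module A N] : PowerSeries ℝ :=
  PowerSeries.mk fun n => ((Module.length A (torModule A M N n)).toNat : ℝ)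

/-- Coefficientwise inequality of real formal power series. -/
def CoeffLE (p q : PowerSeries ℝ) : Prop :=
  ∀ n, PowerSeries.coeff n p ≤ PowerSeries.coeff n q

/-! ### The Tate resolution and dg modules over it

For an exact pair of zero divisors `(f, g)` the Tate resolution of `Q/(f)` over `Q` is the dg
algebra `A = Q⟨y, t ∣ ∂y = f, ∂t = g y⟩`, free over `Q` on the elements `y_{2i} = t^{(i)}` and
`y_{2i+1} = t^{(i)} y` (with `|y_i| = i`). We record its structure constants in this basis. -/

/-- `y_i y_j = tateMul i j • y_{i+j}` in the Tate resolution. -/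
def tateMul (i j : ℕ) : ℕ :=
  if i % 2 = 1 ∧ j % 2 = 1 then 0 else (i / 2 + j / 2).choose (i / 2)

/-- `∂ y_{i+1} = tateD f g i • y_i` in the Tate resolution. -/
def tateD {Q : Type u} (f g : Q) (i : ℕ) : Q := if i % 2 = 0 then f else g

variable {Q : Type u} [CommRing Q]

/-- A dg module structure over the Tate resolution `A` on a nonnegatively graded complex `U` of
`Q`-modules: the action of the basis elements `y_i`, which is unitary and associative and
satisfies the Leibniz rule `∂(y_i x) = ∂(y_i) x + (-1)^i y_i ∂(x)`. -/
structure TateDGModule (f g : Q) (U : ChainComplex (ModuleCat.{u} Q) ℕ) where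
  /-- the action of `y_i` -/
  y : ∀ (i : ℕ) {n m : ℕ}, i + n = m → (U.X n →ₗ[Q] U.X m)
  one_act : ∀ {n : ℕ} (x : U.X n), y 0 (Nat.zero_add n) x = x
  mul_act : ∀ {i j n m p : ℕ} (hj : j + n = m) (hi : i + m = p) (hij : i + j + n = p)
    (x : U.X n), y i hi (y j hj x) = tateMul i j • y (i + j) hij x
  leibniz_zero : ∀ (i : ℕ) (x : U.X 0),
    (U.d (i + 1) i).hom (y (i + 1) (Nat.add_zero (i + 1)) x) =
      tateD f g i • y i (Nat.add_zero i) x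
  leibniz_succ : ∀ {i n m : ℕ} (h : i + (n + 1) = m) (h' : i + 1 + (n + 1) = m + 1)
    (h'' : i + 1 + n = m) (x : U.X (n + 1)),
    (U.d (m + 1) m).hom (y (i + 1) h' x) =
      tateD f g i • y i h x + (-1 : Q) ^ (i + 1) • y (i + 1) h'' ((U.d (n + 1) n).hom x)

/-- A free resolution `U` of `M` over `Q` with a structure of semi-free dg module over the Tate
resolution `A`. The datum of a homogeneous basis of `U^#` over `A^#` enters through the free
`Q`-modules `V_n` spanned by its elements of degree `n`, so that `U_n = ⨁_{j ≤ n} y_{n-j} V_j`,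
with `y_{n-j}` injective on `V_j`. -/
structure SemifreeResolution (f g : Q) (M : Type u) [AddCommGroup M] [Module Q M] where
  /-- the resolution of `M` -/
  res : ProjectiveResolution (ModuleCat.of Q M)
  /-- the dg module structure -/
  dg : TateDGModule f g res.complex
  /-- the span of the basis elements of degree `n` -/
  V : ∀ n, Submodule Q (res.complex.X n)
  free : ∀ n, Module.Free Q (V n)
  bijective : ∀ n, Function.Bijective fun v : (∀ j : Fin (n + 1), V j) =>
    ∑ j : Fin (n + 1), dg.y (n - j) (Nat.sub_add_cancel (Nat.le_of_lt_succ j.2)) (v j : res.complex.X j)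

/-! ### Generalities on complexes -/

/-- The modules of the double shift `Σ²C`. -/
def shiftTwoX (C : ChainComplex (ModuleCat.{u} Q) ℕ) : ℕ → ModuleCat.{u} Q
  | 0 => ModuleCat.of Q PUnit
  | 1 => ModuleCat.of Q PUnit
  | n + 2 => C.X n

/-- The differentials of the double shift `Σ²C`. -/
def shiftTwoD (C : ChainComplex (ModuleCat.{u} Q) ℕ) :
    ∀ i j, shiftTwoX C i ⟶ shiftTwoX C j
  | i + 2, j + 2 => C.d i j
  | 0, _ => 0
  | 1, _ => 0
  | _ + 2, 0 => 0
  | _ + 2, 1 => 0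

/-- The double shift `Σ²C`, that is `(Σ²C)_n = C_{n-2}` with the same differentials. -/
def shiftTwo (C : ChainComplex (ModuleCat.{u} Q) ℕ) : ChainComplex (ModuleCat.{u} Q) ℕ where
  X := shiftTwoX C
  d := shiftTwoD C
  shape i j h := by
    match i, j with
    | i + 2, j + 2 =>
      exact C.shape _ _ (by simp only [ComplexShape.down_Rel] at h ⊢; omega)
    | 0, _ => rfl
    | 1, _ => rfl
    | _ + 2, 0 => rfl
    | _ + 2, 1 => rfl
  d_comp_d' i j k _ _ := by
    match i, j, k with
    | i + 2, j + 2, k + 2 => exact C.d_comp_d _ _ _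
    | 0, _, _ => exact Limits.zero_comp
    | 1, _, _ => exact Limits.zero_comp
    | _ + 2, 0, _ => exact Limits.zero_comp
    | _ + 2, 1, _ => exact Limits.zero_comp
    | _ + 2, _ + 2, 0 => exact Limits.comp_zero
    | _ + 2, _ + 2, 1 => exact Limits.comp_zero

/-- The functor `- ⊗_Q S` with `S = Q/(f, g)`, seen in `Q`-modules. -/
abbrev tensorS (f g : Q) : ModuleCat.{u} Q ⥤ ModuleCat.{u} Q :=
  tensorRight (ModuleCat.of Q (Q ⧸ Ideal.span {f, g}))

/-- The functor `- ⊗_Q N`. On modules over a quotient `S` of `Q` this is `- ⊗_S N` as soon as `N`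
is an `S`-module. -/
abbrev tensorN (N : Type u) [AddCommGroup N] [Module Q N] : ModuleCat.{u} Q ⥤ ModuleCat.{u} Q :=
  tensorRight (ModuleCat.of Q N)

/-- Two maps that agree modulo `(f, g)` agree after tensoring with `S = Q/(f, g)`. -/
lemma tensorS_map_eq {f g : Q} {X Y : ModuleCat.{u} Q} (φ ψ : X ⟶ Y)
    (h : ∀ x, φ.hom x - ψ.hom x ∈ Ideal.span {f, g} • (⊤ : Submodule Q Y)) :
    (tensorS f g).map φ = (tensorS f g).map ψ := by
  have key : ∀ z ∈ Ideal.span {f, g} • (⊤ : Submodule Q Y), ∀ s : Q ⧸ Ideal.span {f, g},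
      z ⊗ₜ[Q] s = 0 := by
    intro z hz s
    refine Submodule.smul_induction_on hz (fun r hr n _ => ?_) (fun a b ha hb => ?_)
    · rw [TensorProduct.smul_tmul]
      have : r • s = 0 := by
        rw [Algebra.smul_def, Ideal.Quotient.algebraMap_eq,
          Ideal.Quotient.eq_zero_iff_mem.2 hr, zero_mul]
      rw [this, TensorProduct.tmul_zero]
    · rw [TensorProduct.add_tmul, ha, hb, add_zero]
  refine ModuleCat.hom_ext (TensorProduct.ext' fun x s => ?_)
  have := key _ (h x) s
  rw [TensorProduct.sub_tmul, sub_eq_zero] at this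
  exact this

lemma mem_smul_top_of_smul_eq_zero {f g : Q} (hfg : IsExactPair f g) {X : Type u}
    [AddCommGroup X] [Module Q X] [Module.Free Q X] (x : X) (hx : f • x = 0) :
    x ∈ Ideal.span {f, g} • (⊤ : Submodule Q X) := by
  let b := Module.Free.chooseBasis Q X
  rw [← b.linearCombination_repr x, Finsupp.linearCombination_apply]
  refine Submodule.sum_mem _ fun i _ => Submodule.smul_mem_smul ?_ trivial
  have h1 : f * b.repr x i = 0 := by
    have := congrArg (fun z => b.repr z i) hx
    simpa using this
  have h2 : b.repr x i ∈ Ideal.torsionOf Q Q f := by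
    rw [Ideal.mem_torsionOf_iff, smul_eq_mul, mul_comm]; exact h1
  rw [hfg.ann_left] at h2
  exact Ideal.span_mono (by simp) h2

namespace SemifreeResolution

variable {f g : Q} {M : Type u} [AddCommGroup M] [Module Q M] (D : SemifreeResolution f g M)

/-! ### The decomposition `U_n = V_n ⊕ y V_{n-1} ⊕ L_n` and the lifting `(V, ∂^V)` -/

/-- The complex `U`. -/
abbrev U : ChainComplex (ModuleCat.{u} Q) ℕ := D.res.complex

/-- The isomorphism `⨁_{j ≤ n} V_j ≃ U_n`, `(v_j) ↦ ∑ y_{n-j} v_j`. -/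
def decomp (n : ℕ) : (∀ j : Fin (n + 1), D.V j) ≃ₗ[Q] D.U.X n :=
  LinearEquiv.ofBijective
    (∑ j : Fin (n + 1), D.dg.y (n - j) (Nat.sub_add_cancel (Nat.le_of_lt_succ j.2)) ∘ₗ
      (D.V j).subtype ∘ₗ LinearMap.proj j)
    (by
      convert D.bijective n using 1
      ext v
      simp [LinearMap.sum_apply])

/-- The projection `π_n : U_n → V_n`. -/
def pr (n : ℕ) : D.U.X n →ₗ[Q] D.V n :=
  LinearMap.proj (φ := fun j : Fin (n + 1) => D.V j) (Fin.last n) ∘ₗ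
    (D.decomp n).symm.toLinearMap

/-- The map `U_{n+1} → V_n` that takes the coefficient of `y = y_1`. -/
def prY (n : ℕ) : D.U.X (n + 1) →ₗ[Q] D.V n :=
  LinearMap.proj (φ := fun j : Fin (n + 2) => D.V j) (Fin.castSucc (Fin.last n)) ∘ₗ
    (D.decomp (n + 1)).symm.toLinearMap

/-- `∂^V_{n+1} : V_{n+1} → V_n`, the restriction of `π_n ∂_{n+1}`. -/
def dV (n : ℕ) : D.V (n + 1) →ₗ[Q] D.V n :=
  D.pr n ∘ₗ (D.U.d (n + 1) n).hom ∘ₗ (D.V (n + 1)).subtype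

lemma decomp_symm_y {n : ℕ} (j : Fin (n + 1)) (h : n - j + j = n) (v : D.V j) :
    (D.decomp n).symm (D.dg.y (n - j) h (v : D.U.X j)) = Pi.single j v := by
  rw [LinearEquiv.symm_apply_eq]
  simp only [decomp, LinearEquiv.ofBijective_apply, LinearMap.sum_apply, LinearMap.comp_apply,
    LinearMap.proj_apply, Submodule.subtype_apply]
  rw [Finset.sum_eq_single j]
  · simp
  · intro k _ hk
    rw [Pi.single_eq_of_ne hk]
    simp
  · simp

/-- The elements `y_i v` with `v ∈ V_j` span. -/
lemma mem_of_gen {n : ℕ} (p : Submodule Q (D.U.X n))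
    (h : ∀ (i j : ℕ) (hij : i + j = n) (v : D.V j), D.dg.y i hij (v : D.U.X j) ∈ p)
    (x : D.U.X n) : x ∈ p := by
  obtain ⟨v, rfl⟩ := (D.bijective n).2 x
  exact Submodule.sum_mem _ fun j _ => h _ _ _ _

lemma pr_coe {n : ℕ} (v : D.V n) : D.pr n (v : D.U.X n) = v := by
  have h := D.decomp_symm_y (Fin.last n) (by simp) v
  have e : ∀ (i : ℕ) (hi : i = 0) (h : i + n = n), D.dg.y i h (v : D.U.X n) = v := by
    rintro i rfl h
    exact D.dg.one_act _
  have e' := e (n - (Fin.last n : ℕ)) (by simp) (by simp)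
  have h2 : (D.decomp n).symm (v : D.U.X n) = Pi.single (Fin.last n) v := by
    rw [← h]; exact congrArg _ e'.symm
  change (D.decomp n).symm (v : D.U.X n) (Fin.last n) = v
  rw [h2, Pi.single_eq_same]

lemma decomp_symm_y' {n i j : ℕ} (hij : i + j = n) (v : D.V j) :
    (D.decomp n).symm (D.dg.y i hij (v : D.U.X j)) =
      Pi.single (M := fun j : Fin (n + 1) => D.V j) ⟨j, by omega⟩ v := by
  obtain rfl : i = n - j := by omega
  exact D.decomp_symm_y ⟨j, by omega⟩ hij v

lemma pr_y_gen {n i j : ℕ} (hi : 0 < i) (hij : i + j = n) (v : D.V j) :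
    D.pr n (D.dg.y i hij (v : D.U.X j)) = 0 := by
  change (D.decomp n).symm _ (Fin.last n) = 0
  rw [D.decomp_symm_y', Pi.single_eq_of_ne]
  simp only [ne_eq, Fin.ext_iff, Fin.val_last]; omega

lemma prY_y_gen {n i j : ℕ} (hi : i ≠ 1) (hij : i + j = n + 1) (v : D.V j) :
    D.prY n (D.dg.y i hij (v : D.U.X j)) = 0 := by
  change (D.decomp (n + 1)).symm _ (Fin.castSucc (Fin.last n)) = 0
  rw [D.decomp_symm_y', Pi.single_eq_of_ne]
  simp only [ne_eq, Fin.ext_iff, Fin.val_castSucc, Fin.val_last]; omega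

lemma prY_y_one_coe {n : ℕ} (h : 1 + n = n + 1) (v : D.V n) :
    D.prY n (D.dg.y 1 h (v : D.U.X n)) = v := by
  change (D.decomp (n + 1)).symm _ (Fin.castSucc (Fin.last n)) = v
  rw [D.decomp_symm_y']
  exact Pi.single_eq_same (M := fun j : Fin (n + 2) => D.V j) (Fin.castSucc (Fin.last n)) v

lemma prY_coe {n : ℕ} (v : D.V (n + 1)) : D.prY n (v : D.U.X (n + 1)) = 0 := by
  have := D.prY_y_gen (i := 0) (by omega) (Nat.zero_add _) v
  rwa [D.dg.one_act] at this

/-- `π` kills `y_i U` for `i > 0`. -/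
lemma pr_y {n i m : ℕ} (hi : 0 < i) (h : i + m = n) (x : D.U.X m) :
    D.pr n (D.dg.y i h x) = 0 := by
  refine D.mem_of_gen (LinearMap.ker (D.pr n ∘ₗ D.dg.y i h)) (fun k j hk v => ?_) x
  rw [LinearMap.mem_ker, LinearMap.comp_apply, D.dg.mul_act hk h (by omega), map_nsmul,
    D.pr_y_gen (by omega), smul_zero]

/-- The `y`-component vanishes on `y_i U` for `i > 1`. -/
lemma prY_y {n i m : ℕ} (hi : 1 < i) (h : i + m = n + 1) (x : D.U.X m) :
    D.prY n (D.dg.y i h x) = 0 := by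
  refine D.mem_of_gen (LinearMap.ker (D.prY n ∘ₗ D.dg.y i h)) (fun k j hk v => ?_) x
  rw [LinearMap.mem_ker, LinearMap.comp_apply, D.dg.mul_act hk h (by omega), map_nsmul,
    D.prY_y_gen (by omega), smul_zero]

lemma prY_y_one {n : ℕ} (h : 1 + n = n + 1) (x : D.U.X n) :
    D.prY n (D.dg.y 1 h x) = D.pr n x := by
  refine sub_eq_zero.1 (D.mem_of_gen (LinearMap.ker (D.prY n ∘ₗ D.dg.y 1 h - D.pr n))
    (fun k j hk v => ?_) x)
  rw [LinearMap.mem_ker, LinearMap.sub_apply, LinearMap.comp_apply,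
    D.dg.mul_act hk h (by omega), map_nsmul]
  rcases Nat.eq_zero_or_pos k with rfl | hk0
  · obtain rfl : j = n := by omega
    rw [D.dg.one_act, D.pr_coe, D.prY_y_one_coe]
    simp [tateMul]
  · rw [D.prY_y_gen (by omega), D.pr_y_gen hk0, smul_zero, sub_zero]

/-! ### The Eisenbud operator -/

lemma pr_d {n : ℕ} (x : D.U.X (n + 1)) :
    D.pr n ((D.U.d (n + 1) n).hom x) = D.dV n (D.pr (n + 1) x) + f • D.prY n x := by
  refine sub_eq_zero.1 (D.mem_of_gen (LinearMap.ker (D.pr n ∘ₗ (D.U.d (n + 1) n).hom -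
    (D.dV n ∘ₗ D.pr (n + 1) + f • D.prY n))) (fun i j hij v => ?_) x)
  rw [LinearMap.mem_ker, LinearMap.sub_apply, LinearMap.add_apply, LinearMap.smul_apply,
    LinearMap.comp_apply, LinearMap.comp_apply, sub_eq_zero]
  rcases i with _ | k
  · obtain rfl : j = n + 1 := by omega
    rw [D.dg.one_act, D.pr_coe, D.prY_coe, smul_zero, add_zero]
    rfl
  · rw [D.pr_y (Nat.succ_pos k), map_zero, zero_add]
    rcases j with _ | j
    · obtain rfl : k = n := by omega
      rw [D.dg.leibniz_zero k (v : D.U.X 0), map_smul]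
      rcases Nat.eq_zero_or_pos k with rfl | hk
      · rw [D.dg.one_act, D.pr_coe, D.prY_y_one_coe]
        simp [tateD]
      · rw [D.pr_y hk, D.prY_y (by omega), smul_zero, smul_zero]
    · rw [D.dg.leibniz_succ (by omega) hij (by omega) (v : D.U.X (j + 1)), map_add, map_smul,
        map_smul, D.pr_y (Nat.succ_pos k), smul_zero, add_zero]
      rcases Nat.eq_zero_or_pos k with rfl | hk
      · obtain rfl : j + 1 = n := by omega
        rw [D.dg.one_act, D.pr_coe, D.prY_y_one_coe]
        simp [tateD]
      · rw [D.pr_y hk, D.prY_y (by omega), smul_zero, smul_zero]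

lemma dV_dV {n : ℕ} (v : D.V (n + 2)) :
    D.dV n (D.dV (n + 1) v) = f • -D.prY n ((D.U.d (n + 2) (n + 1)).hom (v : D.U.X (n + 2))) := by
  have h := D.pr_d ((D.U.d (n + 2) (n + 1)).hom (v : D.U.X (n + 2)))
  have h0 : (D.U.d (n + 1) n).hom ((D.U.d (n + 2) (n + 1)).hom (v : D.U.X (n + 2))) = 0 := by
    rw [← LinearMap.comp_apply, ← ModuleCat.hom_comp, D.U.d_comp_d]
    rfl
  rw [h0, map_zero] at h
  rw [smul_neg]
  exact eq_neg_of_add_eq_zero_left h.symm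

/-- The composition `∂^V ∂^V` is divisible by `f`. -/
lemma exists_tauLift : ∃ τ : ∀ n, D.V (n + 2) →ₗ[Q] D.V n,
    ∀ n, D.dV n ∘ₗ D.dV (n + 1) = f • τ n :=
  ⟨fun n => -(D.prY n ∘ₗ (D.U.d (n + 2) (n + 1)).hom ∘ₗ (D.V (n + 2)).subtype),
    fun _ => LinearMap.ext fun v => D.dV_dV v⟩

/-- A map `τ̃` with `∂^V ∂^V = f τ̃`. When `ann (f) ⊆ (f, g)`, it is unique modulo `(f, g)`. -/
def tauLift : ∀ n, D.V (n + 2) →ₗ[Q] D.V n := D.exists_tauLift.choose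

lemma tauLift_spec {n : ℕ} (v : D.V (n + 2)) : D.dV n (D.dV (n + 1) v) = f • D.tauLift n v :=
  LinearMap.congr_fun (D.exists_tauLift.choose_spec n) v

lemma smul_mem_top {X : Type u} [AddCommGroup X] [Module Q X] (x : X) :
    f • x ∈ Ideal.span {f, g} • (⊤ : Submodule Q X) :=
  Submodule.smul_mem_smul (Ideal.subset_span (by simp)) trivial

lemma smul_mem_top' {X : Type u} [AddCommGroup X] [Module Q X] (x : X) :
    g • x ∈ Ideal.span {f, g} • (⊤ : Submodule Q X) :=
  Submodule.smul_mem_smul (Ideal.subset_span (by simp)) trivial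

lemma tauLift_add_mem (hfg : IsExactPair f g) {n : ℕ} (v : D.V (n + 2)) :
    D.tauLift n v + D.prY n ((D.U.d (n + 2) (n + 1)).hom (v : D.U.X (n + 2))) ∈
      Ideal.span {f, g} • (⊤ : Submodule Q (D.V n)) := by
  have := D.free n
  refine mem_smul_top_of_smul_eq_zero hfg _ ?_
  rw [smul_add, ← D.tauLift_spec, D.dV_dV, smul_neg, neg_add_cancel]

lemma tauLift_dV_mem (hfg : IsExactPair f g) {n : ℕ} (v : D.V (n + 3)) :
    D.tauLift n (D.dV (n + 2) v) - D.dV n (D.tauLift (n + 1) v) ∈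
      Ideal.span {f, g} • (⊤ : Submodule Q (D.V n)) := by
  have := D.free n
  refine mem_smul_top_of_smul_eq_zero hfg _ ?_
  rw [smul_sub, ← D.tauLift_spec, ← map_smul, ← D.tauLift_spec, sub_self]

/-- The complex `V ⊗_Q S`. -/
def VS : ChainComplex (ModuleCat.{u} Q) ℕ :=
  ChainComplex.of (fun n => (tensorS f g).obj (ModuleCat.of Q (D.V n)))
    (fun n => (tensorS f g).map (ModuleCat.ofHom (D.dV n)))
    (fun n => by
      rw [← Functor.map_comp, ← (tensorS f g).map_zero]
      refine tensorS_map_eq _ _ fun v => ?_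
      change D.dV n (D.dV (n + 1) v) - 0 ∈ _
      rw [sub_zero, D.tauLift_spec]
      exact smul_mem_top _)

lemma VS_d (n : ℕ) : D.VS.d (n + 1) n = (tensorS f g).map (ModuleCat.ofHom (D.dV n)) := by
  simp only [VS, ChainComplex.of_d]

/-- The components of the Eisenbud operator, as maps `V ⊗_Q S → Σ²(V ⊗_Q S)`. -/
def eisenbudX : ∀ n, D.VS.X n ⟶ shiftTwoX D.VS n
  | 0 => 0
  | 1 => 0
  | n + 2 => (tensorS f g).map (ModuleCat.ofHom (D.tauLift n))

/-- The Eisenbud operator `τ = τ̃ ⊗_Q S`, a chain map of degree `-2` on `V ⊗_Q S`. -/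
def eisenbud (hfg : IsExactPair f g) : D.VS ⟶ shiftTwo D.VS where
  f := D.eisenbudX
  comm' i j hij := by
    simp only [ComplexShape.down_Rel] at hij
    subst hij
    match j with
    | 0 => exact Limits.zero_comp.trans Limits.comp_zero.symm
    | 1 =>
      exact Limits.comp_zero.trans Limits.comp_zero.symm
    | n + 2 =>
      change (tensorS f g).map (ModuleCat.ofHom (D.tauLift (n + 1))) ≫ D.VS.d (n + 1) n =
        D.VS.d (n + 2 + 1) (n + 2) ≫ (tensorS f g).map (ModuleCat.ofHom (D.tauLift n))
      rw [D.VS_d n, D.VS_d (n + 2)]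
      refine ((tensorS f g).map_comp _ _).symm.trans (Eq.trans ?_ ((tensorS f g).map_comp _ _))
      refine (tensorS_map_eq _ _ fun v => ?_).symm
      exact D.tauLift_dV_mem hfg v

/-! ### The mapping cone -/

/-- `V_{n-1}`, which is zero for `n = 0`. -/
def prev : ℕ → ModuleCat.{u} Q
  | 0 => ModuleCat.of Q PUnit
  | n + 1 => ModuleCat.of Q (D.V n)

/-- `∂^V_n : V_n → V_{n-1}`. -/
def prevD : ∀ n, D.V n →ₗ[Q] D.prev n
  | 0 => 0
  | n + 1 => D.dV n

/-- `τ̃ : V_{n+1} → V_{n-1}`. -/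
def prevTau : ∀ n, D.V (n + 1) →ₗ[Q] D.prev n
  | 0 => 0
  | n + 1 => D.tauLift n

/-- The projection `U_n → V_{n-1}` that takes the coefficient of `y`. -/
def prevY : ∀ n, D.U.X n →ₗ[Q] D.prev n
  | 0 => 0
  | n + 1 => D.prY n

/-- `V_{n-1} ⊕ V_n`. -/
def coneX (n : ℕ) : ModuleCat.{u} Q := ModuleCat.of Q (D.prev n × D.V n)

/-- The map `V_n ⊕ V_{n+1} → V_{n-1} ⊕ V_n`, `(a, b) ↦ (-∂^V a - τ̃ b, ∂^V b)`. -/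
def coneD (n : ℕ) : D.coneX (n + 1) ⟶ D.coneX n :=
  ModuleCat.ofHom (X := D.V n × D.V (n + 1)) (Y := D.prev n × D.V n)
    (LinearMap.prod
      (-(D.prevD n ∘ₗ LinearMap.fst Q (D.V n) (D.V (n + 1))) -
        D.prevTau n ∘ₗ LinearMap.snd Q (D.V n) (D.V (n + 1)))
      (D.dV n ∘ₗ LinearMap.snd Q (D.V n) (D.V (n + 1))))

lemma prod_mem {I : Ideal Q} {X Y : Type u} [AddCommGroup X] [Module Q X] [AddCommGroup Y]
    [Module Q Y] {x : X} {y : Y} (hx : x ∈ I • (⊤ : Submodule Q X))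
    (hy : y ∈ I • (⊤ : Submodule Q Y)) : (x, y) ∈ I • (⊤ : Submodule Q (X × Y)) := by
  have h1 : ((x, 0) : X × Y) ∈ I • (⊤ : Submodule Q (X × Y)) :=
    Submodule.smul_top_le_comap_smul_top I (LinearMap.inl Q X Y) hx
  have h2 : ((0, y) : X × Y) ∈ I • (⊤ : Submodule Q (X × Y)) :=
    Submodule.smul_top_le_comap_smul_top I (LinearMap.inr Q X Y) hy
  have := add_mem h1 h2
  simpa using this

/-- The mapping cone `W` of the Eisenbud operator, with `W_n = (V_{n-1} ⊕ V_n) ⊗_Q S`. -/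
def W (hfg : IsExactPair f g) : ChainComplex (ModuleCat.{u} Q) ℕ :=
  ChainComplex.of (fun n => (tensorS f g).obj (D.coneX n)) (fun n => (tensorS f g).map (D.coneD n))
    (fun n => by
      rw [← Functor.map_comp, ← (tensorS f g).map_zero]
      refine tensorS_map_eq _ _ fun x => ?_
      obtain ⟨a, b⟩ := (show D.V (n + 1) × D.V (n + 2) from x)
      change ((-(D.prevD n (-(D.dV n a) - D.tauLift n b)) - D.prevTau n (D.dV (n + 1) b),
        D.dV n (D.dV (n + 1) b)) : D.prev n × D.V n) - 0 ∈ _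
      rw [sub_zero]
      refine prod_mem ?_ (by rw [D.tauLift_spec]; exact smul_mem_top _)
      match n with
      | 0 => exact zero_mem _
      | n + 1 =>
        change -(D.dV n (-(D.dV (n + 1) a) - D.tauLift (n + 1) b)) -
          D.tauLift n (D.dV (n + 2) b) ∈ Ideal.span {f, g} • (⊤ : Submodule Q (D.V n))
        have e : -(D.dV n (-(D.dV (n + 1) a) - D.tauLift (n + 1) b)) -
            D.tauLift n (D.dV (n + 2) b) = f • D.tauLift n a -
              (D.tauLift n (D.dV (n + 2) b) - D.dV n (D.tauLift (n + 1) b)) := by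
          rw [map_sub, map_neg, ← D.tauLift_spec]; abel
        rw [e]
        exact sub_mem (smul_mem_top _) (D.tauLift_dV_mem hfg b))

/-! ### The short exact sequence `0 → Σ²U ⊗_Q S → U ⊗_Q S → W → 0` -/

/-- The complex `U ⊗_Q S`. -/
abbrev US : ChainComplex (ModuleCat.{u} Q) ℕ :=
  ((tensorS f g).mapHomologicalComplex _).obj D.U

/-- The complex `Σ²U ⊗_Q S`. -/
abbrev shiftUS : ChainComplex (ModuleCat.{u} Q) ℕ :=
  ((tensorS f g).mapHomologicalComplex _).obj (shiftTwo D.U)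

/-- Multiplication by `y_2 = t`, as a map `U_{n-2} → U_n`. -/
def mulTwo : ∀ n, shiftTwoX D.U n ⟶ D.U.X n
  | 0 => 0
  | 1 => 0
  | n + 2 => ModuleCat.ofHom (D.dg.y 2 (Nat.add_comm 2 n))

/-- The chain map `Σ²U ⊗_Q S → U ⊗_Q S` given by multiplication by `y_2`. -/
def alpha : D.shiftUS ⟶ D.US where
  f n := (tensorS f g).map (D.mulTwo n)
  comm' i j hij := by
    simp only [ComplexShape.down_Rel] at hij
    subst hij
    change (tensorS f g).map _ ≫ (tensorS f g).map (D.U.d (j + 1) j) =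
      (tensorS f g).map (shiftTwoD D.U (j + 1) j) ≫ (tensorS f g).map _
    rw [← Functor.map_comp, ← Functor.map_comp]
    match j with
    | 0 =>
      congr 1
      exact Limits.zero_comp.trans Limits.comp_zero.symm
    | 1 =>
      refine tensorS_map_eq _ _ fun x => ?_
      change (D.U.d 2 1).hom (D.dg.y 2 _ x) - 0 ∈ _
      rw [sub_zero, D.dg.leibniz_zero 1 x]
      exact smul_mem_top' _
    | n + 2 =>
      refine tensorS_map_eq _ _ fun x => ?_
      change (D.U.d (n + 2 + 1) (n + 2)).hom (D.dg.y 2 _ x) -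
        D.dg.y 2 _ ((D.U.d (n + 1) n).hom x) ∈ _
      rw [D.dg.leibniz_succ (i := 1) (n := n) (m := n + 2) (by omega) (by omega) (by omega) x]
      simp only [Nat.reduceAdd, even_two, Even.neg_pow, one_pow, one_smul, add_sub_cancel_right]
      exact smul_mem_top' _

lemma prY_d_mem {n : ℕ} (x : D.U.X (n + 2)) :
    D.prY n ((D.U.d (n + 2) (n + 1)).hom x) -
      D.prY n ((D.U.d (n + 2) (n + 1)).hom (D.pr (n + 2) x : D.U.X (n + 2))) +
      D.dV n (D.prY (n + 1) x) ∈ Ideal.span {f, g} • (⊤ : Submodule Q (D.V n)) := by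
  let δ : D.U.X (n + 2) →ₗ[Q] D.V n := D.prY n ∘ₗ (D.U.d (n + 2) (n + 1)).hom
  refine D.mem_of_gen ((Ideal.span {f, g} • (⊤ : Submodule Q (D.V n))).comap
    (δ - δ ∘ₗ (D.V (n + 2)).subtype ∘ₗ D.pr (n + 2) + D.dV n ∘ₗ D.prY (n + 1)))
    (fun i j hij v => ?_) x
  change D.prY n ((D.U.d (n + 2) (n + 1)).hom (D.dg.y i hij (v : D.U.X j))) -
      D.prY n ((D.U.d (n + 2) (n + 1)).hom (D.pr (n + 2) (D.dg.y i hij (v : D.U.X j)) :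
        D.U.X (n + 2))) +
      D.dV n (D.prY (n + 1) (D.dg.y i hij (v : D.U.X j))) ∈
        Ideal.span {f, g} • (⊤ : Submodule Q (D.V n))
  rcases i with _ | k
  · obtain rfl : j = n + 2 := by omega
    rw [D.dg.one_act, D.pr_coe, D.prY_coe, map_zero, sub_self, add_zero]
    exact zero_mem _
  · rw [D.pr_y (Nat.succ_pos k), Submodule.coe_zero, map_zero, map_zero, sub_zero]
    rcases j with _ | j
    · obtain rfl : k = n + 1 := by omega
      rw [D.dg.leibniz_zero (n + 1) (v : D.U.X 0), map_smul,
        D.prY_y_gen (n := n + 1) (i := n + 1 + 1) (by omega) hij v, map_zero, add_zero]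
      rcases Nat.eq_zero_or_pos n with rfl | hn
      · exact smul_mem_top' _
      · rw [D.prY_y (by omega), smul_zero]
        exact zero_mem _
    · rw [D.dg.leibniz_succ (by omega) hij (by omega) (v : D.U.X (j + 1)), map_add, map_smul,
        map_smul]
      rcases k with _ | _ | k
      · obtain rfl : j = n := by omega
        rw [D.prY_y_one, D.prY_y_one_coe, D.dg.one_act, D.prY_coe]
        have : D.pr j ((D.U.d (j + 1) j).hom (v : D.U.X (j + 1))) = D.dV j v := rfl
        rw [this]
        simp
      · obtain rfl : j + 1 = n := by omega
        rw [D.prY_y (i := 0 + 1 + 1) (by omega),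
          D.prY_y_gen (n := j + 1 + 1) (i := 0 + 1 + 1) (by omega) hij v, smul_zero, add_zero,
          map_zero, add_zero]
        exact smul_mem_top' _
      · rw [D.prY_y (by omega), D.prY_y (by omega), D.prY_y (by omega), smul_zero, smul_zero,
          map_zero, add_zero, add_zero]
        exact zero_mem _

/-- The projection `U_n → V_{n-1} ⊕ V_n`, `b + y a + l ↦ (a, b)`. -/
def proj (n : ℕ) : D.U.X n ⟶ D.coneX n :=
  ModuleCat.ofHom (Y := D.prev n × D.V n) (LinearMap.prod (D.prevY n) (D.pr n))

/-- The chain map `ω : U ⊗_Q S → W`. -/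
def omega (hfg : IsExactPair f g) : D.US ⟶ D.W hfg where
  f n := (tensorS f g).map (D.proj n)
  comm' i j hij := by
    simp only [ComplexShape.down_Rel] at hij
    subst hij
    simp only [W, ChainComplex.of_d]
    change (tensorS f g).map _ ≫ (tensorS f g).map _ =
      (tensorS f g).map (D.U.d (j + 1) j) ≫ (tensorS f g).map _
    rw [← Functor.map_comp, ← Functor.map_comp]
    refine tensorS_map_eq _ _ fun x => ?_
    change ((-(D.prevD j (D.prY j x)) - D.prevTau j (D.pr (j + 1) x) -
        D.prevY j ((D.U.d (j + 1) j).hom x),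
      D.dV j (D.pr (j + 1) x) - D.pr j ((D.U.d (j + 1) j).hom x)) : D.prev j × D.V j) ∈ _
    refine prod_mem ?_ ?_
    · match j with
      | 0 => exact zero_mem _
      | n + 1 =>
        change -(D.dV n (D.prY (n + 1) x)) - D.tauLift n (D.pr (n + 2) x) -
          D.prY n ((D.U.d (n + 2) (n + 1)).hom x) ∈
            Ideal.span {f, g} • (⊤ : Submodule Q (D.V n))
        have h := neg_mem (add_mem (D.prY_d_mem x) (D.tauLift_add_mem hfg (D.pr (n + 2) x)))
        convert h using 1
        abel
    · rw [D.pr_d, sub_add_cancel_left]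
      exact neg_mem (smul_mem_top _)

lemma mulTwo_proj (n : ℕ) : D.mulTwo n ≫ D.proj n = 0 := by
  match n with
  | 0 => exact Limits.zero_comp
  | 1 => exact Limits.zero_comp
  | n + 2 =>
    refine ModuleCat.hom_ext (LinearMap.ext fun x => ?_)
    have h1 : ∀ x : D.U.X n, D.prY (n + 1) (D.dg.y 2 (Nat.add_comm 2 n) x) = 0 :=
      fun x => D.prY_y (by omega) _ x
    have h2 : ∀ x : D.U.X n, D.pr (n + 2) (D.dg.y 2 (Nat.add_comm 2 n) x) = 0 :=
      fun x => D.pr_y (by omega) _ x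
    exact Prod.ext (h1 x) (h2 x)

lemma isUnit_tateMul [IsLocalRing Q] [CharZero (IsLocalRing.ResidueField Q)] (k : ℕ) :
    IsUnit (tateMul 2 k : Q) := by
  have h : tateMul 2 k = k / 2 + 1 := by simp [tateMul, Nat.add_comm]
  rw [h, ← IsLocalRing.residue_ne_zero_iff_isUnit, map_natCast]
  exact Nat.cast_ne_zero.2 (Nat.succ_ne_zero _)

lemma decomp_symm_y_two {n : ℕ} (h : 2 + n = n + 2) (x : D.U.X n) (j : ℕ) (hj : j < n + 1) :
    (D.decomp (n + 2)).symm (D.dg.y 2 h x) ⟨j, by omega⟩ =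
      (tateMul 2 (n - j) : Q) • (show D.V j from (D.decomp n).symm x ⟨j, hj⟩) := by
  let p : D.U.X n →ₗ[Q] D.V j :=
    LinearMap.proj (φ := fun j : Fin (n + 1) => D.V j) ⟨j, hj⟩ ∘ₗ (D.decomp n).symm.toLinearMap
  let q : D.U.X (n + 2) →ₗ[Q] D.V j :=
    LinearMap.proj (φ := fun j : Fin (n + 3) => D.V j) ⟨j, by omega⟩ ∘ₗ
      (D.decomp (n + 2)).symm.toLinearMap
  refine sub_eq_zero.1 (D.mem_of_gen (LinearMap.ker (q ∘ₗ D.dg.y 2 h -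
    (tateMul 2 (n - j) : Q) • p)) (fun i k hik v => ?_) x)
  change (D.decomp (n + 2)).symm (D.dg.y 2 h (D.dg.y i hik (v : D.U.X k))) ⟨j, by omega⟩ -
    (tateMul 2 (n - j) : Q) •
      (show D.V j from (D.decomp n).symm (D.dg.y i hik (v : D.U.X k)) ⟨j, hj⟩) = 0
  rw [D.dg.mul_act hik h (by omega), map_nsmul, D.decomp_symm_y', D.decomp_symm_y',
    sub_eq_zero, Pi.smul_apply]
  by_cases hjk : j = k
  · subst hjk
    obtain rfl : i = n - j := by omega
    rw [Pi.single_eq_same (M := fun j : Fin (n + 2 + 1) => D.V j) ⟨j, _⟩ v]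
    rw [Pi.single_eq_same (M := fun j : Fin (n + 1) => D.V j) ⟨j, _⟩ v]
    exact (Nat.cast_smul_eq_nsmul Q _ _).symm
  · rw [Pi.single_eq_of_ne (by simpa [Fin.ext_iff] using hjk),
      Pi.single_eq_of_ne (by simpa [Fin.ext_iff] using hjk)]
    exact (smul_zero _).trans (smul_zero _).symm

lemma proj_surjective (n : ℕ) : Function.Surjective (D.proj n) := by
  intro z
  obtain ⟨a, b⟩ := (show D.prev n × D.V n from z)
  match n with
  | 0 => exact ⟨(b : D.U.X 0), Prod.ext (Subsingleton.elim (α := PUnit) _ _) (D.pr_coe b)⟩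
  | n + 1 =>
    have h1 : ∀ a : D.V n, D.prY n ((b : D.U.X (n + 1)) +
        D.dg.y 1 (Nat.add_comm 1 n) (a : D.U.X n)) = a := fun a => by
      rw [map_add, D.prY_coe, D.prY_y_one_coe, zero_add]
    have h2 : ∀ a : D.V n, D.pr (n + 1) ((b : D.U.X (n + 1)) +
        D.dg.y 1 (Nat.add_comm 1 n) (a : D.U.X n)) = b := fun a => by
      rw [map_add, D.pr_coe, D.pr_y (by omega), add_zero]
    exact ⟨_, Prod.ext (h1 a) (h2 a)⟩

lemma projective_coneX (n : ℕ) : Projective (D.coneX n) := by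
  have h : ∀ n, Module.Projective Q (D.V n) := fun n => by
    have := D.free n
    infer_instance
  have : Module.Projective Q (D.prev n) := by
    match n with
    | 0 => exact (inferInstance : Module.Projective Q PUnit.{u + 1})
    | n + 1 => exact h n
  have := h n
  have : Module.Projective Q (D.coneX n) :=
    (inferInstance : Module.Projective Q (D.prev n × D.V n))
  exact (IsProjective.iff_projective (D.coneX n)).1 this

section exactness

variable [IsLocalRing Q] [CharZero (IsLocalRing.ResidueField Q)]

lemma mulTwo_injective (n : ℕ) : Function.Injective (D.mulTwo n) := by
  match n with
  | 0 => exact fun x y _ => Subsingleton.elim (α := PUnit) x y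
  | 1 => exact fun x y _ => Subsingleton.elim (α := PUnit) x y
  | n + 2 =>
    have key : ∀ x : D.U.X n, D.dg.y 2 (Nat.add_comm 2 n) x = 0 → x = 0 := ?_
    · exact (injective_iff_map_eq_zero (D.mulTwo (n + 2)).hom).2 key
    intro x hx'
    refine (D.decomp n).symm.injective ?_
    rw [map_zero]
    funext ⟨j, hj⟩
    have h := D.decomp_symm_y_two (Nat.add_comm 2 n) x j hj
    rw [hx', map_zero] at h
    exact (isUnit_tateMul (n - j)).smul_eq_zero.1 h.symm

lemma exact_proj (n : ℕ) (x : D.U.X n) (hx : D.proj n x = 0) : ∃ z, D.mulTwo n z = x := by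
  have h1 : D.prevY n x = 0 := congrArg Prod.fst (show (D.prevY n x, D.pr n x) = 0 from hx)
  have h2 : D.pr n x = 0 := congrArg Prod.snd (show (D.prevY n x, D.pr n x) = 0 from hx)
  change x ∈ LinearMap.range (D.mulTwo n).hom
  obtain ⟨w, rfl⟩ := (D.decomp n).surjective x
  have e : D.decomp n w = ∑ j : Fin (n + 1),
      D.dg.y (n - j) (Nat.sub_add_cancel (Nat.le_of_lt_succ j.2)) (w j : D.U.X j) := by
    simp [decomp, LinearMap.sum_apply]
  have hlast : w (Fin.last n) = 0 := by
    have : (D.decomp n).symm (D.decomp n w) (Fin.last n) = 0 := h2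
    rwa [LinearEquiv.symm_apply_apply] at this
  rw [e]
  refine Submodule.sum_mem _ fun j _ => ?_
  obtain ⟨j, hj⟩ := j
  by_cases hjn : j = n
  · subst hjn
    have : w ⟨j, hj⟩ = 0 := hlast
    rw [this, Submodule.coe_zero, map_zero]
    exact zero_mem _
  by_cases hjn' : j + 1 = n
  · subst hjn'
    have : (D.decomp (j + 1)).symm (D.decomp (j + 1) w) ⟨j, hj⟩ = 0 := h1
    rw [LinearEquiv.symm_apply_apply] at this
    rw [this, Submodule.coe_zero, map_zero]
    exact zero_mem _
  obtain ⟨k, rfl⟩ : ∃ k, n = k + 2 := ⟨n - 2, by omega⟩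
  obtain ⟨c, hc⟩ := isUnit_tateMul (Q := Q) (k - j)
  have hk : k - j + j = k := by omega
  have hk2 : k + 2 - j + j = k + 2 := by omega
  have hk3 : k + 2 - j = 2 + (k - j) := by omega
  have key : D.dg.y 2 (Nat.add_comm 2 k) (D.dg.y (k - j) hk (w ⟨j, hj⟩ : D.U.X j)) =
      (c : Q) • D.dg.y (k + 2 - j) hk2 (w ⟨j, hj⟩ : D.U.X j) := by
    have e : ∀ (i : ℕ) (hi : i = 2 + (k - j)) (h : i + j = k + 2),
        D.dg.y (2 + (k - j)) (hi ▸ h) (w ⟨j, hj⟩ : D.U.X j) =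
          D.dg.y i h (w ⟨j, hj⟩ : D.U.X j) := by
      rintro i rfl h
      rfl
    rw [← e _ hk3 hk2, D.dg.mul_act hk _ (hk3 ▸ hk2), hc, Nat.cast_smul_eq_nsmul]
  refine ⟨(c⁻¹ : Qˣ) • D.dg.y (k - j) hk (w ⟨j, hj⟩ : D.U.X j), ?_⟩
  change D.dg.y 2 (Nat.add_comm 2 k) (((c⁻¹ : Qˣ) : Q) •
    D.dg.y (k - j) hk (w ⟨j, hj⟩ : D.U.X j)) = _
  rw [map_smul, key, smul_smul, Units.inv_mul, one_smul]

/-- The degree `n` part of the sequence, before tensoring. -/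
def seqX (n : ℕ) : ShortComplex (ModuleCat.{u} Q) :=
  ShortComplex.mk (D.mulTwo n) (D.proj n) (D.mulTwo_proj n)

lemma seqX_shortExact (n : ℕ) : (D.seqX n).ShortExact where
  mono_f := (ModuleCat.mono_iff_injective _).2 (D.mulTwo_injective n)
  epi_g := (ModuleCat.epi_iff_surjective _).2 (D.proj_surjective n)
  exact := (ShortComplex.moduleCat_exact_iff _).2 (D.exact_proj n)

/-- The sequence `0 → Σ²U ⊗_Q S ⊗_S N → U ⊗_Q S ⊗_S N → W ⊗_S N → 0`. -/
def seqN (hfg : IsExactPair f g) (N : Type u) [AddCommGroup N] [Module Q N] :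
    ShortComplex (ChainComplex (ModuleCat.{u} Q) ℕ) :=
  ShortComplex.mk (((tensorN N).mapHomologicalComplex _).map D.alpha)
    (((tensorN N).mapHomologicalComplex _).map (D.omega hfg)) (by
      rw [← Functor.map_comp]
      have : D.alpha ≫ D.omega hfg = 0 := by
        ext n : 1
        change (tensorS f g).map _ ≫ (tensorS f g).map _ = 0
        exact ((tensorS f g).map_comp _ _).symm.trans
          ((congrArg _ (D.mulTwo_proj n)).trans ((tensorS f g).map_zero _ _))
      rw [this, Functor.map_zero])

lemma seqN_shortExact (hfg : IsExactPair f g) (N : Type u) [AddCommGroup N] [Module Q N] :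
    (D.seqN hfg N).ShortExact := by
  refine HomologicalComplex.shortExact_of_degreewise_shortExact _ fun n => ?_
  have := D.projective_coneX n
  have : Projective (D.seqX n).X₃ := this
  exact (((D.seqX_shortExact n).splittingOfProjective.map
    (tensorS f g ⋙ tensorN N)).shortExact :)

/-! ### The maps `μ^N` and `δ^N` -/

/-- The connecting map `μ^N_{n+1} : H_{n+1}(W ⊗_S N) → H_n(Σ²U ⊗_Q N) = Tor^Q_{n-2}(M, N)`. -/
def mu (hfg : IsExactPair f g) (N : Type u) [AddCommGroup N] [Module Q N] (n : ℕ) :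
    (((tensorN N).mapHomologicalComplex _).obj (D.W hfg)).homology (n + 1) ⟶
      (((tensorN N).mapHomologicalComplex _).obj D.shiftUS).homology n :=
  (D.seqN_shortExact hfg N).δ (n + 1) n rfl

end exactness

/-- The map `δ^N_n : Tor^R_n(M, N) = H_n(V ⊗_Q S ⊗_S N) → H_{n-2}(V ⊗_Q S ⊗_S N) =
Tor^R_{n-2}(M, N)` induced by the Eisenbud operator `τ`. -/
def delta (hfg : IsExactPair f g) (N : Type u) [AddCommGroup N] [Module Q N] (n : ℕ) :
    (((tensorN N).mapHomologicalComplex _).obj D.VS).homology n ⟶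
      (((tensorN N).mapHomologicalComplex _).obj (shiftTwo D.VS)).homology n :=
  HomologicalComplex.homologyMap
    (((tensorN N).mapHomologicalComplex _).map (D.eisenbud hfg)) n

end SemifreeResolution

end

/-! Two short exact sequences of complexes carry the proof. Write p_n, r_n and w_n for the lengths
of Tor^Q_n(M,N), Tor^R_n(M,N) and H_n(W ⊗ N). Since f and g kill N, tensoring with S and then N is
the same as tensoring with N, so Tor^Q is the homology of U ⊗ S ⊗ N (`length_torModule_US`). Once V
⊗ R is known to resolve M, Tor^R is the homology of V ⊗ S ⊗ N (`length_torModule_VS`).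

The sequence 0 → Σ²U → U → W → 0 (`seqN`) gives p_n ≤ p_{n-2} + w_n and w_n ≤ p_n + p_{n-3}. The
mapping cone sequence 0 → ΣV → W → V → 0 (`coneSeq`) gives w_n ≤ r_{n-1} + r_n and r_n ≤ w_n +
r_{n-2}. Eliminating w gives (1 - t²)P^Q ≼ (1 + t)P^R and (1 - t²)P^R ≼ (1 + t³)P^Q, and summing in
steps of two gives the stated inequalities. The second one is an equality iff both inequalities
behind it are equalities in every degree, that is, iff all connecting maps of both sequences vanish
(`length_homology_middle_eq_iff`). Those of the first sequence are μ^N by definition; those of the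
second are δ^N up to sign (`coneSeq_δ_eq_zero_iff`).

V ⊗ R resolves M because the kernel of U → V ⊗ R is acyclic (`exists_d_eq_of_pr`). Filter U by the
degrees of the basis elements: the p-th layer is A ⊗ V_p with only the differential of A, and A is
exact in positive degrees because (f, g) is an exact pair.

A semi-free resolution is built degree by degree as U_{n+2} = V_{n+2} ⊕ yV_{n+1} ⊕ tU_n, with
V_{n+2} free and mapping onto the cycles of U_{n+1}. Only ordinary powers of t are needed: nonzero
integers are units in Q, so t^{(k)} = t^k/k!. The same units make multiplication by t injective with
cokernel V_{n-1} ⊕ V_n.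

Finally, Tor^Q_n is finitely generated and killed by ann M + ann N, whose zero locus is the support
of M ⊗ N, so it has finite length. Finiteness passes to W and, by induction on the degree, to Tor^R.
-/

/-! ### Homology of complexes of modules in terms of cycles and boundaries -/

section homology

variable {A : Type u} [CommRing A]

/-- An element of a complex of modules is a cycle if all differentials kill it. -/
def IsCycle (C : ChainComplex (ModuleCat.{u} A) ℕ) (n : ℕ) (x : C.X n) : Prop :=
  ∀ j, (C.d n j).hom x = 0

/-- An element of a complex of modules is a boundary if it is in the image of a differential. -/
def IsBoundary (C : ChainComplex (ModuleCat.{u} A) ℕ) (n : ℕ) (x : C.X n) : Prop :=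
  ∃ i, ∃ y : C.X i, (C.d i n).hom y = x

variable {C D : ChainComplex (ModuleCat.{u} A) ℕ}

lemma isCycle_zero (x : C.X 0) : IsCycle C 0 x := fun j => by
  rw [C.shape 0 j (by simp)]; rfl

lemma isCycle_succ {n : ℕ} (x : C.X (n + 1)) :
    IsCycle C (n + 1) x ↔ (C.d (n + 1) n).hom x = 0 := by
  refine ⟨fun h => h n, fun h j => ?_⟩
  by_cases hj : j = n
  · subst hj; exact h
  · rw [C.shape (n + 1) j (by simp only [ComplexShape.down_Rel]; omega)]; rfl

lemma isBoundary_iff {n : ℕ} (x : C.X n) :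
    IsBoundary C n x ↔ ∃ y : C.X (n + 1), (C.d (n + 1) n).hom y = x := by
  refine ⟨fun ⟨i, y, h⟩ => ?_, fun ⟨y, h⟩ => ⟨_, y, h⟩⟩
  by_cases hi : i = n + 1
  · subst hi; exact ⟨y, h⟩
  · rw [C.shape i n (by simp only [ComplexShape.down_Rel]; omega)] at h
    exact ⟨0, by rw [map_zero, ← h]; rfl⟩

lemma d_d_apply (C : ChainComplex (ModuleCat.{u} A) ℕ) (i j k : ℕ) (x : C.X i) :
    (C.d j k).hom ((C.d i j).hom x) = 0 := by
  rw [← LinearMap.comp_apply, ← ModuleCat.hom_comp, C.d_comp_d]; rfl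

lemma hom_comm_apply (φ : C ⟶ D) (i j : ℕ) (x : C.X i) :
    (D.d i j).hom ((φ.f i).hom x) = (φ.f j).hom ((C.d i j).hom x) := by
  rw [← LinearMap.comp_apply, ← ModuleCat.hom_comp, φ.comm]; rfl

/-- The homology class of a cycle. -/
noncomputable def cycleClass {n : ℕ} (x : C.X n) (hx : IsCycle C n x) : C.homology n :=
  (C.homologyπ n).hom (C.cyclesMk x _ rfl (hx _))

lemma exists_cycleClass {n : ℕ} (c : C.homology n) :
    ∃ (x : C.X n) (hx : IsCycle C n x), cycleClass x hx = c := by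
  obtain ⟨z, rfl⟩ := (ModuleCat.epi_iff_surjective (C.homologyπ n)).1 inferInstance c
  refine ⟨(C.iCycles n).hom z, fun j => ?_, ?_⟩
  · rw [← LinearMap.comp_apply, ← ModuleCat.hom_comp, C.iCycles_d]; rfl
  · refine congrArg _ ((ModuleCat.mono_iff_injective (C.iCycles n)).1 inferInstance ?_)
    exact C.i_cyclesMk _ _ _ _

/-- Homology is the cokernel of `toCycles`, and `iCycles` is mono, so equality of cycles can be
tested in `C.X n`. -/
lemma cycleClass_eq_zero_iff {n : ℕ} (x : C.X n) (hx : IsCycle C n x) :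
    cycleClass x hx = 0 ↔ IsBoundary C n x := by
  have h := (ShortComplex.moduleCat_exact_iff _).1
    (ShortComplex.exact_of_g_is_cokernel
      (ShortComplex.mk (C.toCycles (n + 1) n) (C.homologyπ n) (C.toCycles_comp_homologyπ _ _))
      (C.homologyIsCokernel (n + 1) n (by simp)))
  constructor
  · intro h0
    obtain ⟨y, hy⟩ := h _ h0
    refine ⟨n + 1, y, ?_⟩
    have := congrArg (C.iCycles n).hom hy
    erw [C.i_cyclesMk] at this
    rw [← this]
    change _ = (C.toCycles (n + 1) n ≫ C.iCycles n).hom y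
    rw [C.toCycles_i]
  · rw [isBoundary_iff]
    rintro ⟨y, hy⟩
    have : C.cyclesMk x _ rfl (hx _) = (C.toCycles (n + 1) n).hom y := by
      refine (ModuleCat.mono_iff_injective (C.iCycles n)).1 inferInstance ?_
      refine (C.i_cyclesMk _ _ _ _).trans ?_
      rw [← hy]
      change _ = (C.toCycles (n + 1) n ≫ C.iCycles n).hom y
      rw [C.toCycles_i]
    rw [cycleClass, this]
    change (C.toCycles (n + 1) n ≫ C.homologyπ n).hom y = 0
    rw [C.toCycles_comp_homologyπ]; rfl

lemma IsCycle.map {n : ℕ} {x : C.X n} (hx : IsCycle C n x) (φ : C ⟶ D) :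
    IsCycle D n ((φ.f n).hom x) := fun j => by
  rw [hom_comm_apply, hx j, map_zero]

lemma homologyMap_cycleClass {n : ℕ} (x : C.X n) (hx : IsCycle C n x) (φ : C ⟶ D) :
    (HomologicalComplex.homologyMap φ n).hom (cycleClass x hx) =
      cycleClass ((φ.f n).hom x) (hx.map φ) := by
  change (C.homologyπ n ≫ HomologicalComplex.homologyMap φ n).hom _ = _
  rw [HomologicalComplex.homologyπ_naturality]
  change (D.homologyπ n).hom ((HomologicalComplex.cyclesMap φ n).hom _) = _
  refine congrArg _ ((ModuleCat.mono_iff_injective (D.iCycles n)).1 inferInstance ?_)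
  refine Eq.trans ?_ (D.i_cyclesMk _ _ _ _).symm
  change (HomologicalComplex.cyclesMap φ n ≫ D.iCycles n).hom _ = _
  rw [HomologicalComplex.cyclesMap_i]
  exact congrArg (φ.f n).hom (C.i_cyclesMk _ _ _ _)

/-- A chain map is zero on homology iff it takes cycles to boundaries. -/
lemma homologyMap_eq_zero_iff (φ : C ⟶ D) (n : ℕ) :
    HomologicalComplex.homologyMap φ n = 0 ↔
      ∀ x : C.X n, IsCycle C n x → IsBoundary D n ((φ.f n).hom x) := by
  constructor
  · intro h x hx
    rw [← cycleClass_eq_zero_iff _ (hx.map φ), ← homologyMap_cycleClass x hx, h]; rfl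
  · intro h
    refine ModuleCat.hom_ext (LinearMap.ext fun c => ?_)
    obtain ⟨x, hx, rfl⟩ := exists_cycleClass c
    rw [homologyMap_cycleClass, (cycleClass_eq_zero_iff _ _).2 (h x hx)]; rfl

lemma cycleClass_add {n : ℕ} (x y : C.X n) (hx : IsCycle C n x) (hy : IsCycle C n y)
    (h : IsCycle C n (x + y)) : cycleClass (x + y) h = cycleClass x hx + cycleClass y hy := by
  rw [cycleClass, cycleClass, cycleClass, ← map_add]
  refine congrArg _ ((ModuleCat.mono_iff_injective (C.iCycles n)).1 inferInstance ?_)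
  refine (C.i_cyclesMk _ _ _ _).trans (Eq.trans ?_ (map_add _ _ _).symm)
  exact (congrArg₂ (· + ·) (C.i_cyclesMk _ _ _ _) (C.i_cyclesMk _ _ _ _)).symm

lemma cycleClass_smul {n : ℕ} (a : A) (x : C.X n) (hx : IsCycle C n x)
    (h : IsCycle C n (a • x)) : cycleClass (a • x) h = a • cycleClass x hx := by
  rw [cycleClass, cycleClass, ← map_smul]
  refine congrArg _ ((ModuleCat.mono_iff_injective (C.iCycles n)).1 inferInstance ?_)
  refine (C.i_cyclesMk _ _ _ _).trans (Eq.trans ?_ (map_smul (C.iCycles n).hom _ _).symm)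
  exact (congrArg (fun z : C.X n => a • z) (C.i_cyclesMk _ _ _ _)).symm

/-- The submodule of cycles. -/
def cycleSubmodule (C : ChainComplex (ModuleCat.{u} A) ℕ) (n : ℕ) : Submodule A (C.X n) where
  carrier := {x | IsCycle C n x}
  zero_mem' := fun _ => map_zero _
  add_mem' := fun hx hy j => by rw [map_add, hx j, hy j, add_zero]
  smul_mem' := fun a x hx j => by rw [map_smul, hx j, smul_zero]

/-- The length of homology only depends on the modules of cycles and boundaries, and can be
computed over any ring that surjects onto the given one. -/
lemma length_homology_congr {B : Type u} [CommRing B] [Algebra A B]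
    (hAB : Function.Surjective (algebraMap A B)) (C : ChainComplex (ModuleCat.{u} A) ℕ)
    (D : ChainComplex (ModuleCat.{u} B) ℕ) {n m : ℕ} (e : C.X n →+ D.X m)
    (he : ∀ (a : A) x, e (a • x) = algebraMap A B a • e x) (hsurj : Function.Surjective e)
    (hc : ∀ x, IsCycle D m (e x) ↔ IsCycle C n x)
    (hb : ∀ x, IsBoundary D m (e x) ↔ IsBoundary C n x) :
    Module.length A (C.homology n) = Module.length B (D.homology m) := by
  -- Restriction of scalars along a surjection preserves length. Over `A` both homologies are then
  -- quotients of the same module of cycles of `C`, with equal kernels.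
  let _ : Module A (D.homology m) := Module.compHom _ (algebraMap A B)
  have : IsScalarTower A B (D.homology m) := ⟨fun a b x => by
    rw [Algebra.smul_def, mul_smul]; rfl⟩
  rw [← Module.length_eq_of_surjective (M := D.homology m) hAB]
  let φ : cycleSubmodule C n →ₗ[A] C.homology n :=
    { toFun := fun x => cycleClass x.1 x.2
      map_add' := fun x y => cycleClass_add _ _ _ _ _
      map_smul' := fun a x => cycleClass_smul _ _ _ _ }
  let ψ : cycleSubmodule C n →ₗ[A] D.homology m :=
    { toFun := fun x => cycleClass (e x.1) ((hc _).2 x.2)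
      map_add' := fun x y => by
        simp only [Submodule.coe_add, map_add]
        exact cycleClass_add _ _ _ _ _
      map_smul' := fun a x => by
        simp only [Submodule.coe_smul, he]
        exact cycleClass_smul _ _ _ _ }
  have hφ : Function.Surjective φ := fun c => by
    obtain ⟨x, hx, rfl⟩ := exists_cycleClass c
    exact ⟨⟨x, hx⟩, rfl⟩
  have hψ : Function.Surjective ψ := fun c => by
    obtain ⟨x, hx, rfl⟩ := exists_cycleClass c
    obtain ⟨x, rfl⟩ := hsurj x
    exact ⟨⟨x, (hc _).1 hx⟩, rfl⟩
  have hker : LinearMap.ker φ = LinearMap.ker ψ := by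
    ext x
    rw [LinearMap.mem_ker, LinearMap.mem_ker]
    exact (cycleClass_eq_zero_iff x.1 x.2).trans
      ((hb x.1).symm.trans (cycleClass_eq_zero_iff (e x.1) ((hc _).2 x.2)).symm)
  exact ((φ.quotKerEquivOfSurjective hφ).symm.trans ((Submodule.quotEquivOfEq _ _ hker).trans
    (ψ.quotKerEquivOfSurjective hψ))).length_eq

/-- The special case of complexes over the same ring. -/
lemma length_homology_congr' (C D : ChainComplex (ModuleCat.{u} A) ℕ) {n m : ℕ}
    (e : C.X n →ₗ[A] D.X m) (hsurj : Function.Surjective e)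
    (hc : ∀ x, IsCycle D m (e x) ↔ IsCycle C n x)
    (hb : ∀ x, IsBoundary D m (e x) ↔ IsBoundary C n x) :
    Module.length A (C.homology n) = Module.length A (D.homology m) :=
  length_homology_congr Function.surjective_id C D e.toAddMonoidHom (map_smul e) hsurj hc hb

lemma length_homology_eq_zero (C : ChainComplex (ModuleCat.{u} A) ℕ) (n : ℕ)
    (h : Subsingleton (C.X n)) : Module.length A (C.homology n) = 0 := by
  rw [Module.length_eq_zero_iff]
  have : ∀ c : C.homology n, c = 0 := fun c => by
    obtain ⟨x, hx, rfl⟩ := exists_cycleClass c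
    exact (cycleClass_eq_zero_iff _ _).2 ⟨n, 0, Subsingleton.elim _ _⟩
  exact ⟨fun a b => (this a).trans (this b).symm⟩

/-- A connecting homomorphism is zero iff it takes cycles to boundaries, in terms of any choice
`s x` of lifts of the cycles `x`, with boundaries `b x`. -/
lemma delta_eq_zero_iff {S : ShortComplex (ChainComplex (ModuleCat.{u} A) ℕ)}
    (hS : S.ShortExact) (n : ℕ) (s : S.X₃.X (n + 1) → S.X₂.X (n + 1))
    (hs : ∀ x, (S.g.f (n + 1)).hom (s x) = x) (b : S.X₃.X (n + 1) → S.X₁.X n)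
    (hb : ∀ x, IsCycle S.X₃ (n + 1) x → (S.f.f n).hom (b x) = (S.X₂.d (n + 1) n).hom (s x)) :
    hS.δ (n + 1) n rfl = 0 ↔ ∀ x, IsCycle S.X₃ (n + 1) x → IsBoundary S.X₁ n (b x) := by
  have hbc : ∀ x, IsCycle S.X₃ (n + 1) x → IsCycle S.X₁ n (b x) := fun x hx j =>
    hS.d_eq_zero_of_f_eq_d_apply (n + 1) n (s x) (b x) (hb x hx) j
  -- The snake construction, with `s x` as the lift of `x` and `b x` as the preimage of its
  -- differential.
  have key : ∀ x (hx : IsCycle S.X₃ (n + 1) x), (hS.δ (n + 1) n rfl).hom (cycleClass x hx) =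
      cycleClass (b x) (hbc x hx) := fun x hx => by
    have := hS.δ_apply (n + 1) n rfl x (hx n) (s x) (hs x) (b x) (hb x hx) _ rfl
    refine Eq.trans (congrArg _ ?_) this
    refine congrArg (S.X₃.homologyπ (n + 1)).hom ?_
    refine (ModuleCat.mono_iff_injective (S.X₃.iCycles (n + 1))).1 inferInstance ?_
    exact (S.X₃.i_cyclesMk _ _ _ _).trans (S.X₃.i_cyclesMk _ _ _ _).symm
  constructor
  · intro h x hx
    rw [← cycleClass_eq_zero_iff _ (hbc x hx), ← key x hx, h]; rfl
  · intro h
    refine ModuleCat.hom_ext (LinearMap.ext fun c => ?_)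
    obtain ⟨x, hx, rfl⟩ := exists_cycleClass c
    rw [key, (cycleClass_eq_zero_iff _ _).2 (h x hx)]; rfl

end homology

/-! ### Lengths in exact sequences of modules -/

section length

variable {A : Type*} [CommRing A] {X Y Z X' : Type*} [AddCommGroup X] [Module A X]
  [AddCommGroup Y] [Module A Y] [AddCommGroup Z] [Module A Z] [AddCommGroup X'] [Module A X']

/-- `Y` is an extension of the image of `ψ`, a submodule of `Z`, by the image of `φ`, a quotient of
`X`. -/
lemma length_le_add_of_exact (φ : X →ₗ[A] Y) (ψ : Y →ₗ[A] Z) (h : Function.Exact φ ψ) :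
    Module.length A Y ≤ Module.length A X + Module.length A Z := by
  rw [Module.length_eq_add_of_exact (LinearMap.ker ψ).subtype ψ.rangeRestrict
    (Submodule.subtype_injective _) ψ.surjective_rangeRestrict
    (fun y => by
      rw [← LinearMap.mem_ker, LinearMap.ker_rangeRestrict]
      simp)]
  rw [LinearMap.exact_iff.1 h]
  exact add_le_add (Module.length_le_of_surjective φ.rangeRestrict φ.surjective_rangeRestrict)
    (Module.length_le_of_injective _ (Submodule.subtype_injective _))

/-- In an exact sequence `W → X → Y → Z → T` of modules of finite length, the length of `Y` is
the sum of the lengths of `X` and `Z` iff the outer maps are zero. -/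
lemma length_eq_add_iff {W : Type*} [AddCommGroup W] [Module A W] (θ : W →ₗ[A] X)
    (φ : X →ₗ[A] Y) (ψ : Y →ₗ[A] Z) (χ : Z →ₗ[A] X') (h₁ : Function.Exact θ φ)
    (h₂ : Function.Exact φ ψ) (h₃ : Function.Exact ψ χ) (hX : Module.length A X ≠ ⊤)
    (hZ : Module.length A Z ≠ ⊤) :
    Module.length A Y = Module.length A X + Module.length A Z ↔ θ = 0 ∧ χ = 0 := by
  -- After rewriting by exactness, ℓ(Y) = ℓ(im φ) + ℓ(ker χ), ℓ(X) = ℓ(im θ) + ℓ(im φ) and ℓ(Z) =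
  -- ℓ(ker χ) + ℓ(im χ). The defect of additivity is therefore ℓ(im θ) + ℓ(im χ).
  have eY := Module.length_eq_add_of_exact (LinearMap.ker ψ).subtype ψ.rangeRestrict
    (Submodule.subtype_injective _) ψ.surjective_rangeRestrict (fun y => by
      rw [← LinearMap.mem_ker, LinearMap.ker_rangeRestrict]; simp)
  rw [LinearMap.exact_iff.1 h₂, ← LinearMap.exact_iff.1 h₃] at eY
  have eX := Module.length_eq_add_of_exact (LinearMap.ker φ).subtype φ.rangeRestrict
    (Submodule.subtype_injective _) φ.surjective_rangeRestrict (fun y => by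
      rw [← LinearMap.mem_ker, LinearMap.ker_rangeRestrict]; simp)
  rw [LinearMap.exact_iff.1 h₁] at eX
  have eZ := Module.length_eq_add_of_exact (LinearMap.ker χ).subtype χ.rangeRestrict
    (Submodule.subtype_injective _) χ.surjective_rangeRestrict (fun y => by
      rw [← LinearMap.mem_ker, LinearMap.ker_rangeRestrict]; simp)
  have hθ : Module.length A (LinearMap.range θ) = 0 ↔ θ = 0 := by
    rw [Module.length_eq_zero_iff, Submodule.subsingleton_iff_eq_bot, LinearMap.range_eq_bot]
  have hχ : Module.length A (LinearMap.range χ) = 0 ↔ χ = 0 := by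
    rw [Module.length_eq_zero_iff, Submodule.subsingleton_iff_eq_bot, LinearMap.range_eq_bot]
  rw [← hθ, ← hχ, eY, eX, eZ]
  rw [eX] at hX
  rw [eZ] at hZ
  obtain ⟨h1, h2⟩ := WithTop.add_ne_top.1 hX
  obtain ⟨h3, h4⟩ := WithTop.add_ne_top.1 hZ
  lift Module.length A (LinearMap.range θ) to ℕ using h1 with a
  lift Module.length A (LinearMap.range φ) to ℕ using h2 with b
  lift Module.length A (LinearMap.ker χ) to ℕ using h3 with c
  lift Module.length A (LinearMap.range χ) to ℕ using h4 with d
  norm_cast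
  omega

end length

/-! ### Lengths in the long exact homology sequence -/

section sequence

variable {A : Type u} [CommRing A] {S : ShortComplex (ChainComplex (ModuleCat.{u} A) ℕ)}
  (hS : S.ShortExact)

lemma function_exact_of_exact {T : ShortComplex (ModuleCat.{u} A)} (h : T.Exact) :
    Function.Exact T.f.hom T.g.hom :=
  (ShortComplex.ShortExact.moduleCat_exact_iff_function_exact _).1 h

include hS

lemma length_homology_middle_le (n : ℕ) : Module.length A (S.X₂.homology n) ≤
    Module.length A (S.X₁.homology n) + Module.length A (S.X₃.homology n) :=
  length_le_add_of_exact _ _ (function_exact_of_exact (hS.homology_exact₂ n))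

lemma length_homology_right_le (n : ℕ) : Module.length A (S.X₃.homology (n + 1)) ≤
    Module.length A (S.X₂.homology (n + 1)) + Module.length A (S.X₁.homology n) :=
  length_le_add_of_exact _ _ (function_exact_of_exact (hS.homology_exact₃ (n + 1) n rfl))

/-- In degree 0 every element is a cycle, so a lift of a representative is again a cycle. -/
lemma homologyMap_zero_surjective :
    Function.Surjective (HomologicalComplex.homologyMap S.g 0).hom := by
  intro c
  obtain ⟨x, hx, rfl⟩ := exists_cycleClass c
  have := hS.epi_g
  obtain ⟨y, rfl⟩ := (ModuleCat.epi_iff_surjective (S.g.f 0)).1 inferInstance x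
  exact ⟨cycleClass y (isCycle_zero y), homologyMap_cycleClass _ _ _⟩

lemma length_homology_right_zero_le : Module.length A (S.X₃.homology 0) ≤
    Module.length A (S.X₂.homology 0) :=
  Module.length_le_of_surjective _ (homologyMap_zero_surjective hS)

/-- Additivity in degree n is equivalent to the vanishing of the connecting maps entering H_n(X₁)
and leaving H_n(X₃). Over all degrees these are all the connecting maps. -/
lemma length_homology_middle_eq_iff (h₁ : ∀ n, Module.length A (S.X₁.homology n) ≠ ⊤)
    (h₃ : ∀ n, Module.length A (S.X₃.homology n) ≠ ⊤) :
    (∀ n, Module.length A (S.X₂.homology n) =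
      Module.length A (S.X₁.homology n) + Module.length A (S.X₃.homology n)) ↔
    ∀ n, hS.δ (n + 1) n rfl = 0 := by
  -- In degree 0 no connecting map leaves H_0(X₃); the zero endomorphism takes its place, exactness
  -- there being surjectivity.
  have e0 := length_eq_add_iff (hS.δ 1 0 rfl).hom _ _ (0 : S.X₃.homology 0 →ₗ[A] S.X₃.homology 0)
    (function_exact_of_exact (hS.homology_exact₁ 1 0 rfl))
    (function_exact_of_exact (hS.homology_exact₂ 0))
    (fun c => ⟨fun _ => homologyMap_zero_surjective hS c, fun _ => rfl⟩) (h₁ _) (h₃ _)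
  have e : ∀ n, _ := fun n => length_eq_add_iff (hS.δ (n + 2) (n + 1) rfl).hom _ _ _
    (function_exact_of_exact (hS.homology_exact₁ (n + 2) (n + 1) rfl))
    (function_exact_of_exact (hS.homology_exact₂ (n + 1)))
    (function_exact_of_exact (hS.homology_exact₃ (n + 1) n rfl)) (h₁ _) (h₃ _)
  have hz : ∀ n, (hS.δ (n + 1) n rfl).hom = 0 ↔ hS.δ (n + 1) n rfl = 0 := fun n =>
    ⟨fun h => ModuleCat.hom_ext h, fun h => by rw [h]; rfl⟩
  constructor
  · intro h n
    rw [← hz]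
    cases n with
    | zero => exact (e0.1 (h 0)).1
    | succ n => exact ((e n).1 (h (n + 1))).1
  · intro h n
    cases n with
    | zero => exact e0.2 ⟨(hz 0).2 (h 0), rfl⟩
    | succ n => exact (e n).2 ⟨(hz _).2 (h _), (hz _).2 (h _)⟩

end sequence

/-! ### Projective resolutions and Tor -/

section resolution

variable {A : Type u} [CommRing A]

/-- An exact augmented complex of projective modules is a projective resolution. -/
noncomputable def projectiveResolutionOfExact (C : ChainComplex (ModuleCat.{u} A) ℕ)
    (hC : ∀ n, Module.Projective A (C.X n)) {M : ModuleCat.{u} A} (ε : C.X 0 ⟶ M)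
    (hε : Function.Surjective ε.hom) (h₀ : ∀ x, ε.hom x = 0 ↔ ∃ y, (C.d 1 0).hom y = x)
    (h : ∀ n (x : C.X (n + 1)), (C.d (n + 1) n).hom x = 0 → ∃ y, (C.d (n + 2) (n + 1)).hom y = x) :
    ProjectiveResolution M where
  complex := C
  projective n := (IsProjective.iff_projective (C.X n)).1 (hC n)
  π := (ChainComplex.toSingle₀Equiv _ _).symm ⟨ε, ModuleCat.hom_ext (LinearMap.ext fun y =>
    (h₀ _).2 ⟨y, rfl⟩)⟩
  quasiIso := ⟨fun n => by
    cases n with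
    | zero =>
      have key : ((ChainComplex.toSingle₀Equiv _ _).symm (⟨ε, ModuleCat.hom_ext (LinearMap.ext fun y =>
        (h₀ _).2 ⟨y, rfl⟩)⟩ : { f : C.X 0 ⟶ M // C.d 1 0 ≫ f = 0 })).f 0 = ε :=
        ChainComplex.toSingle₀Equiv_symm_apply_f_zero _ _
      rw [quasiIsoAt_iff_isIso_homologyMap, ConcreteCategory.isIso_iff_bijective]
      constructor
      · refine (injective_iff_map_eq_zero (ModuleCat.Hom.hom _)).2 fun c hc => ?_
        obtain ⟨x, hx, rfl⟩ := exists_cycleClass c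
        rw [homologyMap_cycleClass, cycleClass_eq_zero_iff, isBoundary_iff] at hc
        -- The target is concentrated in degree 0, so being a boundary there means being zero.
        obtain ⟨y, hy⟩ := hc
        rw [HomologicalComplex.single_obj_d] at hy
        rw [cycleClass_eq_zero_iff, isBoundary_iff]
        refine (h₀ x).1 ?_
        rw [← key]
        exact hy.symm
      · intro c
        obtain ⟨x, hx, rfl⟩ := exists_cycleClass c
        obtain ⟨y, rfl⟩ := hε x
        refine ⟨cycleClass y (isCycle_zero y), (homologyMap_cycleClass _ _ _).trans ?_⟩
        congr 1
    | succ n =>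
      rw [quasiIsoAt_iff_exactAt' _ _ (ChainComplex.exactAt_succ_single_obj _ _),
        HomologicalComplex.exactAt_iff' _ (n + 2) (n + 1) n (by simp) (by simp)]
      exact (ShortComplex.moduleCat_exact_iff _).2 (h n)⟩

lemma exact_zero_apply {M : ModuleCat.{u} A} (P : ProjectiveResolution M) (x : P.complex.X 0) :
    (P.π.f 0).hom x = 0 ↔ ∃ y, (P.complex.d 1 0).hom y = x :=
  (ShortComplex.ShortExact.moduleCat_exact_iff_function_exact _).1 P.exact₀ x

lemma exact_succ_apply {M : ModuleCat.{u} A} (P : ProjectiveResolution M) (n : ℕ)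
    (x : P.complex.X (n + 1)) (hx : (P.complex.d (n + 1) n).hom x = 0) :
    ∃ y, (P.complex.d (n + 2) (n + 1)).hom y = x :=
  (ShortComplex.moduleCat_exact_iff _).1 (P.exact_succ n) x hx

lemma π_surjective {M : ModuleCat.{u} A} (P : ProjectiveResolution M) :
    Function.Surjective (P.π.f 0).hom :=
  (ModuleCat.epi_iff_surjective (P.π.f 0)).1 inferInstance

/-- Complexes with compatible bijective semilinear maps have homology of the same length. -/
lemma length_homology_of_bijective {B : Type u} [CommRing B] [Algebra A B]
    (hAB : Function.Surjective (algebraMap A B)) (C : ChainComplex (ModuleCat.{u} A) ℕ)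
    (D : ChainComplex (ModuleCat.{u} B) ℕ) (e : ∀ n, C.X n →+ D.X n)
    (he : ∀ n (a : A) x, e n (a • x) = algebraMap A B a • e n x)
    (hbij : ∀ n, Function.Bijective (e n))
    (hd : ∀ n x, (D.d (n + 1) n).hom (e (n + 1) x) = e n ((C.d (n + 1) n).hom x)) (n : ℕ) :
    Module.length A (C.homology n) = Module.length B (D.homology n) := by
  refine length_homology_congr hAB C D (e n) (he n) (hbij n).2 (fun x => ?_) (fun x => ?_)
  · cases n with
    | zero => exact ⟨fun _ => isCycle_zero _, fun _ => isCycle_zero _⟩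
    | succ n =>
      rw [isCycle_succ, isCycle_succ, hd]
      exact map_eq_zero_iff _ (hbij n).1
  · rw [isBoundary_iff, isBoundary_iff]
    constructor
    · rintro ⟨y, hy⟩
      obtain ⟨y, rfl⟩ := (hbij _).2 y
      exact ⟨y, (hbij n).1 (by rw [← hd, hy])⟩
    · rintro ⟨y, rfl⟩
      exact ⟨e _ y, hd _ _⟩

/-- `Tor` can be computed from any projective resolution of the first argument. -/
lemma length_torModule {M N : Type u} [AddCommGroup M] [Module A M] [AddCommGroup N] [Module A N]
    (P : ProjectiveResolution (ModuleCat.of A M)) (n : ℕ) :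
    Module.length A (torModule A M N n) =
      Module.length A ((((tensorN N).mapHomologicalComplex _).obj P.complex).homology n) :=
  (P.isoLeftDerivedObj (tensorN N) n).toLinearEquiv.length_eq

end resolution

/-! ### Tor over Q as homology of U ⊗ S ⊗ N -/

section comparison

variable {Q : Type u} [CommRing Q]

section

variable (f g : Q) (X : Type u) [AddCommGroup X] [Module Q X]
  {N : Type u} [AddCommGroup N] [Module Q N]

lemma span_smul_top_eq_bot {f g : Q} (hf : ∀ x : N, f • x = 0) (hg : ∀ x : N, g • x = 0) :
    Ideal.span {f, g} • (⊤ : Submodule Q N) = ⊥ := by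
  refine eq_bot_iff.2 (Submodule.smul_le.2 fun r hr x _ => ?_)
  obtain ⟨a, b, rfl⟩ := Ideal.mem_span_pair.1 hr
  rw [Submodule.mem_bot, add_smul, mul_smul, mul_smul, hf, hg, smul_zero, smul_zero, add_zero]

/-- `(X ⊗ S) ⊗ N ≃ X ⊗ N` for a module `N` over `S = Q/(f, g)`. -/
noncomputable def tensorSNEquiv (hf : ∀ x : N, f • x = 0) (hg : ∀ x : N, g • x = 0) :
    (X ⊗[Q] (Q ⧸ Ideal.span {f, g})) ⊗[Q] N ≃ₗ[Q] X ⊗[Q] N :=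
  TensorProduct.assoc Q X (Q ⧸ Ideal.span {f, g}) N ≪≫ₗ
    TensorProduct.congr (LinearEquiv.refl Q X) (TensorProduct.quotTensorEquivQuotSMul N _ ≪≫ₗ
      Submodule.quotEquivOfEqBot _ (span_smul_top_eq_bot hf hg))

lemma tensorSNEquiv_tmul (hf : ∀ x : N, f • x = 0) (hg : ∀ x : N, g • x = 0) (x : X) (q : Q)
    (m : N) : tensorSNEquiv f g X hf hg
      ((x ⊗ₜ (Ideal.Quotient.mk (Ideal.span {f, g}) q)) ⊗ₜ m) = x ⊗ₜ (q • m) := by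
  simp [tensorSNEquiv]

end

section

variable {f g : Q} {M : Type u} [AddCommGroup M] [Module Q M] (D : SemifreeResolution f g M)
  {N : Type u} [AddCommGroup N] [Module Q N]

/-- `Tor^Q(M, N)` is the homology of `U ⊗ S ⊗ N`. -/
lemma length_torModule_US (hf : ∀ x : N, f • x = 0) (hg : ∀ x : N, g • x = 0) (n : ℕ) :
    Module.length Q (torModule Q M N n) =
      Module.length Q ((((tensorN N).mapHomologicalComplex _).obj D.US).homology n) := by
  rw [length_torModule D.res]
  symm
  refine length_homology_of_bijective (A := Q) (B := Q) Function.surjective_id _ _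
    (fun n => (tensorSNEquiv f g (D.U.X n) hf hg).toLinearMap.toAddMonoidHom)
    (fun n a x => (tensorSNEquiv f g (D.U.X n) hf hg).map_smul a x)
    (fun n => (tensorSNEquiv f g (D.U.X n) hf hg).bijective) (fun n x => ?_) n
  have : (LinearMap.rTensor N (D.U.d (n + 1) n).hom) ∘ₗ
      (tensorSNEquiv f g (D.U.X (n + 1)) hf hg).toLinearMap =
      (tensorSNEquiv f g (D.U.X n) hf hg).toLinearMap ∘ₗ
        LinearMap.rTensor N (LinearMap.rTensor _ (D.U.d (n + 1) n).hom) := by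
    refine TensorProduct.ext_threefold fun x s m => ?_
    obtain ⟨q, rfl⟩ := Ideal.Quotient.mk_surjective s
    simp [tensorSNEquiv_tmul]
  exact LinearMap.congr_fun this x

end

end comparison

/-! ### The filtration of U by basis degree, and acyclicity of the kernel of U → V ⊗ R -/

section

variable {Q : Type u} [CommRing Q] {f g : Q}

/-- Each coordinate of `x` in a basis lies in ann (a) = (b). -/
lemma exists_eq_smul_of_smul_eq_zero {a b : Q} (h : Ideal.torsionOf Q Q a = Ideal.span {b})
    {X : Type u} [AddCommGroup X] [Module Q X] [Module.Free Q X] (x : X) (hx : a • x = 0) :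
    ∃ w, x = b • w := by
  let B := Module.Free.chooseBasis Q X
  have h1 : ∀ i, ∃ c, B.repr x i = b * c := fun i => by
    have h2 : B.repr x i ∈ Ideal.torsionOf Q Q a := by
      rw [Ideal.mem_torsionOf_iff, smul_eq_mul, mul_comm]
      simpa using congrArg (fun z => B.repr z i) hx
    rw [h] at h2
    exact Ideal.mem_span_singleton.1 h2
  choose c hc using h1
  refine ⟨∑ i ∈ (B.repr x).support, c i • B i, ?_⟩
  conv_lhs => rw [← B.linearCombination_repr x, Finsupp.linearCombination_apply, Finsupp.sum]
  rw [Finset.smul_sum]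
  exact Finset.sum_congr rfl fun i _ => by rw [hc, mul_smul]

/-- This is exactness of the Tate resolution, tensored with `X`, at the basis element y_{k+1}: its
differentials are alternately f and g. -/
lemma IsExactPair.exists_eq_tateD_smul (hfg : IsExactPair f g) {X : Type u} [AddCommGroup X]
    [Module Q X] [Module.Free Q X] (k : ℕ) (x : X) (hx : tateD f g k • x = 0) :
    ∃ w, x = tateD f g (k + 1) • w := by
  rcases Nat.mod_two_eq_zero_or_one k with hk | hk
  · have hk' : (k + 1) % 2 ≠ 0 := by omega
    rw [tateD, if_pos hk] at hx
    rw [tateD, if_neg hk']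
    exact exists_eq_smul_of_smul_eq_zero hfg.ann_left x hx
  · have hk' : (k + 1) % 2 = 0 := by omega
    rw [tateD, if_neg (by omega)] at hx
    rw [tateD, if_pos hk']
    exact exists_eq_smul_of_smul_eq_zero hfg.ann_right x hx

namespace SemifreeResolution

variable {M : Type u} [AddCommGroup M] [Module Q M] (D : SemifreeResolution f g M)

/-- The degree `n` part of the `A`-submodule of `U` generated by the `V_j` with `j < p`. -/
def filtration (n p : ℕ) : Submodule Q (D.U.X n) :=
  Submodule.span Q {x | ∃ (i j : ℕ) (hij : i + j = n) (v : D.V j), j < p ∧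
    D.dg.y i hij (v : D.U.X j) = x}

lemma y_mem_filtration {i j n p : ℕ} (hij : i + j = n) (hj : j < p) (v : D.V j) :
    D.dg.y i hij (v : D.U.X j) ∈ D.filtration n p :=
  Submodule.subset_span ⟨i, j, hij, v, hj, rfl⟩

lemma filtration_mono (n : ℕ) {p q : ℕ} (h : p ≤ q) : D.filtration n p ≤ D.filtration n q :=
  Submodule.span_mono fun _ ⟨i, j, hij, v, hj, hx⟩ => ⟨i, j, hij, v, hj.trans_le h, hx⟩

/-- An element of degree m involves only the V_j with j ≤ m, and multiplying by y_i does not change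
which V_j occur. -/
lemma y_mem_filtration_of_lt {i m n p : ℕ} (him : i + m = n) (hm : m < p) (x : D.U.X m) :
    D.dg.y i him x ∈ D.filtration n p := by
  refine D.mem_of_gen ((D.filtration n p).comap (D.dg.y i him)) (fun k j hkj v => ?_) x
  rw [Submodule.mem_comap, D.dg.mul_act hkj him (by omega)]
  exact Submodule.smul_of_tower_mem _ _ (D.y_mem_filtration _ (by omega) v)

lemma mem_filtration_of_lt {n p : ℕ} (h : n < p) (x : D.U.X n) : x ∈ D.filtration n p := by
  rw [← D.dg.one_act x]
  exact D.y_mem_filtration_of_lt _ h x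

/-- The Leibniz rule modulo the filtration. -/
lemma d_y_sub_mem_filtration {i j m : ℕ} (h : i + 1 + j = m + 1) (h' : i + j = m) (v : D.V j) :
    (D.U.d (m + 1) m).hom (D.dg.y (i + 1) h (v : D.U.X j)) -
      tateD f g i • D.dg.y i h' (v : D.U.X j) ∈ D.filtration m j := by
  cases j with
  | zero =>
    obtain rfl : i = m := h'
    rw [D.dg.leibniz_zero i (v : D.U.X 0), sub_self]
    exact zero_mem _
  | succ j =>
    rw [D.dg.leibniz_succ h' h (by omega) (v : D.U.X (j + 1)), add_sub_cancel_left]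
    exact Submodule.smul_mem _ _ (D.y_mem_filtration_of_lt _ (by omega) _)

lemma d_mem_filtration {n p : ℕ} (x : D.U.X (n + 1)) (hx : x ∈ D.filtration (n + 1) p) :
    (D.U.d (n + 1) n).hom x ∈ D.filtration n p := by
  have : D.filtration (n + 1) p ≤ (D.filtration n p).comap (D.U.d (n + 1) n).hom := by
    refine Submodule.span_le.2 ?_
    rintro _ ⟨i, j, hij, v, hj, rfl⟩
    rw [SetLike.mem_coe, Submodule.mem_comap]
    cases i with
    | zero => exact D.mem_filtration_of_lt (by omega) _
    | succ i =>
      refine (Submodule.sub_mem_iff_left _ (Submodule.smul_mem _ (tateD f g i)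
        (D.y_mem_filtration (by omega : i + j = n) hj v))).1 ?_
      exact D.filtration_mono _ hj.le (D.d_y_sub_mem_filtration hij _ v)
  exact this hx

/-- Leading terms: in degree n, the layer that V_p adds to the filtration is spanned by y_{n-p}V_p.
-/
lemma exists_sub_mem_filtration {n p : ℕ} (hp : n - p + p = n) (x : D.U.X n)
    (hx : x ∈ D.filtration n (p + 1)) :
    ∃ v : D.V p, x - D.dg.y (n - p) hp (v : D.U.X p) ∈ D.filtration n p := by
  refine Submodule.span_induction (p := fun x _ => ∃ v : D.V p,
    x - D.dg.y (n - p) hp (v : D.U.X p) ∈ D.filtration n p) ?_ ?_ ?_ ?_ hx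
  · rintro _ ⟨i, j, hij, v, hj, rfl⟩
    by_cases hjp : j = p
    · subst hjp
      obtain rfl : i = n - j := by omega
      exact ⟨v, by rw [sub_self]; exact zero_mem _⟩
    · refine ⟨0, ?_⟩
      rw [Submodule.coe_zero, map_zero, sub_zero]
      exact D.y_mem_filtration _ (by omega) v
  · exact ⟨0, by rw [Submodule.coe_zero, map_zero, sub_zero]; exact zero_mem _⟩
  · rintro x y _ _ ⟨v, hv⟩ ⟨w, hw⟩
    refine ⟨v + w, ?_⟩
    rw [Submodule.coe_add, map_add, add_sub_add_comm]
    exact add_mem hv hw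
  · rintro a x _ ⟨v, hv⟩
    refine ⟨a • v, ?_⟩
    rw [Submodule.coe_smul, map_smul, ← smul_sub]
    exact Submodule.smul_mem _ _ hv

/-- `y_i v` with `v ∈ V_p` nonzero does not lie in the part of the filtration before `V_p`. -/
lemma eq_zero_of_y_mem_filtration {i n p : ℕ} (hp : i + p = n) (v : D.V p)
    (h : D.dg.y i hp (v : D.U.X p) ∈ D.filtration n p) : v = 0 := by
  let c : D.U.X n →ₗ[Q] D.V p :=
    LinearMap.proj (φ := fun j : Fin (n + 1) => D.V j) ⟨p, by omega⟩ ∘ₗ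
      (D.decomp n).symm.toLinearMap
  have h1 : D.filtration n p ≤ LinearMap.ker c := by
    refine Submodule.span_le.2 ?_
    rintro _ ⟨i, j, hij, v, hj, rfl⟩
    change (D.decomp n).symm _ ⟨p, _⟩ = 0
    rw [D.decomp_symm_y', Pi.single_eq_of_ne]
    simp only [ne_eq, Fin.ext_iff]; omega
  have h2 : (D.decomp n).symm (D.dg.y i hp (v : D.U.X p)) ⟨p, by omega⟩ = 0 := h1 h
  rw [D.decomp_symm_y'] at h2
  exact (Pi.single_eq_same (M := fun j : Fin (n + 1) => D.V j) ⟨p, by omega⟩ v).symm.trans h2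

lemma pr_eq_zero_of_mem_filtration {n : ℕ} (x : D.U.X n) (hx : x ∈ D.filtration n n) :
    D.pr n x = 0 := by
  have : D.filtration n n ≤ LinearMap.ker (D.pr n) := by
    refine Submodule.span_le.2 ?_
    rintro _ ⟨i, j, hij, v, hj, rfl⟩
    exact D.pr_y_gen (by omega) hij v
  exact this hx

/-- If y_k v is the leading term of `x`, it can be removed by subtracting the boundary of y_{k+1} w
as soon as v = ∂-coefficient times w. For k = 0 that coefficient is f and the condition on `pr`
applies. For k > 0 the leading term of ∂x = 0 shows that v is killed by the previous coefficient,
and the exact pair provides w. -/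
lemma exists_d_sub_mem_filtration (hfg : IsExactPair f g) {n p : ℕ} (x : D.U.X n)
    (hx : x ∈ D.filtration n (p + 1)) (hpr : ∃ w, D.pr n x = f • w) (hc : IsCycle D.U n x) :
    ∃ z : D.U.X (n + 1), D.pr (n + 1) z = 0 ∧
      x - (D.U.d (n + 1) n).hom z ∈ D.filtration n p := by
  have := D.free p
  by_cases hpn : n < p
  · exact ⟨0, map_zero _, by rw [map_zero, sub_zero]; exact D.mem_filtration_of_lt hpn x⟩
  obtain ⟨k, hk⟩ : ∃ k, k + p = n := ⟨n - p, by omega⟩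
  obtain ⟨v, hv⟩ := D.exists_sub_mem_filtration (by omega) x hx
  have hv' : x - D.dg.y k hk (v : D.U.X p) ∈ D.filtration n p := by
    obtain rfl : k = n - p := by omega
    exact hv
  suffices h : ∃ w, v = tateD f g k • w by
    obtain ⟨w, hw⟩ := h
    refine ⟨D.dg.y (k + 1) (by omega) (w : D.U.X p), D.pr_y_gen (by omega) _ w, ?_⟩
    have h1 := D.d_y_sub_mem_filtration (by omega : k + 1 + p = n + 1) hk w
    have h2 := sub_mem hv' h1
    rw [hw, Submodule.coe_smul, map_smul] at h2
    convert h2 using 1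
    abel
  cases k with
  | zero =>
    obtain rfl : p = n := by omega
    obtain ⟨w, hw⟩ := hpr
    refine ⟨w, ?_⟩
    rw [D.dg.one_act] at hv'
    have := D.pr_eq_zero_of_mem_filtration _ hv'
    rw [map_sub, D.pr_coe, sub_eq_zero] at this
    rw [← this, hw]
    rfl
  | succ k =>
    refine hfg.exists_eq_tateD_smul k v ?_
    obtain ⟨m, rfl⟩ : ∃ m, n = m + 1 := ⟨k + p, by omega⟩
    refine D.eq_zero_of_y_mem_filtration (i := k) (n := m) (by omega) _ ?_
    have h1 := D.d_mem_filtration _ hv'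
    rw [map_sub, hc m, zero_sub, Submodule.neg_mem_iff] at h1
    have h2 := sub_mem h1 (D.d_y_sub_mem_filtration hk (by omega) v)
    rwa [sub_sub_cancel, ← map_smul] at h2

lemma pr_d_mem {n : ℕ} (z : D.U.X (n + 1)) (hz : ∃ w, D.pr (n + 1) z = f • w) :
    ∃ w, D.pr n ((D.U.d (n + 1) n).hom z) = f • w := by
  obtain ⟨w, hw⟩ := hz
  exact ⟨D.dV n w + D.prY n z, by rw [D.pr_d, hw, map_smul, smul_add]⟩

/-- The kernel of `U → V ⊗ R` is acyclic. -/
lemma exists_d_eq_of_pr (hfg : IsExactPair f g) {n : ℕ} (x : D.U.X n)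
    (hpr : ∃ w, D.pr n x = f • w) (hc : IsCycle D.U n x) :
    ∃ z : D.U.X (n + 1), (∃ w, D.pr (n + 1) z = f • w) ∧ (D.U.d (n + 1) n).hom z = x := by
  have key : ∀ p, ∀ x ∈ D.filtration n p, (∃ w, D.pr n x = f • w) → IsCycle D.U n x →
      ∃ z : D.U.X (n + 1), (∃ w, D.pr (n + 1) z = f • w) ∧ (D.U.d (n + 1) n).hom z = x := by
    intro p
    induction p with
    | zero =>
      intro x hx _ _
      have : D.filtration n 0 = ⊥ := by simp [filtration]
      rw [this, Submodule.mem_bot] at hx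
      exact ⟨0, ⟨0, by rw [map_zero, smul_zero]⟩, by rw [hx, map_zero]⟩
    | succ p ih =>
      intro x hx hpr hc
      obtain ⟨z, hz, hxz⟩ := D.exists_d_sub_mem_filtration hfg x hx hpr hc
      obtain ⟨w, hw⟩ := hpr
      -- Subtracting ∂z keeps the projection to V divisible by f, so the induction hypothesis still
      -- applies.
      obtain ⟨w', hw'⟩ := D.pr_d_mem z ⟨0, by rw [hz, smul_zero]⟩
      obtain ⟨z', ⟨u, hu⟩, hd⟩ := ih _ hxz ⟨w - w', by rw [map_sub, hw, hw', smul_sub]⟩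
        (fun j => by rw [map_sub, hc j, d_d_apply, sub_zero])
      exact ⟨z' + z, ⟨u, by rw [map_add, hz, hu, add_zero]⟩, by rw [map_add, hd, sub_add_cancel]⟩
  -- In degree n the filtration is exhausted at step n + 1.
  exact key (n + 1) x (D.mem_filtration_of_lt (Nat.lt_succ_self n) x) hpr hc

/-- Exactness modulo f descends from U. The element ∂v is a cycle in the acyclic kernel, so ∂v = ∂z
with z in that kernel. Then v - z is a cycle of U, hence a boundary, and projecting to V gives the
claim. -/
lemma dV_exact_succ (hfg : IsExactPair f g) {n : ℕ} (v u) (h : D.dV n v = f • u) :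
    ∃ w u', v = D.dV (n + 1) w + f • u' := by
  obtain ⟨z, ⟨w, hw⟩, hd⟩ := D.exists_d_eq_of_pr hfg ((D.U.d (n + 1) n).hom (v : D.U.X (n + 1)))
    ⟨u, h⟩ (fun j => d_d_apply _ _ _ _ _)
  obtain ⟨x, hx⟩ := exact_succ_apply D.res n ((v : D.U.X (n + 1)) - z)
    (by rw [map_sub, hd, sub_self])
  have h1 := D.pr_d x
  rw [hx, map_sub, D.pr_coe, hw] at h1
  exact ⟨D.pr (n + 2) x, D.prY (n + 1) x + w, by
    rw [smul_add, ← add_assoc, ← h1, sub_add_cancel]⟩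

lemma coe_pr_zero (x : D.U.X 0) : (D.pr 0 x : D.U.X 0) = x := by
  have h : x ∈ LinearMap.ker ((D.V 0).subtype ∘ₗ D.pr 0 - LinearMap.id) := by
    refine D.mem_of_gen _ (fun i j hij v => ?_) x
    obtain ⟨rfl, rfl⟩ : i = 0 ∧ j = 0 := by omega
    rw [D.dg.one_act, LinearMap.mem_ker, LinearMap.sub_apply, LinearMap.comp_apply, D.pr_coe]
    exact sub_self _
  exact sub_eq_zero.1 (LinearMap.mem_ker.1 h)

/-- In degree 0 one has U_0 = V_0. Boundaries from U_1 = V_1 ⊕ yV_0 give the image of ∂^V plus fV_0,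
and fV_0 maps to zero because f kills M. -/
lemma dV_exact_zero (hfM : ∀ x : M, f • x = 0) (v : D.V 0) :
    (D.res.π.f 0).hom (v : D.U.X 0) = (0 : ModuleCat.of Q M) ↔
      ∃ w u, v = D.dV 0 w + f • u := by
  constructor
  · intro h
    obtain ⟨x, hx⟩ := (exact_zero_apply D.res _).1 h
    have h1 := D.pr_d x
    rw [hx, D.pr_coe] at h1
    exact ⟨_, _, h1⟩
  · rintro ⟨w, u, rfl⟩
    have e : (D.dV 0 w : D.U.X 0) = (D.U.d 1 0).hom (w : D.U.X 1) := D.coe_pr_zero _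
    rw [Submodule.coe_add, map_add, Submodule.coe_smul, map_smul, e]
    have h1 := (exact_zero_apply D.res _).2 ⟨(w : D.U.X 1), rfl⟩
    rw [h1, zero_add]
    exact hfM _

end SemifreeResolution
end

/-! ### V ⊗ R as a free resolution over R, and Tor over R as homology of V ⊗ S ⊗ N -/

noncomputable section

variable {Q : Type u} [CommRing Q] {f g : Q}

section

variable (f) {X : Type u} [AddCommGroup X] [Module Q X]

lemma exists_one_tmul (z : (Q ⧸ Ideal.span {f}) ⊗[Q] X) :
    ∃ x : X, z = (1 : Q ⧸ Ideal.span {f}) ⊗ₜ x := by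
  obtain ⟨x, hx⟩ := Submodule.Quotient.mk_surjective _
    (TensorProduct.quotTensorEquivQuotSMul X (Ideal.span {f}) z)
  refine ⟨x, ?_⟩
  rw [← LinearEquiv.symm_apply_apply (TensorProduct.quotTensorEquivQuotSMul X (Ideal.span {f})) z,
    ← hx, TensorProduct.quotTensorEquivQuotSMul_symm_mk]

/-- Since R ⊗ X is X/fX, vanishing in R ⊗ X becomes divisibility by f of a lift to X. With
`exists_one_tmul` this reduces questions about V ⊗ R to congruences in V. -/
lemma one_tmul_eq_zero_iff (x : X) :
    (1 : Q ⧸ Ideal.span {f}) ⊗ₜ[Q] x = 0 ↔ ∃ u, x = f • u := by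
  rw [← LinearEquiv.map_eq_zero_iff (TensorProduct.quotTensorEquivQuotSMul X (Ideal.span {f})),
    TensorProduct.quotTensorEquivQuotSMul_mk_one_tmul, Submodule.Quotient.mk_eq_zero,
    Submodule.ideal_span_singleton_smul, Submodule.mem_smul_pointwise_iff_exists]
  simp [eq_comm]

end

namespace SemifreeResolution

variable {M : Type u} [AddCommGroup M] [Module Q M] (D : SemifreeResolution f g M)

/-- The complex `V ⊗ R` over `R = Q/(f)`. -/
def VR : ChainComplex (ModuleCat.{u} (Q ⧸ Ideal.span {f})) ℕ :=
  ChainComplex.of (fun n => ModuleCat.of _ ((Q ⧸ Ideal.span {f}) ⊗[Q] D.V n))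
    (fun n => ModuleCat.ofHom (LinearMap.baseChange _ (D.dV n)))
    (fun n => by
      refine ModuleCat.hom_ext (LinearMap.ext fun z => ?_)
      obtain ⟨v, rfl⟩ := exists_one_tmul f z
      change (1 : Q ⧸ Ideal.span {f}) ⊗ₜ[Q] D.dV n (D.dV (n + 1) v) = 0
      rw [one_tmul_eq_zero_iff]
      exact ⟨_, D.tauLift_spec v⟩)

lemma VR_d_tmul (n : ℕ) (r : Q ⧸ Ideal.span {f}) (v : D.V (n + 1)) :
    (D.VR.d (n + 1) n).hom (r ⊗ₜ v : (Q ⧸ Ideal.span {f}) ⊗[Q] D.V (n + 1)) =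
      (r ⊗ₜ D.dV n v : (Q ⧸ Ideal.span {f}) ⊗[Q] D.V n) := by
  simp only [VR, ChainComplex.of_d]
  rfl

variable [Module (Q ⧸ Ideal.span {f}) M] [IsScalarTower Q (Q ⧸ Ideal.span {f}) M]

omit D in
lemma smul_eq_zero_of_tower {N : Type u} [AddCommGroup N] [Module Q N]
    [Module (Q ⧸ Ideal.span {f}) N] [IsScalarTower Q (Q ⧸ Ideal.span {f}) N] (x : N) :
    f • x = 0 := by
  rw [← one_smul (Q ⧸ Ideal.span {f}) x, ← smul_assoc, Algebra.smul_def, mul_one,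
    Ideal.Quotient.algebraMap_eq, Ideal.Quotient.eq_zero_iff_mem.2 (Ideal.mem_span_singleton_self f),
    zero_smul]

/-- The augmentation `V_0 → M`. -/
def aug : D.V 0 →ₗ[Q] M :=
  LinearMap.comp (M₂ := D.U.X 0) (D.res.π.f 0).hom (D.V 0).subtype

/-- The augmentation `V_0 ⊗ R → M`. -/
def augR : D.VR.X 0 ⟶ ModuleCat.of (Q ⧸ Ideal.span {f}) M :=
  ModuleCat.ofHom (X := (Q ⧸ Ideal.span {f}) ⊗[Q] D.V 0) (LinearMap.liftBaseChange _ D.aug)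

lemma augR_one_tmul (v : D.V 0) :
    D.augR.hom ((1 : Q ⧸ Ideal.span {f}) ⊗ₜ[Q] v : (Q ⧸ Ideal.span {f}) ⊗[Q] D.V 0) =
      D.aug v :=
  (LinearMap.liftBaseChange_tmul _ D.aug 1 v).trans (one_smul _ _)

/-- `V ⊗ R` is a free resolution of `M` over `R`. -/
def resR (hfg : IsExactPair f g) :
    ProjectiveResolution (ModuleCat.of (Q ⧸ Ideal.span {f}) M) :=
  projectiveResolutionOfExact D.VR
    (fun n => by
      have := D.free n
      exact (inferInstance :
        Module.Projective (Q ⧸ Ideal.span {f}) ((Q ⧸ Ideal.span {f}) ⊗[Q] D.V n)))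
    D.augR
    (fun m => by
      obtain ⟨x, hx⟩ := π_surjective D.res m
      refine ⟨((1 : Q ⧸ Ideal.span {f}) ⊗ₜ[Q] D.pr 0 x : (Q ⧸ Ideal.span {f}) ⊗[Q] D.V 0), ?_⟩
      rw [augR_one_tmul]
      exact (congrArg (D.res.π.f 0).hom (D.coe_pr_zero x)).trans hx)
    (fun z => by
      obtain ⟨v, rfl⟩ := exists_one_tmul f (X := D.V 0) z
      rw [augR_one_tmul]
      refine (D.dV_exact_zero smul_eq_zero_of_tower v).trans ⟨?_, ?_⟩
      · rintro ⟨w, u, rfl⟩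
        refine ⟨((1 : Q ⧸ Ideal.span {f}) ⊗ₜ[Q] w : (Q ⧸ Ideal.span {f}) ⊗[Q] D.V 1), ?_⟩
        rw [VR_d_tmul, TensorProduct.tmul_add, (one_tmul_eq_zero_iff f (f • u)).2 ⟨u, rfl⟩, add_zero]
      · rintro ⟨y, hy⟩
        obtain ⟨w, rfl⟩ := exists_one_tmul f (X := D.V 1) y
        rw [VR_d_tmul] at hy
        obtain ⟨u, hu⟩ := (one_tmul_eq_zero_iff f (v - D.dV 0 w)).1
          (by rw [TensorProduct.tmul_sub, hy, sub_self])
        exact ⟨w, u, by rw [← hu]; abel⟩)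
    (fun n z hz => by
      obtain ⟨v, rfl⟩ := exists_one_tmul f (X := D.V (n + 1)) z
      rw [VR_d_tmul] at hz
      obtain ⟨u, hu⟩ := (one_tmul_eq_zero_iff f _).1 hz
      obtain ⟨w, u', rfl⟩ := D.dV_exact_succ hfg v u hu
      refine ⟨((1 : Q ⧸ Ideal.span {f}) ⊗ₜ[Q] w : (Q ⧸ Ideal.span {f}) ⊗[Q] D.V (n + 2)), ?_⟩
      rw [VR_d_tmul, TensorProduct.tmul_add, (one_tmul_eq_zero_iff f (f • u')).2 ⟨u', rfl⟩,
        add_zero])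

section

variable {N : Type u} [AddCommGroup N] [Module Q N] [Module (Q ⧸ Ideal.span {f}) N]
  [IsScalarTower Q (Q ⧸ Ideal.span {f}) N]

/-- `X ⊗_Q N ≃ (R ⊗_Q X) ⊗_R N`. -/
def tensorRNEquiv (X N : Type u) [AddCommGroup X] [Module Q X] [AddCommGroup N] [Module Q N]
    [Module (Q ⧸ Ideal.span {f}) N] [IsScalarTower Q (Q ⧸ Ideal.span {f}) N] :
    X ⊗[Q] N ≃+ ((Q ⧸ Ideal.span {f}) ⊗[Q] X) ⊗[Q ⧸ Ideal.span {f}] N :=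
  ((TensorProduct.comm Q X N).toAddEquiv.trans
    (TensorProduct.AlgebraTensorModule.cancelBaseChange Q (Q ⧸ Ideal.span {f})
      (Q ⧸ Ideal.span {f}) N X).symm.toAddEquiv).trans
    (TensorProduct.comm (Q ⧸ Ideal.span {f}) N _).toAddEquiv

lemma tensorRNEquiv_tmul (X : Type u) [AddCommGroup X] [Module Q X] (x : X) (m : N) :
    tensorRNEquiv (f := f) X N (x ⊗ₜ m) = (1 ⊗ₜ x) ⊗ₜ m := rfl

lemma tensorRNEquiv_smul (X : Type u) [AddCommGroup X] [Module Q X] (a : Q) (z : X ⊗[Q] N) :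
    tensorRNEquiv (f := f) X N (a • z) =
      algebraMap Q (Q ⧸ Ideal.span {f}) a • tensorRNEquiv (f := f) X N z := by
  induction z with
  | zero => simp
  | add x y hx hy => rw [smul_add, map_add, hx, hy, map_add, smul_add]
  | tmul x m =>
    rw [← TensorProduct.tmul_smul, tensorRNEquiv_tmul, tensorRNEquiv_tmul,
      ← TensorProduct.tmul_smul, algebraMap_smul]

/-- `Tor^R(M, N)` is the homology of `V ⊗ S ⊗ N`. -/
lemma length_torModule_VS (hfg : IsExactPair f g) (hg : ∀ x : N, g • x = 0) (n : ℕ) :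
    Module.length (Q ⧸ Ideal.span {f}) (torModule (Q ⧸ Ideal.span {f}) M N n) =
      Module.length Q ((((tensorN N).mapHomologicalComplex _).obj D.VS).homology n) := by
  rw [length_torModule (D.resR hfg)]
  symm
  let e : ∀ n, (D.V n ⊗[Q] (Q ⧸ Ideal.span {f, g})) ⊗[Q] N ≃+
      ((Q ⧸ Ideal.span {f}) ⊗[Q] D.V n) ⊗[Q ⧸ Ideal.span {f}] N := fun n =>
    (tensorSNEquiv f g (D.V n) smul_eq_zero_of_tower hg).toAddEquiv.trans (tensorRNEquiv _ N)
  have he : ∀ n v q m, e n ((v ⊗ₜ (Ideal.Quotient.mk (Ideal.span {f, g}) q)) ⊗ₜ m) =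
      (1 ⊗ₜ v) ⊗ₜ (q • m) := fun n v q m =>
    congrArg (tensorRNEquiv _ N) (tensorSNEquiv_tmul f g (D.V n) smul_eq_zero_of_tower hg v q m)
  refine length_homology_of_bijective Ideal.Quotient.mk_surjective _ _
    (fun n => (e n).toAddMonoidHom) (fun n a x => ?_) (fun n => (e n).bijective) (fun n x => ?_) n
  · exact (congrArg (tensorRNEquiv _ N) ((tensorSNEquiv f g (D.V n) smul_eq_zero_of_tower
      hg).map_smul a x)).trans (tensorRNEquiv_smul _ _ _)
  · change (LinearMap.rTensor N (D.VR.d (n + 1) n).hom) (e (n + 1) x) =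
      e n (LinearMap.rTensor N (D.VS.d (n + 1) n).hom x)
    rw [D.VS_d]
    let φ : (D.V (n + 1) ⊗[Q] (Q ⧸ Ideal.span {f, g})) ⊗[Q] N →+
        ((Q ⧸ Ideal.span {f}) ⊗[Q] D.V n) ⊗[Q ⧸ Ideal.span {f}] N :=
      (LinearMap.rTensor N (D.VR.d (n + 1) n).hom).toAddMonoidHom.comp
      (e (n + 1)).toAddMonoidHom
    let ψ : (D.V (n + 1) ⊗[Q] (Q ⧸ Ideal.span {f, g})) ⊗[Q] N →+
        ((Q ⧸ Ideal.span {f}) ⊗[Q] D.V n) ⊗[Q ⧸ Ideal.span {f}] N :=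
      (e n).toAddMonoidHom.comp (LinearMap.rTensor N
        (LinearMap.rTensor (Q ⧸ Ideal.span {f, g}) (D.dV n))).toAddMonoidHom
    -- The source is a tensor product over Q and the target one over R, so the maps are compared as
    -- additive maps on pure tensors.
    suffices h : ∀ z m, φ (z ⊗ₜ m) = ψ (z ⊗ₜ m) by
      have h' : ∀ x, φ x = ψ x := fun x => by
        induction x with
        | zero => rw [map_zero, map_zero]
        | add a b ha hb => rw [map_add, map_add, ha, hb]
        | tmul z m => exact h z m
      exact h' x
    intro z m
    induction z with
    | zero => rw [TensorProduct.zero_tmul, map_zero, map_zero]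
    | add a b ha hb => rw [TensorProduct.add_tmul, map_add, map_add, ha, hb]
    | tmul v s =>
      obtain ⟨q, rfl⟩ := Ideal.Quotient.mk_surjective s
      change LinearMap.rTensor N (D.VR.d (n + 1) n).hom (e (n + 1) _) =
        e n ((D.dV n v ⊗ₜ _) ⊗ₜ m)
      refine Eq.trans ?_ (he n (D.dV n v) q m).symm
      refine (congrArg _ (he (n + 1) v q m)).trans ?_
      exact congrArg (fun z : (Q ⧸ Ideal.span {f}) ⊗[Q] D.V n => z ⊗ₜ[Q ⧸ Ideal.span {f}] (q • m))
        (D.VR_d_tmul n 1 v)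

end

end SemifreeResolution

end

/-! ### Homology of shifts, and the mapping cone sequence -/

noncomputable section

namespace SemifreeResolution

variable {Q : Type u} [CommRing Q] {f g : Q}
  {M : Type u} [AddCommGroup M] [Module Q M] (D : SemifreeResolution f g M)
  (N : Type u) [AddCommGroup N] [Module Q N]

/-- The functor `- ⊗ S ⊗ N`. -/
abbrev tensorSN (f g : Q) (N : Type u) [AddCommGroup N] [Module Q N] :
    ModuleCat.{u} Q ⥤ ModuleCat.{u} Q := tensorS f g ⋙ tensorN N

lemma subsingleton_tensorSN (X : ModuleCat.{u} Q) [Subsingleton X] :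
    Subsingleton ((tensorSN f g N).obj X) := by
  have : Subsingleton ((X ⊗[Q] (Q ⧸ Ideal.span {f, g})) ⊗[Q] N) := inferInstance
  exact this

/-- The complex `U ⊗ S ⊗ N`. -/
abbrev USN : ChainComplex (ModuleCat.{u} Q) ℕ := ((tensorN N).mapHomologicalComplex _).obj D.US

/-- The complex `Σ²U ⊗ S ⊗ N`. -/
abbrev shiftUSN : ChainComplex (ModuleCat.{u} Q) ℕ :=
  ((tensorN N).mapHomologicalComplex _).obj D.shiftUS

/-- The complex `V ⊗ S ⊗ N`. -/
abbrev VSN : ChainComplex (ModuleCat.{u} Q) ℕ := ((tensorN N).mapHomologicalComplex _).obj D.VS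

/-- The complex `W ⊗ N`. -/
abbrev WN (hfg : IsExactPair f g) : ChainComplex (ModuleCat.{u} Q) ℕ :=
  ((tensorN N).mapHomologicalComplex _).obj (D.W hfg)

lemma length_homology_shiftUS_zero : Module.length Q
    ((D.shiftUSN N).homology 0) = 0 :=
  length_homology_eq_zero _ _
    (subsingleton_tensorSN N (ModuleCat.of Q PUnit) : Subsingleton ((tensorSN f g N).obj _))

lemma length_homology_shiftUS_one : Module.length Q
    ((D.shiftUSN N).homology 1) = 0 :=
  length_homology_eq_zero _ _
    (subsingleton_tensorSN N (ModuleCat.of Q PUnit) : Subsingleton ((tensorSN f g N).obj _))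

/-- The terms and differentials agree, so the identity matches cycles and boundaries. In the lowest
degree every element is a cycle on both sides, the next term of the shift being zero. -/
lemma length_homology_shiftUS_add_two (n : ℕ) : Module.length Q
    ((D.shiftUSN N).homology (n + 2)) =
      Module.length Q ((D.USN N).homology n) := by
  refine length_homology_congr' _ _ (LinearMap.id : (tensorSN f g N).obj (D.U.X n) →ₗ[Q] _)
    Function.surjective_id (fun x => ?_) (fun x => ?_)
  · match n with
    | 0 =>
      refine ⟨fun _ => (isCycle_succ _).2 ?_, fun _ => isCycle_zero _⟩
      have : Subsingleton ((D.shiftUSN N).X 1) :=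
        subsingleton_tensorSN N (ModuleCat.of Q PUnit)
      exact Subsingleton.elim _ _
    | n + 1 =>
      exact (isCycle_succ (C := D.USN N) x).trans
        (isCycle_succ (C := D.shiftUSN N) (n := n + 2) x).symm
  · exact (isBoundary_iff (C := D.USN N) x).trans
      (isBoundary_iff (C := D.shiftUSN N) (n := n + 2) x).symm

/-! ### The mapping cone sequence -/

/-- The differential of `ΣV`, with the sign of the mapping cone. -/
def negPrevD (n : ℕ) : D.prev (n + 1) ⟶ D.prev n :=
  ModuleCat.ofHom (X := D.V n) (-(D.prevD n))

/-- The map `τ̃ : V_{n+1} → V_{n-1}` as a morphism. -/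
def prevTauHom (n : ℕ) : ModuleCat.of Q (D.V (n + 1)) ⟶ D.prev n :=
  ModuleCat.ofHom (D.prevTau n)

/-- The shift `ΣV ⊗ S`, with the sign of the mapping cone in the differential. -/
def shiftVS : ChainComplex (ModuleCat.{u} Q) ℕ :=
  ChainComplex.of (fun n => (tensorS f g).obj (D.prev n))
    (fun n => (tensorS f g).map (D.negPrevD n))
    (fun n => by
      rw [← Functor.map_comp, ← (tensorS f g).map_zero]
      refine tensorS_map_eq _ _ fun v => ?_
      match n with
      | 0 => exact zero_mem _
      | n + 1 =>
        have key : ∀ v : D.V (n + 2), -D.dV n (-D.dV (n + 1) v) - 0 ∈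
            Ideal.span {f, g} • (⊤ : Submodule Q (D.V n)) := fun v => by
          rw [sub_zero, map_neg, neg_neg, D.tauLift_spec]
          exact smul_mem_top _
        exact key v)

/-- The inclusion `V_{n-1} → V_{n-1} ⊕ V_n`. -/
def coneInl (n : ℕ) : D.prev n ⟶ D.coneX n :=
  ModuleCat.ofHom (Y := D.prev n × D.V n) (LinearMap.inl Q (D.prev n) (D.V n))

/-- The inclusion `V_n → V_{n-1} ⊕ V_n`. -/
def coneInr (n : ℕ) : ModuleCat.of Q (D.V n) ⟶ D.coneX n :=
  ModuleCat.ofHom (Y := D.prev n × D.V n) (LinearMap.inr Q (D.prev n) (D.V n))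

/-- The projection `V_{n-1} ⊕ V_n → V_n`. -/
def coneSnd (n : ℕ) : D.coneX n ⟶ ModuleCat.of Q (D.V n) :=
  ModuleCat.ofHom (X := D.prev n × D.V n) (LinearMap.snd Q (D.prev n) (D.V n))

lemma coneInr_snd (n : ℕ) : D.coneInr n ≫ D.coneSnd n = 𝟙 _ := rfl

lemma coneInr_coneD (n : ℕ) : D.coneInr (n + 1) ≫ D.coneD n =
    (-D.prevTauHom n) ≫ D.coneInl n +
      ModuleCat.ofHom (D.dV n) ≫ D.coneInr n := by
  refine ModuleCat.hom_ext (LinearMap.ext fun v => ?_)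
  change ((-(D.prevD n 0) - D.prevTau n v, D.dV n v) : D.prev n × D.V n) =
    (-D.prevTau n v, 0) + (0, D.dV n v)
  rw [map_zero, neg_zero, zero_sub, Prod.mk_add_mk, add_zero, zero_add]

/-- The inclusion of `ΣV ⊗ S` in the mapping cone. -/
def coneι (hfg : IsExactPair f g) : D.shiftVS ⟶ D.W hfg where
  f n := (tensorS f g).map (D.coneInl n)
  comm' i j hij := by
    simp only [ComplexShape.down_Rel] at hij
    subst hij
    simp only [W, shiftVS, ChainComplex.of_d]
    rw [← Functor.map_comp, ← Functor.map_comp]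
    congr 1
    refine ModuleCat.hom_ext (LinearMap.ext fun v => ?_)
    change ((-(D.prevD j v) - D.prevTau j 0, D.dV j 0) : D.prev j × D.V j) =
      (-(D.prevD j v), 0)
    rw [map_zero, map_zero, sub_zero]

/-- The projection from the mapping cone to `V ⊗ S`. -/
def coneπ (hfg : IsExactPair f g) : D.W hfg ⟶ D.VS where
  f n := (tensorS f g).map (D.coneSnd n)
  comm' i j hij := by
    simp only [ComplexShape.down_Rel] at hij
    subst hij
    simp only [W, VS, ChainComplex.of_d]
    rw [← Functor.map_comp, ← Functor.map_comp]
    rfl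

/-- The complex `ΣV ⊗ S ⊗ N`. -/
abbrev shiftVSN : ChainComplex (ModuleCat.{u} Q) ℕ :=
  ((tensorN N).mapHomologicalComplex _).obj D.shiftVS

/-- The sequence `0 → ΣV ⊗ S ⊗ N → W ⊗ N → V ⊗ S ⊗ N → 0`. -/
def coneSeq (hfg : IsExactPair f g) : ShortComplex (ChainComplex (ModuleCat.{u} Q) ℕ) :=
  ShortComplex.mk (((tensorN N).mapHomologicalComplex _).map (D.coneι hfg))
    (((tensorN N).mapHomologicalComplex _).map (D.coneπ hfg)) (by
      rw [← Functor.map_comp]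
      have : D.coneι hfg ≫ D.coneπ hfg = 0 := by
        ext n : 1
        change (tensorS f g).map _ ≫ (tensorS f g).map _ = 0
        exact ((tensorS f g).map_comp _ _).symm.trans ((tensorS f g).map_zero _ _)
      rw [this, Functor.map_zero])

/-- The degree `n` part of the mapping cone sequence, before tensoring. -/
def coneSeqX (n : ℕ) : ShortComplex (ModuleCat.{u} Q) :=
  ShortComplex.mk (D.coneInl n) (D.coneSnd n) rfl

lemma coneSeqX_shortExact (n : ℕ) : (D.coneSeqX n).ShortExact where
  mono_f := (ModuleCat.mono_iff_injective (D.coneInl n)).2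
    (LinearMap.inl_injective (R := Q) (M := D.prev n) (M₂ := D.V n))
  epi_g := (ModuleCat.epi_iff_surjective (D.coneSnd n)).2
    (LinearMap.snd_surjective (R := Q) (M := D.prev n) (M₂ := D.V n))
  exact := (ShortComplex.moduleCat_exact_iff _).2 fun x hx =>
    ⟨x.1, Prod.ext rfl (Eq.symm hx)⟩

lemma coneSeq_shortExact (hfg : IsExactPair f g) : (D.coneSeq N hfg).ShortExact := by
  refine HomologicalComplex.shortExact_of_degreewise_shortExact _ fun n => ?_
  have := D.free n
  have : Projective (D.coneSeqX n).X₃ :=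
    (IsProjective.iff_projective (ModuleCat.of Q (D.V n))).1 inferInstance
  exact (((D.coneSeqX_shortExact n).splittingOfProjective.map
    (tensorS f g ⋙ tensorN N)).shortExact :)

lemma length_homology_shiftVS_zero : Module.length Q
    ((D.shiftVSN N).homology 0) = 0 :=
  length_homology_eq_zero _ _
    (subsingleton_tensorSN N (ModuleCat.of Q PUnit) : Subsingleton ((tensorSN f g N).obj _))

lemma shiftVS_d (n : ℕ) : (D.shiftVSN N).d (n + 1) n =
    (tensorSN f g N).map (D.negPrevD n) := by
  change (tensorN N).map (D.shiftVS.d _ _) = _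
  simp only [shiftVS, ChainComplex.of_d]
  rfl

lemma VSN_d (n : ℕ) : (D.VSN N).d (n + 1) n =
    (tensorSN f g N).map (ModuleCat.ofHom (D.dV n)) := by
  change (tensorN N).map (D.VS.d _ _) = _
  rw [VS_d]
  rfl

lemma WN_d (hfg : IsExactPair f g) (n : ℕ) :
    (D.WN N hfg).d (n + 1) n =
    (tensorSN f g N).map (D.coneD n) := by
  change (tensorN N).map ((D.W hfg).d _ _) = _
  simp only [W, ChainComplex.of_d]
  rfl

lemma shiftVS_d_succ_apply (n : ℕ)
    (x : (D.VSN N).X (n + 1)) :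
    ((D.shiftVSN N).d (n + 2) (n + 1)).hom x =
      -((D.VSN N).d (n + 1) n).hom x := by
  rw [shiftVS_d, VSN_d]
  have : D.negPrevD (n + 1) = -ModuleCat.ofHom (D.dV n) := rfl
  rw [this]
  exact congrArg (fun φ => (ModuleCat.Hom.hom φ) x) ((tensorSN f g N).map_neg)

/-- The sign of the shifted differential changes neither cycles nor boundaries. -/
lemma length_homology_shiftVS_succ (n : ℕ) : Module.length Q
    ((D.shiftVSN N).homology (n + 1)) =
      Module.length Q ((D.VSN N).homology n) := by
  refine length_homology_congr' _ _
    (LinearMap.id : (tensorSN f g N).obj (ModuleCat.of Q (D.V n)) →ₗ[Q] _)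
    Function.surjective_id (fun x => ?_) (fun x => ?_)
  · match n with
    | 0 =>
      refine ⟨fun _ => (isCycle_succ _).2 ?_, fun _ => isCycle_zero _⟩
      have : Subsingleton ((D.shiftVSN N).X 0) :=
        subsingleton_tensorSN N (ModuleCat.of Q PUnit)
      exact Subsingleton.elim _ _
    | n + 1 =>
      refine (isCycle_succ (C := D.VSN N) x).trans (Iff.trans ?_
        (isCycle_succ (C := D.shiftVSN N) (n := n + 1) x).symm)
      exact neg_eq_zero.symm.trans (Eq.congr_left (D.shiftVS_d_succ_apply N n x).symm)
  · refine (isBoundary_iff (C := D.VSN N) x).trans (Iff.trans ?_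
      (isBoundary_iff (C := D.shiftVSN N) (n := n + 1) x).symm)
    constructor
    · rintro ⟨y, hy⟩
      refine ⟨-(show (tensorSN f g N).obj (ModuleCat.of Q (D.V (n + 1))) from y), ?_⟩
      refine (D.shiftVS_d_succ_apply N n _).trans ?_
      exact (congrArg Neg.neg (map_neg _ _)).trans ((neg_neg _).trans hy)
    · rintro ⟨y, hy⟩
      refine ⟨-(show (tensorSN f g N).obj (ModuleCat.of Q (D.V (n + 1))) from y), ?_⟩
      refine (map_neg _ _).trans ?_
      exact (D.shiftVS_d_succ_apply N n _).symm.trans hy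

/-- Snake computation: the cycle x lifts to (0, x) in the cone, whose differential (-τx, ∂x) = (-τx,
0) comes from ΣV. -/
lemma coneInl_τ_apply (hfg : IsExactPair f g) (n : ℕ) (x : (D.VSN N).X (n + 1))
    (hx : IsCycle (D.VSN N) (n + 1) x) :
    ((tensorSN f g N).map (D.coneInl n)).hom (((tensorSN f g N).map (-D.prevTauHom n)).hom x) =
      ((D.WN N hfg).d (n + 1) n).hom (((tensorSN f g N).map (D.coneInr (n + 1))).hom x) := by
  have h1 : ((tensorSN f g N).map (ModuleCat.ofHom (D.dV n))).hom x = 0 := by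
    rw [← VSN_d]; exact hx n
  have h2 := congrArg (tensorSN f g N).map (D.coneInr_coneD n)
  rw [Functor.map_comp, Functor.map_add, Functor.map_comp, Functor.map_comp] at h2
  have h3 := congrArg (fun φ => φ.hom x) h2
  rw [WN_d]
  refine Eq.trans ?_ h3.symm
  refine ((add_zero _).symm.trans (congrArg (_ + ·) ?_))
  exact ((congrArg ((tensorSN f g N).map (D.coneInr n)).hom h1).trans (map_zero _)).symm

/-- The connecting homomorphisms of the mapping cone sequence are, up to sign, the maps induced
by the Eisenbud operator. -/
lemma coneSeq_δ_eq_zero_iff (hfg : IsExactPair f g) (n : ℕ) :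
    (D.coneSeq_shortExact N hfg).δ (n + 1) n rfl = 0 ↔ D.delta hfg N (n + 1) = 0 := by
  refine (delta_eq_zero_iff (D.coneSeq_shortExact N hfg) n
    (fun x => ((tensorSN f g N).map (D.coneInr (n + 1))).hom x) (fun x => ?_)
    (fun x => ((tensorSN f g N).map (-D.prevTauHom n)).hom x)
    (fun x hx => D.coneInl_τ_apply N hfg n x hx)).trans
      (Iff.trans ?_ (homologyMap_eq_zero_iff _ _).symm)
  · have h := congrArg (tensorSN f g N).map (D.coneInr_snd (n + 1))
    rw [CategoryTheory.Functor.map_comp, CategoryTheory.Functor.map_id] at h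
    exact congrArg (fun φ => φ.hom x) h
  refine forall₂_congr fun x _ => ?_
  -- For n = 0 both targets vanish. For larger n the sign of τ cancels against that of the
  -- differential of ΣV, so the same y bounds both elements.
  match n with
  | 0 =>
    have h1 : Subsingleton ((D.shiftVSN N).X 0) :=
      subsingleton_tensorSN N (ModuleCat.of Q PUnit)
    have h2 : Subsingleton ((((tensorN N).mapHomologicalComplex _).obj (shiftTwo D.VS)).X 1) := by
      have : Subsingleton ((PUnit.{u + 1}) ⊗[Q] N) := inferInstance
      exact this
    exact ⟨fun _ => ⟨0, 0, h2.elim _ _⟩, fun _ => ⟨0, 0, h1.elim _ _⟩⟩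
  | n + 1 =>
    refine (isBoundary_iff (C := D.shiftVSN N) (n := n + 1) _).trans (Iff.trans ?_ (isBoundary_iff
      (C := ((tensorN N).mapHomologicalComplex _).obj (shiftTwo D.VS)) (n := n + 2) _).symm)
    refine exists_congr fun y => ?_
    have e1 : ((D.shiftVSN N).d (n + 2) (n + 1)).hom y = _ := D.shiftVS_d_succ_apply N n y
    have e2 : ((tensorSN f g N).map (-D.prevTauHom (n + 1))).hom x =
        -((tensorSN f g N).map (D.prevTauHom (n + 1))).hom x :=
      congrArg (fun φ => (ModuleCat.Hom.hom φ) x) ((tensorSN f g N).map_neg)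
    refine Iff.trans (Eq.congr e1 e2) ?_
    exact neg_inj

/-- The connecting maps of the cone sequence account for δ^N only in positive degrees; in degree 0
the target is zero. -/
lemma delta_zero (hfg : IsExactPair f g) : D.delta hfg N 0 = 0 := by
  rw [delta, homologyMap_eq_zero_iff]
  intro x _
  have h : Subsingleton ((((tensorN N).mapHomologicalComplex _).obj (shiftTwo D.VS)).X 0) := by
    have : Subsingleton ((PUnit.{u + 1}) ⊗[Q] N) := inferInstance
    exact this
  exact ⟨0, 0, h.elim _ _⟩

end SemifreeResolution

end

/-! ### Construction, degree by degree, of a complex with operators y and t -/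

noncomputable section

variable {Q : Type u} [CommRing Q]

/-- The datum of a complex `X` with an action of `Q[y, t]` with `y² = 0`, `∂y + y∂ = f` and
`∂t - t∂ = g y`, that is free on the images of maps `w : V_n → X_n`, and which resolves `M`. -/
structure TateSystem (f g : Q) (M : Type u) [AddCommGroup M] [Module Q M] where
  /-- the terms of the complex -/
  X : ℕ → ModuleCat.{u} Q
  /-- the spans of the basis elements -/
  V : ℕ → ModuleCat.{u} Q
  /-- the differential -/
  d : ∀ n, X (n + 1) →ₗ[Q] X n
  /-- the action of `y` -/
  y : ∀ n, X n →ₗ[Q] X (n + 1)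
  /-- the action of `t` -/
  t : ∀ n, X n →ₗ[Q] X (n + 2)
  /-- the inclusion of the span of the basis -/
  w : ∀ n, V n →ₗ[Q] X n
  /-- the augmentation -/
  ε : X 0 →ₗ[Q] M
  free : ∀ n, Module.Free Q (V n)
  freeX : ∀ n, Module.Free Q (X n)
  finiteX : ∀ n, Module.Finite Q (X n)
  d_d : ∀ n x, d n (d (n + 1) x) = 0
  y_y : ∀ n x, y (n + 1) (y n x) = 0
  y_t : ∀ n x, y (n + 2) (t n x) = t (n + 1) (y n x)
  d_y_zero : ∀ x, d 0 (y 0 x) = f • x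
  d_y : ∀ n x, d (n + 1) (y (n + 1) x) + y n (d n x) = f • x
  d_t_zero : ∀ x, d 1 (t 0 x) = g • y 0 x
  d_t : ∀ n x, d (n + 2) (t (n + 1) x) = t n (d n x) + g • y (n + 1) x
  w_zero : Function.Bijective (w 0)
  exists_one : ∀ x, ∃ a b, w 1 a + y 0 (w 0 b) = x
  eq_zero_one : ∀ a b, w 1 a + y 0 (w 0 b) = 0 → a = 0 ∧ b = 0
  exists_add_two : ∀ n x, ∃ a b c, w (n + 2) a + y (n + 1) (w (n + 1) b) + t n c = x
  eq_zero_add_two : ∀ n a b c, w (n + 2) a + y (n + 1) (w (n + 1) b) + t n c = 0 →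
    a = 0 ∧ b = 0 ∧ c = 0
  ε_surjective : Function.Surjective ε
  exact_zero : ∀ x, ε x = 0 ↔ ∃ z, d 0 z = x
  exact_succ : ∀ n x, d n x = 0 → ∃ z, d (n + 1) z = x

/-- Three consecutive terms `A`, `B` and `V × W × A` of a complex with an action of `Q[y, t]`,
where `V` and `W` are the spans of the basis elements of the degrees of the last two terms. -/
structure TateWindow (f g : Q) where
  /-- the first term -/
  A : ModuleCat.{u} Q
  /-- the second term -/
  B : ModuleCat.{u} Q
  /-- the span of the basis elements in the degree of `B` -/
  W : ModuleCat.{u} Q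
  /-- the span of the basis elements in the next degree -/
  V : ModuleCat.{u} Q
  /-- the differential of `B` -/
  dB : B →ₗ[Q] A
  /-- the differential of the last term -/
  d : V × W × A →ₗ[Q] B
  /-- the action of `y` on `A` -/
  yA : A →ₗ[Q] B
  /-- the action of `y` on `B` -/
  y : B →ₗ[Q] V × W × A
  /-- the inclusion of the span of the basis -/
  w : W →ₗ[Q] B
  freeA : Module.Free Q A
  freeB : Module.Free Q B
  freeW : Module.Free Q W
  freeV : Module.Free Q V
  finiteA : Module.Finite Q A
  finiteB : Module.Finite Q B
  finiteW : Module.Finite Q W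
  finiteV : Module.Finite Q V
  d_d : ∀ c, dB (d c) = 0
  y_w : ∀ x, y (w x) = (0, x, 0)
  y_fst : ∀ b, (y b).1 = 0
  yA_y : ∀ b, yA (y b).2.2 = 0
  y_yA : ∀ a, y (yA a) = 0
  d_y : ∀ b, d (y b) + yA (dB b) = f • b
  -- With (0, 0, a) read as ta, this is ∂(ta) = t∂a + g ya on boundaries a, where the first term
  -- vanishes.
  d_t : ∀ b, d (0, 0, dB b) = g • yA (dB b)
  -- This is ∂y + y∂ = f applied to ta, where ∂(y ta) = ∂(t ya) = t∂(ya) because y² = 0.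
  y_d_t : ∀ a, y (d (0, 0, a)) + (0, 0, dB (yA a)) = f • (0, 0, a)

/-- Noetherianity allows finitely many new basis elements in each degree, which later makes the
modules Tor^Q finitely generated. -/
lemma exists_fin_cover [IsNoetherianRing Q] {X : Type u} [AddCommGroup X] [Module Q X]
    [Module.Finite Q X] (K : Submodule Q X) :
    ∃ (k : ℕ) (φ : (Fin k → Q) →ₗ[Q] X), LinearMap.range φ = K := by
  obtain ⟨k, φ, hφ⟩ := Module.Finite.exists_fin' Q K
  exact ⟨k, K.subtype ∘ₗ φ, by
    rw [LinearMap.range_comp, LinearMap.range_eq_top.2 hφ, Submodule.map_top,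
      Submodule.range_subtype]⟩

namespace TateWindow

variable {f g : Q}

/-- The last term of the window. -/
abbrev C (s : TateWindow f g) : ModuleCat.{u} Q := ModuleCat.of Q (s.V × s.W × s.A)

section

variable (s : TateWindow f g) (P : ModuleCat.{u} Q) (φ : P →ₗ[Q] s.C)

/-- The differential of the next term of the complex. -/
def nextD : P × s.V × s.B →ₗ[Q] s.C :=
  -- The summands are the differentials of p, of yv and of tb, forced by ∂(yv) = fv - y∂v and ∂(tb)
  -- = g yb + t∂b.
  φ ∘ₗ LinearMap.fst Q P (s.V × s.B) +
    ((f • LinearMap.inl Q s.V (s.W × s.A) -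
      s.y ∘ₗ s.d ∘ₗ LinearMap.inl Q s.V (s.W × s.A)) ∘ₗ LinearMap.fst Q s.V s.B +
    (g • s.y + LinearMap.inr Q s.V (s.W × s.A) ∘ₗ LinearMap.inr Q s.W s.A ∘ₗ s.dB) ∘ₗ
      LinearMap.snd Q s.V s.B) ∘ₗ LinearMap.snd Q P (s.V × s.B)

lemma nextD_apply (p : P) (v : s.V) (b : s.B) : s.nextD P φ (p, v, b) =
    φ p + ((f • ((v, 0, 0) : s.V × s.W × s.A) - s.y (s.d (v, 0, 0))) +
      (g • s.y b + (0, 0, s.dB b))) := rfl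

lemma nextD_zero_zero (b : s.B) : s.nextD P φ (0, 0, b) = g • s.y b + (0, 0, s.dB b) := by
  have h : ((0, 0, 0) : s.V × s.W × s.A) = 0 := rfl
  rw [nextD_apply, h, map_zero, smul_zero, map_zero, map_zero, sub_zero, zero_add, zero_add]

lemma nextD_left (p : P) : s.nextD P φ (p, 0, 0) = φ p := by
  have h : ((0, 0, 0) : s.V × s.W × s.A) = 0 := rfl
  rw [nextD_apply, h, map_zero, smul_zero, map_zero, map_zero, smul_zero, sub_zero, zero_add,
    zero_add]
  exact add_zero _

/-- The action of `y` on the last term of the window. -/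
def nextY : s.C →ₗ[Q] P × s.V × s.B :=
  LinearMap.inr Q P (s.V × s.B) ∘ₗ LinearMap.prodMap LinearMap.id
    (s.yA ∘ₗ LinearMap.snd Q s.W s.A)

lemma nextY_apply (v : s.V) (w : s.W) (a : s.A) :
    s.nextY P ((v, w, a) : s.V × s.W × s.A) = (0, v, s.yA a) := rfl

/-- The window shifted by one step, for a choice of new basis elements. -/
def extend (hgf : g * f = 0) (hP : Module.Free Q P) (hP' : Module.Finite Q P)
    (hφ : ∀ p, s.d (φ p) = 0) : TateWindow f g where
  A := s.B
  B := s.C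
  W := s.V
  V := P
  dB := s.d
  d := s.nextD P φ
  yA := s.y
  y := s.nextY P
  w := LinearMap.inl Q s.V (s.W × s.A)
  freeA := s.freeB
  freeB := by
    have := s.freeV; have := s.freeW; have := s.freeA
    infer_instance
  freeW := s.freeV
  freeV := hP
  finiteA := s.finiteB
  finiteB := by
    have := s.finiteV; have := s.finiteW; have := s.finiteA
    infer_instance
  finiteW := s.finiteV
  finiteV := hP'
  d_d := by
    rintro ⟨p, v, b⟩
    rw [nextD_apply, map_add, map_add, map_sub, map_add, map_smul, map_smul, hφ, s.d_t, zero_add]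
    have h1 := s.d_y (s.d (v, 0, 0))
    rw [s.d_d, map_zero, add_zero] at h1
    -- The part from yv cancels by `h1`; the part from tb is g(∂y + y∂)b = gf b = 0.
    rw [h1, sub_self, zero_add, ← smul_add, s.d_y, smul_smul, hgf, zero_smul]
  y_w := fun v => by
    change ((0 : P), v, s.yA 0) = _
    rw [map_zero]
  y_fst := fun _ => rfl
  yA_y := fun c => s.y_yA _
  y_yA := fun b => by
    change ((0 : P), (s.y b).1, s.yA (s.y b).2.2) = 0
    rw [s.y_fst, s.yA_y]; rfl
  d_y := by
    rintro ⟨v, w, a⟩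
    rw [nextY_apply, nextD_apply, map_zero, zero_add, s.y_yA, smul_zero, zero_add]
    -- The element (0, w, 0) is yw, and y∂y = fy because y² = 0.
    have h1 : s.y (s.d (0, w, 0)) = f • ((0, w, 0) : s.V × s.W × s.A) := by
      rw [← s.y_w, ← map_smul, ← s.d_y (s.w w), map_add, s.y_yA, add_zero]
    have h2 : ((v, w, a) : s.V × s.W × s.A) = (v, 0, 0) + ((0, w, 0) + (0, 0, a)) := by simp
    rw [h2, map_add, map_add, map_add, map_add, h1, smul_add, smul_add, ← s.y_d_t]
    abel
  d_t := fun c => by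
    change s.nextD P φ (0, 0, s.d c) = g • s.y (s.d c)
    rw [nextD_zero_zero, s.d_d]
    exact add_zero _
  y_d_t := fun b => by
    have h1 : s.nextY P (s.y b) = 0 := by
      change ((0 : P), (s.y b).1, s.yA (s.y b).2.2) = 0
      rw [s.y_fst, s.yA_y]; rfl
    have h2 : f • ((0, 0, b) : P × s.V × s.B) = (0, 0, f • b) := by simp
    rw [nextD_zero_zero, map_add, map_smul, h1, smul_zero, zero_add, nextY_apply, h2, ← s.d_y]
    simp [add_comm]

end

section

variable [IsNoetherianRing Q] (hgf : g * f = 0) (s : TateWindow f g)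

include hgf in
lemma exists_next : ∃ s' : TateWindow f g, ∃ (P : ModuleCat.{u} Q) (φ : P →ₗ[Q] s.C)
    (hP : Module.Free Q P) (hP' : Module.Finite Q P) (hφ : ∀ p, s.d (φ p) = 0),
    s' = s.extend P φ hgf hP hP' hφ ∧ ∀ c, s.d c = 0 → ∃ p, φ p = c := by
  have := s.finiteV; have := s.finiteW; have := s.finiteA
  obtain ⟨k, φ, hφ⟩ := exists_fin_cover (X := s.V × s.W × s.A) (LinearMap.ker s.d)
  refine ⟨_, ModuleCat.of Q (Fin k → Q), φ, inferInstance, inferInstance, fun p => ?_, rfl,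
    fun c hc => ?_⟩
  · have : φ p ∈ LinearMap.ker s.d := hφ ▸ LinearMap.mem_range_self φ p
    exact this
  · have : c ∈ LinearMap.range φ := hφ ▸ hc
    exact this

/-- The new basis elements of the next step, which cover the cycles of the last term. -/
def newV : ModuleCat.{u} Q := (s.exists_next hgf).choose_spec.choose

/-- The differential of the new basis elements. -/
def newφ : s.newV hgf →ₗ[Q] s.C := (s.exists_next hgf).choose_spec.choose_spec.choose

lemma newV_free : Module.Free Q (s.newV hgf) :=
  (s.exists_next hgf).choose_spec.choose_spec.choose_spec.choose

lemma newV_finite : Module.Finite Q (s.newV hgf) :=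
  (s.exists_next hgf).choose_spec.choose_spec.choose_spec.choose_spec.choose

lemma d_newφ (p : s.newV hgf) : s.d (s.newφ hgf p) = 0 :=
  (s.exists_next hgf).choose_spec.choose_spec.choose_spec.choose_spec.choose_spec.choose p

lemma exists_newφ (c : s.C) (hc : s.d c = 0) : ∃ p, s.newφ hgf p = c :=
  (s.exists_next hgf).choose_spec.choose_spec.choose_spec.choose_spec.choose_spec.choose_spec.2 c hc

/-- The next window. -/
def next : TateWindow f g :=
  s.extend (s.newV hgf) (s.newφ hgf) hgf (s.newV_free hgf) (s.newV_finite hgf) (s.d_newφ hgf)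

/-- The sequence of windows. -/
def seq : ℕ → TateWindow f g
  | 0 => s
  | n + 1 => (seq n).next hgf

end

section

variable {V₀ V₁ : ModuleCat.{u} Q} (φ : V₁ →ₗ[Q] V₀) (h₀ : Module.Free Q V₀)
  (h₁ : Module.Free Q V₁) (h₀' : Module.Finite Q V₀) (h₁' : Module.Finite Q V₁)

/-- The first window `0, V_0, V_1 ⊕ y V_0`. -/
def init (f g : Q) : TateWindow f g where
  A := ModuleCat.of Q PUnit.{u + 1}
  B := V₀
  W := V₀
  V := V₁
  dB := 0
  d := φ ∘ₗ LinearMap.fst Q V₁ (V₀ × PUnit.{u + 1}) +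
    f • LinearMap.fst Q V₀ PUnit.{u + 1} ∘ₗ LinearMap.snd Q V₁ (V₀ × PUnit.{u + 1})
  yA := 0
  y := LinearMap.inr Q V₁ (V₀ × PUnit.{u + 1}) ∘ₗ LinearMap.inl Q V₀ PUnit.{u + 1}
  w := LinearMap.id
  freeA := (inferInstance : Module.Free Q PUnit.{u + 1})
  freeB := h₀
  freeW := h₀
  freeV := h₁
  finiteA := (inferInstance : Module.Finite Q PUnit.{u + 1})
  finiteB := h₀'
  finiteW := h₀'
  finiteV := h₁'
  d_d := fun _ => rfl
  y_w := fun _ => rfl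
  y_fst := fun _ => rfl
  yA_y := fun _ => rfl
  y_yA := fun _ => map_zero _
  d_y := fun b => by
    change (φ 0 + f • b) + 0 = f • b
    rw [map_zero, zero_add, add_zero]
  d_t := fun b => by
    change φ 0 + f • (0 : V₀) = g • (0 : V₀)
    rw [map_zero, smul_zero, smul_zero, add_zero]
  y_d_t := fun a => by
    change ((0 : V₁), φ 0 + f • (0 : V₀), (0 : PUnit.{u + 1})) + 0 = f • ((0 : V₁), (0 : V₀), a)
    rw [map_zero, smul_zero, add_zero, add_zero]
    simp

end

end TateWindow


section

variable {f g : Q} (hgf : g * f = 0) {M : Type u} [AddCommGroup M] [Module Q M]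

namespace TateWindow

lemma extend_sum (s : TateWindow f g) (P : ModuleCat.{u} Q) (a : P) (b : s.V) (c : s.B) :
    ((a, 0, 0) : P × s.V × s.B) + s.nextY P ((b, 0, 0) : s.V × s.W × s.A) + (0, 0, c) =
      (a, b, c) := by
  rw [nextY_apply, map_zero]
  simp

variable {V₀ V₁ : ModuleCat.{u} Q} (φ : V₁ →ₗ[Q] V₀) (h₀ : Module.Free Q V₀)
    (h₁ : Module.Free Q V₁) (h₀' : Module.Finite Q V₀) (h₁' : Module.Finite Q V₁)

lemma init_sum (a : V₁) (b : V₀) (c : PUnit.{u + 1}) :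
    ((a, 0, 0) : V₁ × V₀ × PUnit.{u + 1}) + (0, b, 0) = (a, b, c) := by
  simp

/-- The image of the first differential is φ(V_1) + fV_0, and fV_0 adds nothing to ker ε since f
kills M. -/
lemma init_exact (ε : V₀ →ₗ[Q] M) (hφ : LinearMap.range φ = LinearMap.ker ε)
    (hfM : ∀ x : M, f • x = 0) (x : V₀) :
    ε x = 0 ↔ ∃ z : V₁ × V₀ × PUnit.{u + 1}, (init φ h₀ h₁ h₀' h₁' f g).d z = x := by
  rw [← LinearMap.mem_ker]
  constructor
  · intro h
    rw [← hφ] at h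
    obtain ⟨v, rfl⟩ := h
    exact ⟨(v, 0, 0), (congrArg _ (smul_zero _)).trans (add_zero _)⟩
  · rintro ⟨⟨v, w, a⟩, rfl⟩
    change φ v + f • w ∈ _
    refine add_mem (hφ ▸ ⟨v, rfl⟩) ?_
    rw [LinearMap.mem_ker, map_smul, hfM]

variable [IsNoetherianRing Q]

/-- The system obtained from a first window which presents `M`. -/
def system (ε : V₀ →ₗ[Q] M) (hε : Function.Surjective ε)
    (hφ : LinearMap.range φ = LinearMap.ker ε) (hfM : ∀ x : M, f • x = 0) : TateSystem f g M :=
  let s : ℕ → TateWindow f g := (init φ h₀ h₁ h₀' h₁' f g).seq hgf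
  { X := fun n => (s n).B
    V := fun n => (s n).W
    d := fun n => (s n).d
    y := fun n => (s n).y
    -- The term of degree n + 2 unfolds to V_{n+2} × V_{n+1} × X_n, and t is the inclusion of the
    -- last factor.
    t := fun n => LinearMap.inr Q (s (n + 1)).V ((s n).V × (s n).B) ∘ₗ
      LinearMap.inr Q (s n).V (s n).B
    w := fun n => (s n).w
    ε := ε
    free := fun n => (s n).freeW
    freeX := fun n => (s n).freeB
    finiteX := fun n => (s n).finiteB
    d_d := fun n x => (s (n + 1)).d_d x
    y_y := fun n x => (s (n + 1)).y_yA x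
    y_t := fun n x => rfl
    d_y_zero := fun x => (add_zero _).symm.trans ((s 0).d_y x)
    d_y := fun n x => (s (n + 1)).d_y x
    d_t_zero := fun x => ((s 0).nextD_zero_zero _ _ x).trans (add_zero _)
    d_t := fun n x => ((s (n + 1)).nextD_zero_zero _ _ x).trans (add_comm _ _)
    w_zero := Function.bijective_id
    exists_one := fun x => by
      obtain ⟨a, b, c⟩ := (show V₁ × V₀ × PUnit.{u + 1} from x)
      exact ⟨a, b, init_sum a b c⟩
    eq_zero_one := fun a b h => by
      have h' := (init_sum (V₁ := V₁) (V₀ := V₀) a b 0).symm.trans h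
      exact ⟨congrArg Prod.fst h', congrArg (fun z => z.2.1) h'⟩
    exists_add_two := fun n x => by
      obtain ⟨a, b, c⟩ := (show (s (n + 1)).V × (s n).V × (s n).B from x)
      exact ⟨a, b, c, extend_sum (s n) (s (n + 1)).V a b c⟩
    eq_zero_add_two := fun n a b c h => by
      have h' := (extend_sum (s n) (s (n + 1)).V a b c).symm.trans h
      exact ⟨congrArg Prod.fst h', congrArg (fun z => z.2.1) h', congrArg (fun z => z.2.2) h'⟩
    ε_surjective := hε
    exact_zero := fun x => init_exact φ h₀ h₁ h₀' h₁' ε hφ hfM x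
    exact_succ := fun n x hx => by
      obtain ⟨p, hp⟩ := (s n).exists_newφ hgf x hx
      exact ⟨(p, 0, 0), ((s n).nextD_left _ _ p).trans hp⟩ }

end TateWindow

include hgf in
lemma nonempty_tateSystem [IsNoetherianRing Q] [Module.Finite Q M] (hfM : ∀ x : M, f • x = 0) :
    Nonempty (TateSystem f g M) := by
  obtain ⟨k, ε, hε⟩ := Module.Finite.exists_fin' Q M
  obtain ⟨l, φ, hφ⟩ := exists_fin_cover (X := Fin k → Q) (LinearMap.ker ε)
  exact ⟨TateWindow.system hgf (V₀ := ModuleCat.of Q (Fin k → Q))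
    (V₁ := ModuleCat.of Q (Fin l → Q)) φ
    (inferInstance : Module.Free Q (Fin k → Q)) (inferInstance : Module.Free Q (Fin l → Q))
    (inferInstance : Module.Finite Q (Fin k → Q)) (inferInstance : Module.Finite Q (Fin l → Q))
    ε hε hφ hfM⟩

end
end

/-! ### Divided powers of t, and the semi-free resolution -/

noncomputable section

section

variable {Q : Type u} [CommRing Q] {E : Type u} [Ring E] [Algebra Q E]

/-- The element `y_i = t^{(i/2)} y^{i % 2}` of an algebra in which the factorials are invertible. -/
def dividedPow (y t : E) (i : ℕ) : E :=
  Ring.inverse ((i / 2).factorial : Q) • (t ^ (i / 2) * y ^ (i % 2))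

lemma dividedPow_even (y t : E) (k : ℕ) :
    dividedPow (Q := Q) y t (2 * k) = Ring.inverse (k.factorial : Q) • t ^ k := by
  have h1 : 2 * k / 2 = k := by omega
  have h2 : 2 * k % 2 = 0 := by omega
  rw [dividedPow, h1, h2, pow_zero, mul_one]

lemma dividedPow_odd (y t : E) (k : ℕ) :
    dividedPow (Q := Q) y t (2 * k + 1) = Ring.inverse (k.factorial : Q) • (t ^ k * y) := by
  have h1 : (2 * k + 1) / 2 = k := by omega
  have h2 : (2 * k + 1) % 2 = 1 := by omega
  rw [dividedPow, h1, h2, pow_one]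

lemma even_or_odd_form (i : ℕ) : ∃ k, i = 2 * k ∨ i = 2 * k + 1 := ⟨i / 2, by omega⟩

lemma tateMul_eq_choose {i j a b : ℕ} (h : ¬(i % 2 = 1 ∧ j % 2 = 1)) (ha : i / 2 = a)
    (hb : j / 2 = b) : tateMul i j = (a + b).choose a := by
  rw [tateMul, if_neg h, ha, hb]

/-- The commutator of D and t is gy, which commutes with t, so D acts on powers of t as a
derivation. -/
lemma commutator_pow {y t D : E} {g : Q} (hyt : y * t = t * y) (hDt : D * t = t * D + g • y)
    (k : ℕ) : D * t ^ (k + 1) = t ^ (k + 1) * D + ((k + 1 : ℕ) : Q) • g • (t ^ k * y) := by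
  induction k with
  | zero => simp [hDt]
  | succ k ih =>
    have h : t ^ k * y * t = t ^ (k + 1) * y := by rw [mul_assoc, hyt, ← mul_assoc, pow_succ]
    rw [pow_succ t (k + 1), ← mul_assoc, ih, add_mul, mul_assoc, hDt, mul_add, smul_mul_assoc,
      smul_mul_assoc, h, mul_smul_comm, add_assoc, ← mul_assoc, Nat.cast_succ (k + 1), add_smul,
      one_smul, add_comm (g • _)]

variable [IsLocalRing Q] [CharZero (IsLocalRing.ResidueField Q)]

lemma isUnit_natCast_of_charZero_residueField {k : ℕ} (hk : k ≠ 0) : IsUnit (k : Q) := by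
  rw [← IsLocalRing.residue_ne_zero_iff_isUnit, map_natCast]
  exact Nat.cast_ne_zero.2 hk

lemma inverse_factorial_mul (a b : ℕ) :
    Ring.inverse (a.factorial : Q) * Ring.inverse (b.factorial : Q) =
      ((a + b).choose a : Q) * Ring.inverse ((a + b).factorial : Q) := by
  have ha := isUnit_natCast_of_charZero_residueField (Q := Q) a.factorial_ne_zero
  have hb := isUnit_natCast_of_charZero_residueField (Q := Q) b.factorial_ne_zero
  have hab := isUnit_natCast_of_charZero_residueField (Q := Q) (a + b).factorial_ne_zero
  have h : ((a + b).choose a : Q) * (a.factorial * b.factorial) = (a + b).factorial := by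
    rw [← mul_assoc, Nat.choose_symm_add, ← Nat.add_choose_mul_factorial_mul_factorial a b,
      Nat.cast_mul, Nat.cast_mul]
  refine (ha.mul hb).mul_left_cancel (hab.mul_left_cancel ?_)
  calc ((a + b).factorial : Q) * (a.factorial * b.factorial *
        (Ring.inverse (a.factorial : Q) * Ring.inverse (b.factorial : Q)))
      = (a + b).factorial * ((a.factorial * Ring.inverse (a.factorial : Q)) *
        (b.factorial * Ring.inverse (b.factorial : Q))) := by ring
    _ = (((a + b).choose a : Q) * (a.factorial * b.factorial)) *
        ((a + b).factorial * Ring.inverse ((a + b).factorial : Q)) := by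
      rw [Ring.mul_inverse_cancel _ ha, Ring.mul_inverse_cancel _ hb,
        Ring.mul_inverse_cancel _ hab, h]
      ring
    _ = _ := by ring

lemma dividedPow_mul {y t : E} (hy : y * y = 0) (hyt : y * t = t * y) (i j : ℕ) :
    dividedPow (Q := Q) y t i * dividedPow (Q := Q) y t j =
      tateMul i j • dividedPow (Q := Q) y t (i + j) := by
  obtain ⟨a, rfl | rfl⟩ := even_or_odd_form i <;> obtain ⟨b, rfl | rfl⟩ := even_or_odd_form j
  · rw [show 2 * a + 2 * b = 2 * (a + b) by ring, dividedPow_even, dividedPow_even,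
      dividedPow_even, smul_mul_smul_comm, ← pow_add, inverse_factorial_mul,
      tateMul_eq_choose (a := a) (b := b) (by omega) (by omega) (by omega), mul_smul, Nat.cast_smul_eq_nsmul]
  · rw [show 2 * a + (2 * b + 1) = 2 * (a + b) + 1 by ring, dividedPow_even, dividedPow_odd,
      dividedPow_odd, smul_mul_smul_comm, ← mul_assoc, ← pow_add, inverse_factorial_mul,
      tateMul_eq_choose (a := a) (b := b) (by omega) (by omega) (by omega), mul_smul, Nat.cast_smul_eq_nsmul]
  · have h : t ^ a * y * t ^ b = t ^ (a + b) * y := by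
      rw [mul_assoc, ((show Commute y t from hyt).pow_right b).eq, ← mul_assoc, pow_add]
    rw [show 2 * a + 1 + 2 * b = 2 * (a + b) + 1 by ring, dividedPow_even, dividedPow_odd,
      dividedPow_odd, smul_mul_smul_comm, h, inverse_factorial_mul,
      tateMul_eq_choose (a := a) (b := b) (by omega) (by omega) (by omega), mul_smul, Nat.cast_smul_eq_nsmul]
  · have h : t ^ a * y * (t ^ b * y) = 0 := by
      rw [mul_assoc, ← mul_assoc y, ((show Commute y t from hyt).pow_right b).eq, mul_assoc, hy,
        mul_zero, mul_zero]
    rw [dividedPow_odd, dividedPow_odd, smul_mul_smul_comm, h, smul_zero, tateMul,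
      if_pos (by omega), zero_smul]

/-- For y_{2k+1} the correction from moving D past t^k ends in y² = 0, leaving only Dy = f - yD. For
y_{2k+2} the factor k + 1 from `commutator_pow` turns 1/(k+1)! into 1/k!. -/
lemma dividedPow_leibniz {y t D : E} {f g : Q} (hy : y * y = 0) (hyt : y * t = t * y)
    (hDy : D * y + y * D = algebraMap Q E f) (hDt : D * t = t * D + g • y) (i : ℕ) :
    D * dividedPow (Q := Q) y t (i + 1) = tateD f g i • dividedPow (Q := Q) y t i +
      (-1 : Q) ^ (i + 1) • (dividedPow (Q := Q) y t (i + 1) * D) := by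
  obtain ⟨k, rfl | rfl⟩ := even_or_odd_form i
  · have h : D * (t ^ k * y) = f • t ^ k - t ^ k * y * D := by
      have h1 : D * t ^ k * y = t ^ k * D * y := by
        rcases k with _ | k
        · simp
        · rw [commutator_pow hyt hDt, add_mul, smul_mul_assoc, smul_mul_assoc, mul_assoc _ y y, hy,
            mul_zero, smul_zero, smul_zero, add_zero]
      rw [← mul_assoc, h1, mul_assoc, eq_sub_of_add_eq hDy, mul_sub, ← mul_assoc,
        ← Algebra.commutes, Algebra.smul_def]
    rw [dividedPow_even, dividedPow_odd, mul_smul_comm, h, tateD, if_pos (by omega),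
      Odd.neg_one_pow ⟨k, rfl⟩, smul_sub, smul_mul_assoc, neg_one_smul, smul_comm f,
      sub_eq_add_neg]
  · have h := inverse_factorial_mul (Q := Q) k 1
    have h1 : ((k + 1 : ℕ) : Q) * Ring.inverse ((k + 1).factorial : Q) =
        Ring.inverse (k.factorial : Q) := by
      rw [Nat.factorial_one, Nat.cast_one, Ring.inverse_one, mul_one, Nat.choose_symm_add,
        Nat.choose_one_right] at h
      exact h.symm
    rw [show 2 * k + 1 + 1 = 2 * (k + 1) by ring, dividedPow_even, dividedPow_odd, mul_smul_comm,
      commutator_pow hyt hDt, tateD, if_neg (by omega), Even.neg_one_pow ⟨k + 1, by ring⟩,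
      one_smul, smul_add, smul_mul_assoc, smul_smul, mul_comm (Ring.inverse _), h1, add_comm,
      smul_comm g]

end

namespace TateSystem

variable {Q : Type u} [CommRing Q] {f g : Q} {M : Type u} [AddCommGroup M] [Module Q M]
  (T : TateSystem f g M)

/-- The product of the terms of the complex. -/
abbrev Tot : Type u := ∀ n, T.X n

/-- The action of `y` on the product of the terms. -/
def yT : Module.End Q T.Tot :=
  -- On the product of all terms the relations between y, t and the differential are identities in
  -- one endomorphism algebra, with no transport between degrees.
  LinearMap.pi fun n => match n with
    | 0 => 0
    | n + 1 => T.y n ∘ₗ LinearMap.proj n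

/-- The action of `t` on the product of the terms. -/
def tT : Module.End Q T.Tot :=
  LinearMap.pi fun n => match n with
    | 0 => 0
    | 1 => 0
    | n + 2 => T.t n ∘ₗ LinearMap.proj n

/-- The differential on the product of the terms. -/
def dT : Module.End Q T.Tot := LinearMap.pi fun n => T.d n ∘ₗ LinearMap.proj (n + 1)

lemma yT_mul_yT : T.yT * T.yT = 0 := by
  refine LinearMap.ext fun F => funext fun n => ?_
  match n with
  | 0 => rfl
  | 1 => exact map_zero (T.y 0)
  | n + 2 => exact T.y_y n (F n)

lemma yT_mul_tT : T.yT * T.tT = T.tT * T.yT := by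
  refine LinearMap.ext fun F => funext fun n => ?_
  match n with
  | 0 => rfl
  | 1 => exact map_zero (T.y 0)
  | 2 => exact (map_zero (T.y 1)).trans (map_zero (T.t 0)).symm
  | n + 3 => exact T.y_t n (F n)

lemma dT_yT : T.dT * T.yT + T.yT * T.dT = algebraMap Q (Module.End Q T.Tot) f := by
  refine LinearMap.ext fun F => funext fun n => ?_
  match n with
  | 0 => exact (add_zero _).trans (T.d_y_zero (F 0))
  | n + 1 => exact T.d_y n (F (n + 1))

lemma dT_tT : T.dT * T.tT = T.tT * T.dT + g • T.yT := by
  refine LinearMap.ext fun F => funext fun n => ?_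
  match n with
  | 0 => exact (map_zero (T.d 0)).trans ((zero_add _).trans (smul_zero g)).symm
  | 1 => exact (T.d_t_zero (F 0)).trans (zero_add _).symm
  | n + 2 => exact T.d_t n (F (n + 1))

/-- The action of `y_i` on the product of the terms. -/
def Y (i : ℕ) : Module.End Q T.Tot := dividedPow (Q := Q) T.yT T.tT i

lemma Y_zero : T.Y 0 = 1 := by simp [Y, dividedPow]

/-- The inclusion of a term into the product of the terms. -/
def single (n : ℕ) : T.X n →ₗ[Q] T.Tot := LinearMap.single Q (fun n => T.X n) n

lemma single_same (n : ℕ) (x : T.X n) : T.single n x n = x :=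
  Pi.single_eq_same (M := fun n => T.X n) n x

lemma single_of_ne {n m : ℕ} (h : m ≠ n) (x : T.X n) : T.single n x m = 0 :=
  Pi.single_eq_of_ne (M := fun n => T.X n) h x

lemma yT_single (n : ℕ) (x : T.X n) : T.yT (T.single n x) = T.single (n + 1) (T.y n x) := by
  funext m
  rcases m with _ | m
  · exact (T.single_of_ne (Nat.succ_ne_zero n).symm _).symm
  · change T.y m (T.single n x m) = _
    rcases eq_or_ne m n with rfl | h
    · rw [single_same, single_same]
    · rw [T.single_of_ne h, map_zero, T.single_of_ne (by omega)]

lemma tT_single (n : ℕ) (x : T.X n) : T.tT (T.single n x) = T.single (n + 2) (T.t n x) := by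
  funext m
  match m with
  | 0 => exact (T.single_of_ne (Nat.succ_ne_zero _).symm _).symm
  | 1 => exact (T.single_of_ne (by omega) _).symm
  | m + 2 =>
    change T.t m (T.single n x m) = _
    rcases eq_or_ne m n with rfl | h
    · rw [single_same, single_same]
    · rw [T.single_of_ne h, map_zero, T.single_of_ne (by omega)]

lemma dT_single_zero (x : T.X 0) : T.dT (T.single 0 x) = 0 :=
  funext fun m => (congrArg (T.d m) (T.single_of_ne (Nat.succ_ne_zero m) x)).trans
    (map_zero (T.d m))

lemma dT_single_succ (n : ℕ) (x : T.X (n + 1)) :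
    T.dT (T.single (n + 1) x) = T.single n (T.d n x) := by
  funext m
  change T.d m (T.single (n + 1) x (m + 1)) = _
  rcases eq_or_ne m n with rfl | h
  · rw [single_same, single_same]
  · rw [T.single_of_ne (by omega), map_zero, T.single_of_ne h]

lemma tT_pow_single (k : ℕ) {n m : ℕ} (h : 2 * k + n = m) (x : T.X n) :
    ∃ z : T.X m, (T.tT ^ k) (T.single n x) = T.single m z := by
  induction k generalizing m with
  | zero =>
    obtain rfl : n = m := by omega
    exact ⟨x, rfl⟩
  | succ k ih =>
    obtain ⟨z, hz⟩ := ih rfl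
    obtain rfl : m = 2 * k + n + 2 := by omega
    rw [pow_succ']
    exact ⟨T.t _ z, (congrArg T.tT hz).trans (T.tT_single _ _)⟩

/-- The component of the action of `y_i` from degree `n` to degree `m`. -/
def act (i n m : ℕ) : T.X n →ₗ[Q] T.X m :=
  LinearMap.proj (φ := fun n => T.X n) m ∘ₗ T.Y i ∘ₗ T.single n

lemma act_apply (i n m : ℕ) (x : T.X n) : T.act i n m x = T.Y i (T.single n x) m := rfl

/-- `y_i` is homogeneous of degree `i`. -/
lemma Y_single {i n m : ℕ} (h : i + n = m) (x : T.X n) :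
    T.Y i (T.single n x) = T.single m (T.act i n m x) := by
  have key : ∃ z : T.X m, T.Y i (T.single n x) = T.single m z := by
    obtain ⟨k, rfl | rfl⟩ := even_or_odd_form i
    · obtain ⟨z, hz⟩ := T.tT_pow_single k h x
      refine ⟨Ring.inverse (k.factorial : Q) • z, ?_⟩
      rw [Y, dividedPow_even, LinearMap.smul_apply, hz, map_smul]
    · obtain ⟨z, hz⟩ := T.tT_pow_single k (n := n + 1) (m := m) (by omega) (T.y n x)
      refine ⟨Ring.inverse (k.factorial : Q) • z, ?_⟩
      rw [Y, dividedPow_odd, LinearMap.smul_apply, Module.End.mul_apply, yT_single, hz, map_smul]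
  obtain ⟨z, hz⟩ := key
  rw [act_apply, hz, single_same]

lemma act_zero (n : ℕ) (x : T.X n) : T.act 0 n n x = x := by
  rw [act_apply, Y_zero]
  exact T.single_same n x

section

variable [IsLocalRing Q] [CharZero (IsLocalRing.ResidueField Q)]

lemma act_act {i j n m p : ℕ} (hj : j + n = m) (x : T.X n) :
    T.act i m p (T.act j n m x) = tateMul i j • T.act (i + j) n p x := by
  rw [T.act_apply i, ← T.Y_single hj x]
  exact congrFun (LinearMap.congr_fun (dividedPow_mul (Q := Q) T.yT_mul_yT T.yT_mul_tT i j)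
    (T.single n x)) p

lemma dT_Y (i : ℕ) (F : T.Tot) : T.dT (T.Y (i + 1) F) =
    tateD f g i • T.Y i F + (-1 : Q) ^ (i + 1) • T.Y (i + 1) (T.dT F) :=
  LinearMap.congr_fun
    (dividedPow_leibniz (Q := Q) T.yT_mul_yT T.yT_mul_tT T.dT_yT T.dT_tT i) F

lemma d_act_zero (i : ℕ) (x : T.X 0) :
    T.d i (T.act (i + 1) 0 (i + 1) x) = tateD f g i • T.act i 0 i x := by
  have h := T.dT_Y i (T.single 0 x)
  rw [dT_single_zero, map_zero, smul_zero, add_zero] at h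
  exact congrFun h i

lemma d_act_succ (i n m : ℕ) (x : T.X (n + 1)) :
    T.d m (T.act (i + 1) (n + 1) (m + 1) x) = tateD f g i • T.act i (n + 1) m x +
      (-1 : Q) ^ (i + 1) • T.act (i + 1) n m (T.d n x) := by
  have h := T.dT_Y i (T.single (n + 1) x)
  rw [dT_single_succ] at h
  exact congrFun h m

end

/-- The underlying complex. -/
def complex : ChainComplex (ModuleCat.{u} Q) ℕ :=
  ChainComplex.of T.X (fun n => ModuleCat.ofHom (T.d n))
    fun n => ModuleCat.hom_ext (LinearMap.ext fun x => T.d_d n x)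

lemma complex_d (n : ℕ) (x : T.X (n + 1)) : (T.complex.d (n + 1) n).hom x = T.d n x :=
  congrArg (fun φ : T.X (n + 1) ⟶ T.X n => φ.hom x) (ChainComplex.of_d T.X (fun n => ModuleCat.ofHom (T.d n)) n)

/-- The projective resolution defined by the system. -/
def resolution : ProjectiveResolution (ModuleCat.of Q M) :=
  projectiveResolutionOfExact T.complex
    (fun n => have := T.freeX n; (inferInstance : Module.Projective Q (T.X n)))
    (ModuleCat.ofHom T.ε) T.ε_surjective
    (fun x => (T.exact_zero x).trans
      (exists_congr fun z => Eq.congr_left (T.complex_d 0 z).symm))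
    fun n x hx => by
      obtain ⟨z, hz⟩ := T.exact_succ n x ((T.complex_d n x).symm.trans hx)
      exact ⟨z, (T.complex_d _ z).trans hz⟩

lemma w_injective (n : ℕ) : Function.Injective (T.w n) := by
  refine (injective_iff_map_eq_zero (T.w n)).2 fun a ha => ?_
  match n with
  | 0 => exact T.w_zero.1 (ha.trans (map_zero _).symm)
  | 1 => exact (T.eq_zero_one a 0 (by rw [ha, map_zero, map_zero, add_zero])).1
  | n + 2 =>
    exact (T.eq_zero_add_two n a 0 0 (by
      rw [ha, map_zero, map_zero, map_zero, add_zero, add_zero])).1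

/-- The sum `∑ y_{n-j} v_j`. -/
def total (n : ℕ) : (∀ j, T.V j) →ₗ[Q] T.X n :=
  ∑ j ∈ Finset.range (n + 1), T.act (n - j) j n ∘ₗ T.w j ∘ₗ LinearMap.proj j

lemma total_apply (n : ℕ) (v : ∀ j, T.V j) :
    T.total n v = ∑ j ∈ Finset.range (n + 1), T.act (n - j) j n (T.w j (v j)) := by
  simp [total]

lemma act_one (n : ℕ) (x : T.X n) : T.act 1 n (n + 1) x = T.y n x := by
  rw [act_apply, Y, dividedPow_odd (k := 0)]
  simp [yT_single, single_same]

lemma act_two (n : ℕ) (x : T.X n) : T.act 2 n (n + 2) x = T.t n x := by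
  rw [act_apply, Y, dividedPow_even (k := 1)]
  simp [tT_single, single_same]

lemma total_zero (v : ∀ j, T.V j) : T.total 0 v = T.w 0 (v 0) := by
  simp [total_apply, act_zero]

lemma total_one (v : ∀ j, T.V j) : T.total 1 v = T.w 1 (v 1) + T.y 0 (T.w 0 (v 0)) := by
  simp [total_apply, Finset.sum_range_succ, act_zero, act_one, add_comm]

variable [IsLocalRing Q] [CharZero (IsLocalRing.ResidueField Q)]

/-- The dg module structure. -/
def dg : TateDGModule f g T.complex where
  -- The component `act` is defined for all triples of degrees, so the equation i + n = m is not
  -- needed as data.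
  y i n m _ := T.act i n m
  one_act {n} x := T.act_zero n x
  mul_act hj _ _ x := T.act_act hj x
  leibniz_zero i x := (T.complex_d i _).trans (T.d_act_zero i x)
  leibniz_succ {i n m} _ _ _ x := (T.complex_d m _).trans ((T.d_act_succ i n m x).trans
    (congrArg (fun z => _ + (-1 : Q) ^ (i + 1) • T.act (i + 1) n m z) (T.complex_d n x).symm))

/-- Since t = y_2 and y_2 y_{n-j} = `tateMul 2 (n - j)` y_{n+2-j}, the coefficients must be rescaled
when t is factored out of the terms with j ≤ n. -/
lemma total_add_two (n : ℕ) (u v : ∀ j, T.V j)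
    (h : ∀ j ≤ n, u j = (tateMul 2 (n - j) : Q) • v j) :
    T.total (n + 2) u = T.w (n + 2) (u (n + 2)) + T.y (n + 1) (T.w (n + 1) (u (n + 1))) +
      T.t n (T.total n v) := by
  have e1 : n + 2 - (n + 1) = 1 := by omega
  rw [total_apply, Finset.sum_range_succ, Finset.sum_range_succ, Nat.sub_self, act_zero, e1,
    act_one, total_apply, map_sum, add_assoc]
  refine (congrArg (· + _) (Finset.sum_congr rfl fun j hj => ?_)).trans
    ((add_comm _ _).trans (congrArg (· + _) (add_comm _ _)))
  have hj' : j ≤ n := Nat.lt_succ_iff.1 (Finset.mem_range.1 hj)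
  have e2 : n + 2 - j = 2 + (n - j) := by omega
  rw [← act_two, T.act_act (by omega), h j hj', map_smul, map_smul, e2, Nat.cast_smul_eq_nsmul]

/-- The decomposition V_{n+2} ⊕ yV_{n+1} ⊕ tX_n reduces the claim by two degrees; the rescaling
factors are units because the residue characteristic is 0. -/
lemma eq_zero_of_total_eq_zero (n : ℕ) (v : ∀ j, T.V j) (hv : T.total n v = 0) (j : ℕ)
    (hj : j ≤ n) : v j = 0 := by
  induction n using Nat.strong_induction_on generalizing v j with
  | _ n ih =>
    match n with
    | 0 =>
      obtain rfl : j = 0 := by omega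
      rw [total_zero] at hv
      exact T.w_injective 0 (hv.trans (map_zero _).symm)
    | 1 =>
      rw [total_one] at hv
      obtain ⟨h1, h0⟩ := T.eq_zero_one _ _ hv
      rcases (show j = 0 ∨ j = 1 by omega) with rfl | rfl
      · exact h0
      · exact h1
    | n + 2 =>
      have hu : ∀ j, v j = (tateMul 2 (n - j) : Q) •
          (Ring.inverse (tateMul 2 (n - j) : Q) • v j) := fun j => by
        rw [smul_smul, Ring.mul_inverse_cancel _ (SemifreeResolution.isUnit_tateMul _), one_smul]
      rw [T.total_add_two n v (fun j => Ring.inverse (tateMul 2 (n - j) : Q) • v j)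
        fun j _ => hu j] at hv
      obtain ⟨h2, h1, h0⟩ := T.eq_zero_add_two _ _ _ _ hv
      rcases (show j ≤ n ∨ j = n + 1 ∨ j = n + 2 by omega) with h | rfl | rfl
      · rw [hu j]
        exact (congrArg _ (ih n (by omega) _ h0 j h)).trans (smul_zero _)
      · exact h1
      · exact h2

lemma total_surjective (n : ℕ) (x : T.X n) : ∃ v, T.total n v = x := by
  induction n using Nat.strong_induction_on with
  | _ n ih =>
    match n with
    | 0 =>
      obtain ⟨a, rfl⟩ := T.w_zero.2 x
      exact ⟨Function.update 0 0 a, by rw [total_zero, Function.update_self]⟩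
    | 1 =>
      obtain ⟨a, b, rfl⟩ := T.exists_one x
      refine ⟨Function.update (Function.update 0 0 b) 1 a, ?_⟩
      rw [total_one, Function.update_self, Function.update_of_ne zero_ne_one,
        Function.update_self]
    | n + 2 =>
      obtain ⟨a, b, c, rfl⟩ := T.exists_add_two n x
      obtain ⟨v, rfl⟩ := ih n (by omega) c
      refine ⟨Function.update (Function.update (fun j => (tateMul 2 (n - j) : Q) • v j) (n + 1) b)
        (n + 2) a, ?_⟩
      rw [T.total_add_two n _ v fun j hj => ?_, Function.update_self,
        Function.update_of_ne (by omega), Function.update_self]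
      rw [Function.update_of_ne (by omega), Function.update_of_ne (by omega)]

/-- The semi-free resolution defined by the system. -/
def semifreeResolution : SemifreeResolution f g M where
  res := T.resolution
  dg := T.dg
  V n := LinearMap.range (T.w n)
  free n := by
    have := T.free n
    exact Module.Free.of_equiv (LinearEquiv.ofInjective (T.w n) (T.w_injective n))
  bijective n := by
    have key : ∀ (u : ∀ j, T.V j) (v : ∀ j : Fin (n + 1), LinearMap.range (T.w j)),
        (∀ j : Fin (n + 1), T.w j (u j) = v j) →
        ∑ j : Fin (n + 1), T.act (n - j) j n (v j) = T.total n u := by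
      intro u v h
      rw [total_apply, Finset.sum_range]
      exact Finset.sum_congr rfl fun j _ => congrArg _ (h j).symm
    have lift : ∀ v : (∀ j : Fin (n + 1), LinearMap.range (T.w j)),
        ∃ u : ∀ j, T.V j, ∀ j : Fin (n + 1), T.w j (u j) = v j := by
      intro v
      -- Coefficients beyond degree n do not enter the sum; 0 is a filler.
      refine ⟨fun j => if h : j < n + 1 then (v ⟨j, h⟩).2.choose else 0, fun j => ?_⟩
      have h := (v j).2.choose_spec
      exact (congrArg (T.w j) (dif_pos j.2)).trans h
    constructor
    · intro v v' h
      obtain ⟨u, hu⟩ := lift v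
      obtain ⟨u', hu'⟩ := lift v'
      have h' : T.total n (u - u') = 0 := by
        rw [map_sub, sub_eq_zero]
        exact (key u v hu).symm.trans (Eq.trans h (key u' v' hu'))
      refine funext fun j => Subtype.ext ?_
      have hj := T.eq_zero_of_total_eq_zero n _ h' j (Nat.lt_succ_iff.1 j.2)
      exact (hu j).symm.trans ((congrArg (T.w j) (sub_eq_zero.1 hj)).trans (hu' j))
    · intro x
      obtain ⟨u, rfl⟩ := T.total_surjective n x
      exact ⟨fun j => ⟨T.w j (u j), u j, rfl⟩, key u _ fun j => rfl⟩

end TateSystem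

lemma exists_semifreeResolution {Q : Type u} [CommRing Q] [IsNoetherianRing Q] [IsLocalRing Q]
    [CharZero (IsLocalRing.ResidueField Q)] {f g : Q} (hgf : g * f = 0) {M : Type u}
    [AddCommGroup M] [Module Q M] [Module.Finite Q M] (hfM : ∀ x : M, f • x = 0) :
    ∃ D : SemifreeResolution f g M, ∀ n, Module.Finite Q (D.U.X n) := by
  obtain ⟨T⟩ := nonempty_tateSystem hgf hfM
  exact ⟨T.semifreeResolution, T.finiteX⟩

end

/-! ### Finite length of Tor over Q -/

section

variable {Q : Type u} [CommRing Q]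

/-- For finitely generated modules the support is detected on fibres over residue fields, and the
fibre of M ⊗ N is a tensor product of two nonzero vector spaces. -/
lemma annihilator_sup_le_support_tensorProduct {M N : Type u} [AddCommGroup M] [Module Q M]
    [Module.Finite Q M] [AddCommGroup N] [Module Q N] [Module.Finite Q N] (p : PrimeSpectrum Q)
    (h : Module.annihilator Q M ⊔ Module.annihilator Q N ≤ p.asIdeal) :
    p ∈ Module.support Q (M ⊗[Q] N) := by
  have hM := (Module.mem_support_iff_nontrivial_residueField_tensorProduct (M := M) p).1
    (Module.mem_support_iff_of_finite.2 (le_sup_left.trans h))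
  have hN := (Module.mem_support_iff_nontrivial_residueField_tensorProduct (M := N) p).1
    (Module.mem_support_iff_of_finite.2 (le_sup_right.trans h))
  rw [Module.mem_support_iff_nontrivial_residueField_tensorProduct]
  exact (AlgebraTensorModule.distribBaseChange Q p.asIdeal.ResidueField M N).toEquiv.nontrivial

variable [IsLocalRing Q]

/-- The chain 𝔪^n X stabilises because X is Artinian, and by Nakayama its stable value is zero. -/
lemma exists_maximalIdeal_pow_le_annihilator {X : Type u} [AddCommGroup X] [Module Q X]
    (hX : Module.length Q X ≠ ⊤) :
    ∃ k, IsLocalRing.maximalIdeal Q ^ k ≤ Module.annihilator Q X := by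
  obtain ⟨_, _⟩ := isFiniteLength_iff_isNoetherian_isArtinian.1 (Module.length_ne_top_iff.1 hX)
  obtain ⟨k, hk⟩ := IsArtinian.monotone_stabilizes (R := Q) (M := X)
    ⟨fun n => OrderDual.toDual ((IsLocalRing.maximalIdeal Q ^ n) • (⊤ : Submodule Q X)),
      fun a b hab => Submodule.smul_mono_left (Ideal.pow_le_pow_right hab)⟩
  have h1 : IsLocalRing.maximalIdeal Q ^ k • (⊤ : Submodule Q X) =
      IsLocalRing.maximalIdeal Q ^ (k + 1) • (⊤ : Submodule Q X) := hk (k + 1) (Nat.le_succ k)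
  have h2 := Submodule.eq_bot_of_le_smul_of_le_jacobson_bot (IsLocalRing.maximalIdeal Q)
    (IsLocalRing.maximalIdeal Q ^ k • (⊤ : Submodule Q X)) (IsNoetherian.noetherian _)
    (by rw [← mul_smul, ← pow_succ']; exact h1.le) (IsLocalRing.maximalIdeal_le_jacobson _)
  refine ⟨k, fun r hr => Module.mem_annihilator.2 fun x => ?_⟩
  rw [← Submodule.mem_bot Q, ← h2]
  exact Submodule.smul_mem_smul hr trivial

/-- A prime containing ann X lies in the support of M ⊗ N, hence contains a power of 𝔪 and equals 𝔪.
So Q/ann X is Artinian, and X is a finitely generated module over it. -/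
lemma length_ne_top_of_annihilator_sup_le [IsNoetherianRing Q] {M N X : Type u} [AddCommGroup M] [Module Q M]
    [Module.Finite Q M] [AddCommGroup N] [Module Q N] [Module.Finite Q N]
    [AddCommGroup X] [Module Q X] [Module.Finite Q X]
    (hMN : Module.length Q (M ⊗[Q] N) ≠ ⊤)
    (h : Module.annihilator Q M ⊔ Module.annihilator Q N ≤ Module.annihilator Q X) :
    Module.length Q X ≠ ⊤ := by
  obtain ⟨k, hk⟩ := exists_maximalIdeal_pow_le_annihilator hMN
  let J := Module.annihilator Q X
  have : IsArtinianRing (Q ⧸ J) := by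
    rw [isArtinianRing_iff_krullDimLE_zero, Ring.krullDimLE_zero_iff]
    intro P hP
    have hle : J ≤ P.comap (Ideal.Quotient.mk J) := fun r hr => by
      rw [Ideal.mem_comap, Ideal.Quotient.eq_zero_iff_mem.2 hr]
      exact zero_mem _
    have hp : (P.comap (Ideal.Quotient.mk J)).IsPrime := inferInstance
    have hs := annihilator_sup_le_support_tensorProduct (M := M) (N := N)
      ⟨P.comap (Ideal.Quotient.mk J), hp⟩ (h.trans hle)
    have hm := hk.trans (Module.mem_support_iff_of_finite.1 hs)
    have hm' : IsLocalRing.maximalIdeal Q = P.comap (Ideal.Quotient.mk J) :=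
      (IsLocalRing.maximalIdeal.isMaximal Q).eq_of_le hp.ne_top (hp.le_of_pow_le hm)
    have : (P.comap (Ideal.Quotient.mk J)).IsMaximal := hm' ▸ IsLocalRing.maximalIdeal.isMaximal Q
    have hP' := Ideal.map_eq_top_or_isMaximal_of_surjective (Ideal.Quotient.mk J)
      Ideal.Quotient.mk_surjective this
    rw [Ideal.map_comap_of_surjective _ Ideal.Quotient.mk_surjective] at hP'
    exact hP'.resolve_left hP.ne_top
  let _ : Module (Q ⧸ J) X := Module.quotientAnnihilator
  have : IsScalarTower Q (Q ⧸ J) X := inferInstance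
  have : Module.Finite (Q ⧸ J) X := Module.Finite.of_restrictScalars_finite Q (Q ⧸ J) X
  have : IsArtinian Q X := isArtinian_of_surjective_algebraMap (S := Q) (R := Q ⧸ J)
    Ideal.Quotient.mk_surjective
  have : IsNoetherian Q X := isNoetherian_of_isNoetherianRing_of_finite Q X
  exact Module.length_ne_top

end

section

variable {A : Type u} [CommRing A]

lemma finite_homology [IsNoetherianRing A] (C : ChainComplex (ModuleCat.{u} A) ℕ) (n : ℕ)
    [Module.Finite A (C.X n)] : Module.Finite A (C.homology n) := by
  have hi : Function.Injective (C.iCycles n) := (ModuleCat.mono_iff_injective _).1 inferInstance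
  have hs : Function.Surjective (C.homologyπ n) :=
    (ModuleCat.epi_iff_surjective _).1 inferInstance
  have : Module.Finite A (C.cycles n) := Module.Finite.of_injective (C.iCycles n).hom hi
  exact Module.Finite.of_surjective (C.homologyπ n).hom hs

lemma smul_homology_eq_zero {C : ChainComplex (ModuleCat.{u} A) ℕ} {n : ℕ} (a : A)
    (h : ∀ x : C.X n, IsCycle C n x → IsBoundary C n (a • x)) (c : C.homology n) : a • c = 0 := by
  obtain ⟨x, hx, rfl⟩ := exists_cycleClass c
  have hx' : IsCycle C n (a • x) := (cycleSubmodule C n).smul_mem a hx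
  rw [← cycleClass_smul a x hx hx', cycleClass_eq_zero_iff]
  exact h x hx

variable {M N : Type u} [AddCommGroup M] [Module A M] [AddCommGroup N] [Module A N]
  (P : ProjectiveResolution (ModuleCat.of A M)) (n : ℕ)

lemma smul_homology_tensorN_of_right (a : A) (h : ∀ x : N, a • x = 0)
    (c : ((((tensorN N).mapHomologicalComplex _).obj P.complex).homology n)) : a • c = 0 := by
  refine smul_homology_eq_zero a (fun x _ => ⟨n, 0, ?_⟩) c
  rw [map_zero]
  have key : ∀ x : P.complex.X n ⊗[A] N, a • x = 0 := fun x => by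
    induction x with
    | zero => exact smul_zero a
    | add x y hx hy => rw [smul_add, hx, hy, add_zero]
    | tmul x y => rw [← TensorProduct.tmul_smul, h, TensorProduct.tmul_zero]
  exact (key x).symm

/-- Multiplication by `a` on a complex. -/
def smulHom (a : A) (C : ChainComplex (ModuleCat.{u} A) ℕ) : C ⟶ C where
  f n := ModuleCat.ofHom (LinearMap.lsmul A (C.X n) a)
  comm' i j _ := ModuleCat.hom_ext (LinearMap.ext fun x => ((C.d i j).hom.map_smul a x))

/-- If a kills M, multiplication by a on P and the zero chain map both lift the zero map of M, so
they induce the same map on Tor. -/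
lemma smul_homology_tensorN_of_left (a : A) (h : ∀ x : M, a • x = 0)
    (c : ((((tensorN N).mapHomologicalComplex _).obj P.complex).homology n)) : a • c = 0 := by
  have h0 : (smulHom a P.complex) ≫ P.π = P.π ≫ (ChainComplex.single₀ _).map
      (0 : ModuleCat.of A M ⟶ ModuleCat.of A M) := by
    rw [Functor.map_zero, Limits.comp_zero]
    refine HomologicalComplex.to_single_hom_ext ?_
    refine ModuleCat.hom_ext (LinearMap.ext fun x => ?_)
    change (P.π.f 0).hom (a • x) = 0
    rw [map_smul]
    exact h _
  have h1 := Functor.leftDerived_map_eq (tensorN N) n (0 : ModuleCat.of A M ⟶ ModuleCat.of A M)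
    (P := P) (Q := P) (smulHom a P.complex) h0
  have h2 : HomologicalComplex.homologyMap (((tensorN N).mapHomologicalComplex _).map
      (smulHom a P.complex)) n = 0 := by
    have key : ∀ {X Y : ModuleCat.{u} A} (e : X ≅ Y) (m : Y ⟶ Y), e.hom ≫ m ≫ e.inv = 0 →
        m = 0 := fun e m he => by
      rw [← cancel_mono e.inv, ← cancel_epi e.hom, he, Limits.zero_comp, Limits.comp_zero]
    have h3 := (Functor.leftDerived_map_eq (tensorN N) n (0 : ModuleCat.of A M ⟶ ModuleCat.of A M)
      (P := P) (Q := P) 0 (by rw [Functor.map_zero, Limits.comp_zero, Limits.zero_comp])).trans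
        (by rw [Functor.map_zero, Limits.zero_comp, Limits.comp_zero])
    exact key _ _ (h1.symm.trans h3)
  rw [homologyMap_eq_zero_iff] at h2
  refine smul_homology_eq_zero a (fun x hx => ?_) c
  have h3 := h2 x hx
  have key : ∀ x : P.complex.X n ⊗[A] N,
      (LinearMap.lsmul A (P.complex.X n) a).rTensor N x = a • x := fun x => by
    induction x with
    | zero => rw [map_zero, smul_zero]
    | add x y hx hy => rw [map_add, smul_add, hx, hy]
    | tmul x y => rfl
  exact (key x) ▸ h3

end

section

variable {Q : Type u} [CommRing Q] [IsLocalRing Q] [IsNoetherianRing Q]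
  {M N : Type u} [AddCommGroup M] [Module Q M] [Module.Finite Q M] [AddCommGroup N] [Module Q N]
  [Module.Finite Q N]

/-- If `M ⊗ N` has finite length, then so have the modules `Tor_n(M, N)`. -/
lemma length_torModule_ne_top (P : ProjectiveResolution (ModuleCat.of Q M))
    (hP : ∀ n, Module.Finite Q (P.complex.X n)) (hMN : Module.length Q (M ⊗[Q] N) ≠ ⊤) (n : ℕ) :
    Module.length Q (torModule Q M N n) ≠ ⊤ := by
  rw [length_torModule P]
  have := hP n
  have : Module.Finite Q ((((tensorN N).mapHomologicalComplex
      (ComplexShape.down ℕ)).obj P.complex).X n) :=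
    (inferInstance : Module.Finite Q (P.complex.X n ⊗[Q] N))
  have := finite_homology (((tensorN N).mapHomologicalComplex _).obj P.complex) n
  refine length_ne_top_of_annihilator_sup_le hMN (sup_le (fun a ha => ?_) fun a ha => ?_)
  · exact Module.mem_annihilator.2
      (smul_homology_tensorN_of_left P n a (Module.mem_annihilator.1 ha))
  · exact Module.mem_annihilator.2
      (smul_homology_tensorN_of_right P n a (Module.mem_annihilator.1 ha))

end

/-! ### Power series and recursive inequalities -/

section numeric

lemma inv_one_sub_X : ((1 - PowerSeries.X)⁻¹ : PowerSeries ℝ) = PowerSeries.mk 1 :=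
  ((PowerSeries.eq_inv_iff_mul_eq_one (by simp)).2 (PowerSeries.mk_one_mul_one_sub_eq_one ℝ)).symm

lemma coeff_mul_inv_one_sub_X (a : PowerSeries ℝ) (n : ℕ) :
    PowerSeries.coeff n (a * (1 - PowerSeries.X)⁻¹) =
      ∑ k ∈ Finset.range (n + 1), PowerSeries.coeff k a := by
  rw [inv_one_sub_X, PowerSeries.coeff_mul, Finset.Nat.sum_antidiagonal_eq_sum_range_succ_mk]
  simp

lemma mul_inv_one_sub_X_eq (a : PowerSeries ℝ) :
    (1 - PowerSeries.X + PowerSeries.X ^ 2) * a * (1 - PowerSeries.X)⁻¹ =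
      a + PowerSeries.X ^ 2 * (a * (1 - PowerSeries.X)⁻¹) := by
  have h : (1 - PowerSeries.X : PowerSeries ℝ) * (1 - PowerSeries.X)⁻¹ = 1 :=
    PowerSeries.mul_inv_cancel _ (by simp)
  linear_combination a * h

lemma coeffLE_mk_mul_inv (p r : ℕ → ℕ) (h : ∀ n, p n ≤ ∑ k ∈ Finset.range (n + 1), r k) :
    CoeffLE (PowerSeries.mk fun n => (p n : ℝ))
      (PowerSeries.mk (fun n => (r n : ℝ)) * (1 - PowerSeries.X)⁻¹) := fun n => by
  simp only [coeff_mul_inv_one_sub_X, PowerSeries.coeff_mk]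
  exact_mod_cast h n

lemma mk_eq_mk_mul_inv_iff (p r : ℕ → ℕ) :
    PowerSeries.mk (fun n => (p n : ℝ)) =
      PowerSeries.mk (fun n => (r n : ℝ)) * (1 - PowerSeries.X)⁻¹ ↔
        ∀ n, p n = ∑ k ∈ Finset.range (n + 1), r k := by
  rw [PowerSeries.ext_iff]
  refine forall_congr' fun n => ?_
  simp only [coeff_mul_inv_one_sub_X, PowerSeries.coeff_mk]
  exact_mod_cast Iff.rfl

/-- As (1 - t + t²)/(1 - t) = 1 + t²/(1 - t), the coefficient in degree n + 1 is p_{n+1} plus the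
sum of the p_k with k ≤ n - 1. -/
lemma coeffLE_mk_mul_mul_inv (p r : ℕ → ℕ) (h₀ : r 0 ≤ p 0)
    (h : ∀ n, r (n + 1) ≤ p (n + 1) + ∑ k ∈ Finset.range n, p k) :
    CoeffLE (PowerSeries.mk fun n => (r n : ℝ)) ((1 - PowerSeries.X + PowerSeries.X ^ 2) *
      PowerSeries.mk (fun n => (p n : ℝ)) * (1 - PowerSeries.X)⁻¹) := fun n => by
  rw [mul_inv_one_sub_X_eq, map_add, PowerSeries.coeff_X_pow_mul']
  match n with
  | 0 => simpa using h₀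
  | 1 => simpa using h 0
  | n + 2 =>
    rw [if_pos (by omega), Nat.add_sub_cancel]
    simp only [coeff_mul_inv_one_sub_X, PowerSeries.coeff_mk]
    exact_mod_cast h (n + 1)

variable {p p' r r' w : ℕ → ℕ} (hp₀ : p' 0 = 0) (hp₁ : p' 1 = 0) (hp : ∀ n, p' (n + 2) = p n)
  (hr₀ : r' 0 = 0) (hr : ∀ n, r' (n + 1) = r n)

section

variable (h₁ : ∀ n, p n ≤ p' n + w n) (h₂ : ∀ n, w n ≤ r' n + r n)

include hp₀ hp₁ hp hr₀ hr h₁ h₂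

/-- Here p' and r' are p and r shifted by two and one. Combining the hypotheses gives p_n ≤ p_{n-2}
+ r_{n-1} + r_n, which telescopes in steps of two. -/
lemma le_sum_range_of_le (n : ℕ) : p n ≤ ∑ k ∈ Finset.range (n + 1), r k := by
  induction n using Nat.twoStepInduction with
  | zero =>
    have := h₁ 0; have := h₂ 0
    rw [Finset.sum_range_one]
    omega
  | one =>
    have := h₁ 1; have := h₂ 1; have : r' 1 = r 0 := hr 0
    rw [Finset.sum_range_succ, Finset.sum_range_one]
    omega
  | more n ih _ =>
    have := h₁ (n + 2); have := h₂ (n + 2); have : r' (n + 2) = r (n + 1) := hr (n + 1); have := hp n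
    rw [Finset.sum_range_succ, Finset.sum_range_succ]
    omega

/-- If p_n is the full sum of the r_k, then p_{n+2} - p_n = r_{n+1} + r_{n+2} attains the bound
imposed by both inequalities, so neither is strict. -/
lemma eq_sum_range_iff : (∀ n, p n = ∑ k ∈ Finset.range (n + 1), r k) ↔
    (∀ n, p n = p' n + w n) ∧ ∀ n, w n = r' n + r n := by
  constructor
  · intro h
    have key : ∀ n, p n = p' n + w n ∧ w n = r' n + r n := fun n => by
      have := h₁ n; have := h₂ n; have h0 := h n
      match n with
      | 0 =>
        rw [Finset.sum_range_one] at h0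
        omega
      | 1 =>
        have : r' 1 = r 0 := hr 0
        rw [Finset.sum_range_succ, Finset.sum_range_one] at h0
        omega
      | n + 2 =>
        have := h n; have := hp n; have : r' (n + 2) = r (n + 1) := hr (n + 1)
        rw [Finset.sum_range_succ, Finset.sum_range_succ] at h0
        omega
    exact ⟨fun n => (key n).1, fun n => (key n).2⟩
  · rintro ⟨h3, h4⟩ n
    induction n using Nat.twoStepInduction with
    | zero =>
      have := h3 0; have := h4 0
      rw [Finset.sum_range_one]
      omega
    | one =>
      have := h3 1; have := h4 1; have : r' 1 = r 0 := hr 0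
      rw [Finset.sum_range_succ, Finset.sum_range_one]
      omega
    | more n ih _ =>
      have := h3 (n + 2); have := h4 (n + 2); have : r' (n + 2) = r (n + 1) := hr (n + 1); have := hp n
      rw [Finset.sum_range_succ, Finset.sum_range_succ]
      omega

end

include hp₀ hp₁ hp hr₀ hr in
-- Eliminating w gives r_{n+1} ≤ p_{n+1} + p_{n-2} + r_{n-1}; the bound for r_{n-1} contributes
-- p_{n-1} and the earlier terms.
lemma le_add_sum_range_of_le (h₀ : w 0 ≤ p 0) (h₁ : ∀ n, w (n + 1) ≤ p (n + 1) + p' n)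
    (h₂ : r 0 ≤ w 0) (h₃ : ∀ n, r (n + 1) ≤ w (n + 1) + r' n) (n : ℕ) :
    r (n + 1) ≤ p (n + 1) + ∑ k ∈ Finset.range n, p k := by
  induction n using Nat.twoStepInduction with
  | zero =>
    have := h₁ 0; have := h₃ 0
    rw [Finset.sum_range_zero]
    omega
  | one =>
    have : r 2 ≤ w 2 + r' 1 := h₃ 1; have : r' 1 = r 0 := hr 0
    rw [Finset.sum_range_one]
    change r 2 ≤ p 2 + p 0
    have : w 2 ≤ p 2 + p' 1 := h₁ 1
    omega
  | more n ih _ =>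
    have := h₁ (n + 2); have := h₃ (n + 2); have : r' (n + 2) = r (n + 1) := hr (n + 1); have := hp n
    rw [Finset.sum_range_succ, Finset.sum_range_succ]
    omega

end numeric

/-! ### Comparison of the Poincaré series -/

lemma ENat.exists_nat_seq {a : ℕ → ℕ∞} (h : ∀ n, a n ≠ ⊤) : ∃ b : ℕ → ℕ, ∀ n, a n = b n :=
  ⟨fun n => (a n).toNat, fun n => (ENat.natCast_toNat (h n)).symm⟩

section

variable {A : Type u} [CommRing A] {S : ShortComplex (ChainComplex (ModuleCat.{u} A) ℕ)}
  {X Y Z : ChainComplex (ModuleCat.{u} A) ℕ} {a b c : ℕ → ℕ}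

/-- The inequalities between the lengths in the long exact homology sequence. -/
lemma natLength_homology_le (hS : S.ShortExact) (hX : S.X₁ = X) (hY : S.X₂ = Y) (hZ : S.X₃ = Z)
    (ha : ∀ n, Module.length A (X.homology n) = a n)
    (hb : ∀ n, Module.length A (Y.homology n) = b n)
    (hc : ∀ n, Module.length A (Z.homology n) = c n) :
    (∀ n, b n ≤ a n + c n) ∧ (c 0 ≤ b 0 ∧ ∀ n, c (n + 1) ≤ b (n + 1) + a n) ∧
      ((∀ n, b n = a n + c n) ↔ ∀ n, hS.δ (n + 1) n rfl = 0) := by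
  subst hX hY hZ
  refine ⟨fun n => ?_, ⟨?_, fun n => ?_⟩, ?_⟩
  · have := length_homology_middle_le hS n
    rw [ha, hb, hc] at this
    exact_mod_cast this
  · have := length_homology_right_zero_le hS
    rw [hb, hc] at this
    exact_mod_cast this
  · have := length_homology_right_le hS n
    rw [ha, hb, hc] at this
    exact_mod_cast this
  · rw [← length_homology_middle_eq_iff hS (fun n => (ha n).trans_ne (ENat.natCast_ne_top _))
      fun n => (hc n).trans_ne (ENat.natCast_ne_top _)]
    refine forall_congr' fun n => ?_
    rw [ha, hb, hc]
    exact_mod_cast Iff.rfl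

/-- In a short exact sequence, the homology of the third complex has finite length in degree `n`
if the homology of the second one and that of the first one in degree `n - 1` have. -/
lemma length_homology_right_ne_top (hS : S.ShortExact) (hX : S.X₁ = X) (hY : S.X₂ = Y)
    (hZ : S.X₃ = Z) {n : ℕ} (hb : Module.length A (Y.homology n) ≠ ⊤)
    (ha : ∀ m, n = m + 1 → Module.length A (X.homology m) ≠ ⊤) :
    Module.length A (Z.homology n) ≠ ⊤ := by
  subst hX hY hZ
  cases n with
  | zero => exact ne_top_of_le_ne_top hb (length_homology_right_zero_le hS)
  | succ n =>
    exact ne_top_of_le_ne_top (WithTop.add_ne_top.2 ⟨hb, ha n rfl⟩) (length_homology_right_le hS n)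

end

namespace SemifreeResolution

variable {Q : Type u} [CommRing Q] [IsLocalRing Q] [CharZero (IsLocalRing.ResidueField Q)]
  {f g : Q} {M : Type u} [AddCommGroup M] [Module Q M] (D : SemifreeResolution f g M)
  (N : Type u) [AddCommGroup N] [Module Q N] (hfg : IsExactPair f g)

include hfg

lemma length_homology_W_ne_top (h : ∀ n, Module.length Q ((D.USN N).homology n) ≠ ⊤) (n : ℕ) :
    Module.length Q ((D.WN N hfg).homology n) ≠ ⊤ := by
  refine length_homology_right_ne_top (D.seqN_shortExact hfg N) (X := D.shiftUSN N) rfl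
    (Y := D.USN N) rfl rfl (h n) fun m _ => ?_
  match m with
  | 0 => rw [D.length_homology_shiftUS_zero N]; exact ENat.zero_ne_top
  | 1 => rw [D.length_homology_shiftUS_one N]; exact ENat.zero_ne_top
  | m + 2 => rw [D.length_homology_shiftUS_add_two N m]; exact h m

/-- H_n(V) lies between H_n(W) and H_{n-1}(ΣV) = H_{n-2}(V) in the cone sequence, so finiteness
propagates upwards in steps of two. -/
lemma length_homology_V_ne_top (h : ∀ n, Module.length Q ((D.USN N).homology n) ≠ ⊤) (n : ℕ) :
    Module.length Q ((D.VSN N).homology n) ≠ ⊤ := by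
  induction n using Nat.strong_induction_on with
  | _ n ih =>
    refine length_homology_right_ne_top (D.coneSeq_shortExact N hfg) (X := D.shiftVSN N) rfl
      (Y := D.WN N hfg) rfl rfl (D.length_homology_W_ne_top N hfg h n) fun m hm => ?_
    cases m with
    | zero => rw [D.length_homology_shiftVS_zero N]; exact ENat.zero_ne_top
    | succ m => rw [D.length_homology_shiftVS_succ N m]; exact ih m (by omega)

/-- The comparison of the Poincaré series computed from a semi-free resolution. -/
lemma coeffLE_of_length_ne_top {p r : ℕ → ℕ}
    (hp : ∀ n, Module.length Q ((D.USN N).homology n) = p n)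
    (hr : ∀ n, Module.length Q ((D.VSN N).homology n) = r n) :
    (r 0 ≤ p 0 ∧ ∀ n, r (n + 1) ≤ p (n + 1) + ∑ k ∈ Finset.range n, p k) ∧
    (∀ n, p n ≤ ∑ k ∈ Finset.range (n + 1), r k) ∧
    ((∀ n, p n = ∑ k ∈ Finset.range (n + 1), r k) ↔
      (∀ n, D.mu hfg N n = 0) ∧ ∀ n, D.delta hfg N n = 0) := by
  have hp' : ∀ n, Module.length Q ((D.USN N).homology n) ≠ ⊤ := fun n => by
    rw [hp]; exact ENat.natCast_ne_top _
  obtain ⟨w, hw⟩ := ENat.exists_nat_seq (D.length_homology_W_ne_top N hfg hp')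
  obtain ⟨p', hpp, hp₀, hp₁, hp₂⟩ : ∃ p' : ℕ → ℕ,
      (∀ n, Module.length Q ((D.shiftUSN N).homology n) = p' n) ∧ p' 0 = 0 ∧ p' 1 = 0 ∧
        ∀ n, p' (n + 2) = p n :=
    ⟨fun n => match n with | 0 => 0 | 1 => 0 | n + 2 => p n, fun n => match n with
      | 0 => D.length_homology_shiftUS_zero N
      | 1 => D.length_homology_shiftUS_one N
      | n + 2 => (D.length_homology_shiftUS_add_two N n).trans (hp n), rfl, rfl, fun _ => rfl⟩
  obtain ⟨r', hrr, hr₀, hr₁⟩ : ∃ r' : ℕ → ℕ,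
      (∀ n, Module.length Q ((D.shiftVSN N).homology n) = r' n) ∧ r' 0 = 0 ∧
        ∀ n, r' (n + 1) = r n :=
    ⟨fun n => match n with | 0 => 0 | n + 1 => r n, fun n => match n with
      | 0 => D.length_homology_shiftVS_zero N
      | n + 1 => (D.length_homology_shiftVS_succ N n).trans (hr n), rfl, fun _ => rfl⟩
  obtain ⟨a1, ⟨a3, a2⟩, a4⟩ := natLength_homology_le (D.seqN_shortExact hfg N)
    (X := D.shiftUSN N) rfl (Y := D.USN N) rfl (Z := D.WN N hfg) rfl hpp hp hw
  obtain ⟨b1, ⟨b3, b2⟩, b4⟩ := natLength_homology_le (D.coneSeq_shortExact N hfg)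
    (X := D.shiftVSN N) rfl (Y := D.WN N hfg) rfl (Z := D.VSN N) rfl hrr hw hr
  refine ⟨⟨b3.trans a3, le_add_sum_range_of_le hp₀ hp₁ hp₂ hr₀ hr₁ a3 a2 b3 b2⟩,
    le_sum_range_of_le hp₀ hp₁ hp₂ hr₀ hr₁ a1 b1, ?_⟩
  rw [eq_sum_range_iff hp₀ hp₁ hp₂ hr₀ hr₁ a1 b1, a4, b4]
  refine and_congr Iff.rfl ⟨fun h n => ?_, fun h n =>
    (D.coneSeq_δ_eq_zero_iff N hfg n).2 (h (n + 1))⟩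
  match n with
  | 0 => exact D.delta_zero N hfg
  | n + 1 => exact (D.coneSeq_δ_eq_zero_iff N hfg n).1 (h n)

end SemifreeResolution

theorem mainTheorem2 {Q : Type u} [CommRing Q] [IsLocalRing Q] [IsNoetherianRing Q]
    [CharZero (IsLocalRing.ResidueField Q)] (f g : Q) (hfg : IsExactPair f g)
    (M N : Type u)
    [AddCommGroup M] [Module Q M] [Module (Q ⧸ Ideal.span {f}) M]
    [IsScalarTower Q (Q ⧸ Ideal.span {f}) M] [Module.Finite (Q ⧸ Ideal.span {f}) M]
    [AddCommGroup N] [Module Q N] [Module (Q ⧸ Ideal.span {f}) N]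
    [IsScalarTower Q (Q ⧸ Ideal.span {f}) N] [Module.Finite (Q ⧸ Ideal.span {f}) N]
    (hgN : ∀ x : N, g • x = 0) (hMN : Module.length Q (M ⊗[Q] N) ≠ ⊤) :
    (∀ n, Module.length Q (torModule Q M N n) ≠ ⊤) ∧
    (∀ n, Module.length (Q ⧸ Ideal.span {f}) (torModule (Q ⧸ Ideal.span {f}) M N n) ≠ ⊤) ∧
    CoeffLE (poincareSeries (Q ⧸ Ideal.span {f}) M N)
      ((1 - PowerSeries.X + PowerSeries.X ^ 2) * poincareSeries Q M N *
        (1 - PowerSeries.X)⁻¹) ∧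
    CoeffLE (poincareSeries Q M N)
      (poincareSeries (Q ⧸ Ideal.span {f}) M N * (1 - PowerSeries.X)⁻¹) ∧
    Nonempty (SemifreeResolution f g M) ∧
    ∀ D : SemifreeResolution f g M,
      poincareSeries Q M N =
          poincareSeries (Q ⧸ Ideal.span {f}) M N * (1 - PowerSeries.X)⁻¹ ↔
        (∀ n, D.mu hfg N n = 0) ∧ ∀ n, D.delta hfg N n = 0 := by
  have hf : ∀ x : N, f • x = 0 := SemifreeResolution.smul_eq_zero_of_tower
  have hfM : ∀ x : M, f • x = 0 := SemifreeResolution.smul_eq_zero_of_tower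
  have hgf : g * f = 0 := by
    have h : g ∈ Ideal.torsionOf Q Q f := hfg.ann_left ▸ Ideal.mem_span_singleton_self g
    exact (Ideal.mem_torsionOf_iff _ _).1 h
  have : Module.Finite Q M := Module.Finite.trans (Q ⧸ Ideal.span {f}) M
  have : Module.Finite Q N := Module.Finite.trans (Q ⧸ Ideal.span {f}) N
  -- One resolution with finitely generated terms suffices for the finiteness claims, which do not
  -- refer to a resolution; the equivalence then holds for every `D`.
  obtain ⟨D₀, hD₀⟩ := exists_semifreeResolution (M := M) hgf hfM
  have hp : ∀ n, Module.length Q (torModule Q M N n) ≠ ⊤ :=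
    length_torModule_ne_top D₀.res hD₀ hMN
  have hr : ∀ n, Module.length (Q ⧸ Ideal.span {f}) (torModule (Q ⧸ Ideal.span {f}) M N n) ≠ ⊤ :=
    fun n => by
      rw [SemifreeResolution.length_torModule_VS D₀ hfg hgN]
      exact D₀.length_homology_V_ne_top N hfg
        (fun n => (length_torModule_US D₀ hf hgN n).symm.trans_ne (hp n)) n
  have key := fun D : SemifreeResolution f g M => D.coeffLE_of_length_ne_top N hfg
    (p := fun n => (Module.length Q (torModule Q M N n)).toNat)
    (r := fun n => (Module.length (Q ⧸ Ideal.span {f})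
      (torModule (Q ⧸ Ideal.span {f}) M N n)).toNat)
    (fun n => (length_torModule_US D hf hgN n).symm.trans (ENat.natCast_toNat (hp n)).symm)
    (fun n => (D.length_torModule_VS hfg hgN n).symm.trans (ENat.natCast_toNat (hr n)).symm)
  obtain ⟨⟨h₀, h₁⟩, h₂, _⟩ := key D₀
  exact ⟨hp, hr, coeffLE_mk_mul_mul_inv _ _ h₀ h₁, coeffLE_mk_mul_inv _ _ h₂, ⟨D₀⟩,
    fun D => (mk_eq_mk_mul_inv_iff _ _).trans (key D).2.2⟩
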